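/- **Conventions.** All objects depend on a security parameter $\eta\in\mathbb N$; instances $x\in\mathcal X_\eta$, witnesses, first messages $a$, challenges and responses $z$ are bit strings of polynomial length. A $\Sigma$-protocol $\Sigma$ for a relation $R$ has a first message $a$, a uniformly random challenge $c$ from a finite non-empty set $\mathcal C_\eta$, a response $z$, and a verification predicate $V(x,a,c,z)$; no correctness is required. The challenge space is efficiently samplable: for all $\eta,s$ a function of uniformly random bits, computed by a circuit of size polynomial in $\eta+s$, takes values in $\mathcal C_\eta$ with a distribution within statistical distance $2^{-s}$ of uniform. $\mathsf{FS}[\Sigma]$ replaces $c$ by $H(x,a)$, where $H$ is a uniformly random function (random oracle) with values in $\mathcal C_\eta$, queried in superposition; $V^H_{FS}(x,(a,z))$ means $V(x,a,H(x,a),z)$. An adversary consists of an arbitrary initial state and a sequence of unitaries on communication registers and a finite-dimensional internal register: two unitaries (before and after the challenge) for a dishonest $\Sigma$-prover, and one after each of its $q$ oracle queries for an adversary against $\mathsf{FS}[\Sigma]$. It is quantum polynomial-time (non-uniform, with quantum advice) if $q$, the number of qubits of its internal register and the circuit sizes of its unitaries are polynomially bounded. An extractor is a (non-uniform) family of quantum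 circuits whose gates may also be (controlled) calls of the adversary's unitaries and their inverses on the adversary's given initial state; a call counts as one step and only calls act on the internal register. Its size must be polynomial in $\eta$, respectively in $\eta$ and $q$ in the case of $\mathsf{FS}[\Sigma]$; it has no random oracle of its own. $\Sigma$ is a *statistical* (*computational*) *proof of knowledge for static adversaries* if there are a polynomial-size extractor $\mathcal K$, a polynomial $p>0$, a constant $d\ge 0$ and a negligible function $\kappa$ such that for all (all quantum polynomial-time) provers $\mathcal A$, all $\eta$ and all $x\in\mathcal X_\eta$ $$\Pr[(x,w)\in R: w\leftarrow\mathcal K^{\mathcal A}(x)]\ \ge\ \frac1{p(\eta)}\Pr[\langle\mathcal A,\mathcal V(x)\rangle=accept]^d-\kappa(\eta).$$ $\mathsf{FS}[\Sigma]$ is a *statistical* (*computational*) *proof of knowledge for adaptive adversaries* if there are a polynomial-size extractor $\mathcal E$, a polynomial $p>0$, constants $d,e\ge0$ and a negligible function $\mu$ such that for all (all quantum polynomial-time) adversaries $\mathcal A$, all $\eta$ and all $X\subseteq\mathcal X_\eta$ $$\Pr[x\in X\wedge(x,w)\in R:(x,w)\leftarrow\mathcal E^{\mathcal A}]\ \ge\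 \frac1{q^e\,p(\eta)}\Pr_H[x\in X\wedge V_{FS}^H(x,\pi):(x,\pi)\leftarrow\mathcal A^H]^d-\mu(\eta),$$ where $q$ is the number of queries of $\mathcal A$ (read as $1$ if there are none). In the computational case we also consider the variant in which the negligible function may depend on the adversary. **Corollary 2.** Let $\Sigma$ be a $\Sigma$-protocol as above with $|\mathcal C_\eta|$ superpolynomial. If $\Sigma$ is a statistical (computational, in either variant) proof of knowledge for static adversaries, then $\mathsf{FS}[\Sigma]$ is a statistical (computational, in the same variant) proof of knowledge for adaptive adversaries in the quantum random oracle model. Moreover, for every polynomial-size extractor $\mathcal K$ for $\Sigma$ there is a polynomial-size extractor $\mathcal E$ for $\mathsf{FS}[\Sigma]$ such that for every $d\ge0$ there is a constant $c>0$ with the following property, for each of these notions and every polynomial $p>0$: if $\mathcal K$ satisfies the static condition with parameters $p,d$ (and some negligible function), then $\mathcal E$ satisfies the adaptive condition with $c\,p$ in place of $p$, with $d'=\max(d,1)$ in place of $d$, and with $e=2d'$; that is, the success degrades by a factor $O(q^{2d'})$. -/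

import Mathlib

noncomputable section

namespace FiatShamir

open scoped Polynomial

/-! ### Registers, states, circuits -/

/-- Bit strings indexed by a set `W` of wires; they label the computational basis of the
qubits `W`. A (not necessarily normalised) state over a finite basis `ι` is a function `ι → ℂ`. -/
abbrev Bits (W : Type) : Type := W → Bool

/-- Bit strings of length `n`. -/
abbrev BitString (n : ℕ) : Type := Bits (Fin n)

/-- The all-zero string. -/
def zeros (W : Type) : Bits W := fun _ => false

/-- Probability that measuring `ψ` in the computational basis gives an outcome in `S`
(for a subnormalised `ψ`: jointly with the event that led to `ψ`). -/
def measureProb {ι : Type} [Fintype ι] (ψ : ι → ℂ) (S : Set ι) : ℝ :=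
  ∑ i, S.indicator (fun i => ‖ψ i‖ ^ 2) i

/-- A gate: a unitary on `arity` qubits, applied to distinct wires of `W`. -/
structure Gate (W : Type) where
  arity : ℕ
  wires : Fin arity ↪ W
  unitary : Matrix.unitaryGroup (BitString arity) ℂ

/-- A unitary on `k` qubits is charged the number `4 ^ k` of its matrix entries, the order of the
number of two-qubit gates that suffice to implement it. Gates of bounded arity have cost `O(1)`. -/
def Gate.cost {W : Type} (g : Gate W) : ℕ := 4 ^ g.arity

open Classical in
/-- The action of a gate on all wires: the identity outside the wires it touches. -/
def Gate.matrix {W : Type} (g : Gate W) : Matrix (Bits W) (Bits W) ℂ := fun b b' =>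
  if ∀ v, v ∉ Set.range g.wires → b v = b' v then
    (g.unitary : Matrix (BitString g.arity) (BitString g.arity) ℂ) (b ∘ g.wires) (b' ∘ g.wires)
  else 0

/-- A circuit is a list of gates; the head of the list is applied first. -/
abbrev Circuit (W : Type) : Type := List (Gate W)

def Circuit.cost {W : Type} (C : Circuit W) : ℕ := (C.map Gate.cost).sum

/-- The unitary computed by a circuit. -/
def Circuit.matrix {W : Type} [Fintype W] [DecidableEq W] (C : Circuit W) :
    Matrix (Bits W) (Bits W) ℂ :=
  C.foldl (fun M g => g.matrix * M) 1

/-! ### Adversaries -/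

/-- An adversary with communication wires `N` and `m` steps: an arbitrary initial state and
arbitrary unitaries on the communication wires together with a finite-dimensional internal
register, with basis `E`. -/
structure Adversary (N : Type) [Fintype N] [DecidableEq N] (m : ℕ) where
  E : Type
  fintypeE : Fintype E
  decidableEqE : DecidableEq E
  init : Bits N × E → ℂ
  init_norm : ∑ i, ‖init i‖ ^ 2 = 1
  step : Fin m → Matrix.unitaryGroup (Bits N × E) ℂ

attribute [instance] Adversary.fintypeE Adversary.decidableEqE

/-- The adversary has circuits of size at most `b`: its internal register consists of at most `b`
qubits and each of its unitaries is computed by a circuit of cost at most `b`.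
The initial state is unrestricted (quantum advice). -/
def Adversary.HasCircuits {N : Type} [Fintype N] [DecidableEq N] {m : ℕ}
    (A : Adversary N m) (b : ℕ) : Prop :=
  ∃ (n : ℕ) (e : A.E ≃ BitString n), n ≤ b ∧
    ∀ j : Fin m, ∃ C : Circuit (N ⊕ Fin n), C.cost ≤ b ∧
      ∀ p p' : Bits N × A.E,
        (A.step j : Matrix (Bits N × A.E) (Bits N × A.E) ℂ) p p' =
          C.matrix (Sum.elim p.1 (e p.2)) (Sum.elim p'.1 (e p'.2))

/-! ### Black-box algorithms -/

/-- An instruction of an algorithm on the wires `W` with black-box access to an adversary: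
either a gate on its own wires, or a call of one of the adversary's unitaries or of its inverse.
A call connects wires `port` to the adversary's communication register and is performed if the
wire `control` holds 1. Only calls act on the adversary's internal register. -/
inductive Instr (N W : Type) (m : ℕ) where
  | gate (g : Gate W)
  | call (j : Fin m) (inverse : Bool) (port : N ↪ W) (control : W)
      (control_notMem : control ∉ Set.range port)

/-- A call costs one step. -/
def Instr.cost {N W : Type} {m : ℕ} : Instr N W m → ℕ
  | .gate g => g.cost
  | .call _ _ _ _ _ => 1

open Classical in
/-- The unitary performed by an instruction, on the wires `W` and the internal register of `A`. -/
def Instr.matrix {N W : Type} [Fintype N] [DecidableEq N] [Fintype W] [DecidableEq W] {m : ℕ}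
    (A : Adversary N m) : Instr N W m → Matrix (Bits W × A.E) (Bits W × A.E) ℂ
  | .gate g => fun p p' => if p.2 = p'.2 then g.matrix p.1 p'.1 else 0
  | .call j inverse port control _ => fun p p' =>
      if p.1 control = true then
        if ∀ v, v ∉ Set.range port → p.1 v = p'.1 v then
          ((if inverse = true then (A.step j)⁻¹ else A.step j :
              Matrix.unitaryGroup (Bits N × A.E) ℂ) : Matrix (Bits N × A.E) (Bits N × A.E) ℂ)
            (p.1 ∘ port, p.2) (p'.1 ∘ port, p'.2)
        else 0
      else (1 : Matrix (Bits W × A.E) (Bits W × A.E) ℂ) p p'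

/-- A quantum algorithm with input wires `In`, output wires `Out` and black-box access to
adversaries with communication wires `N` and `m` steps: a list of instructions (the head is
performed first) on the wires `N`, `In`, `Out` and `work` further ones. Measurements are deferred
to the end. -/
structure BlackBoxAlg (N In Out : Type) (m : ℕ) where
  work : ℕ
  prog : List (Instr N (N ⊕ In ⊕ Out ⊕ Fin work) m)

namespace BlackBoxAlg

variable {N In Out : Type} {m : ℕ}

def cost (K : BlackBoxAlg N In Out m) : ℕ := (K.prog.map Instr.cost).sum

open Classical in
/-- Initially the wires `N` and the internal register hold the adversary's initial state, the input
wires hold the input and all other wires hold 0. -/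
def initState [Fintype N] [DecidableEq N] (K : BlackBoxAlg N In Out m)
    (A : Adversary N m) (x : Bits In) : Bits (N ⊕ In ⊕ Out ⊕ Fin K.work) × A.E → ℂ := fun p =>
  if p.1 ∘ Sum.inr = Sum.elim x (zeros (Out ⊕ Fin K.work)) then A.init (p.1 ∘ Sum.inl, p.2) else 0

/-- The probability that `K`, on input `x` and with black-box access to `A`, produces an output
in `S`. -/
def outputProb [Fintype N] [DecidableEq N] [Fintype In] [DecidableEq In]
    [Fintype Out] [DecidableEq Out] (K : BlackBoxAlg N In Out m)
    (A : Adversary N m) (x : Bits In) (S : Set (Bits Out)) : ℝ :=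
  measureProb
    (K.prog.foldl (fun ψ instr => (instr.matrix A).mulVec ψ) (K.initState A x))
    {p | (fun o => p.1 (Sum.inr (Sum.inr (Sum.inl o)))) ∈ S}

end BlackBoxAlg

/-! ### Protocols -/

/-- A three-round public-coin protocol for a relation `rel`, depending on a security parameter.
All objects are encoded as bit strings of polynomial length. The honest prover is described by the
distribution of its first message and by the distribution of its response given the first message
and the challenge; no correctness is required. -/
structure SigmaProtocol where
  instLen : ℕ → ℕ
  witLen : ℕ → ℕ
  msgLen : ℕ → ℕ
  chalLen : ℕ → ℕ
  respLen : ℕ → ℕ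
  len_poly : ∃ b : ℕ[X], ∀ η,
    instLen η + witLen η + msgLen η + chalLen η + respLen η ≤ b.eval η
  /-- the set of instances -/
  inst : ∀ η, Set (BitString (instLen η))
  /-- the relation between instances and witnesses -/
  rel : ∀ η, BitString (instLen η) → BitString (witLen η) → Prop
  inst_of_rel : ∀ η x w, rel η x w → x ∈ inst η
  /-- the challenge space -/
  chal : ∀ η, Finset (BitString (chalLen η))
  chal_nonempty : ∀ η, (chal η).Nonempty
  commit : ∀ η, BitString (instLen η) → BitString (witLen η) → PMF (BitString (msgLen η))
  respond : ∀ η, BitString (instLen η) → BitString (witLen η) → BitString (msgLen η) →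
    BitString (chalLen η) → PMF (BitString (respLen η))
  /-- the verification predicate `V(x, a, c, z)` -/
  verify : ∀ η, BitString (instLen η) → BitString (msgLen η) → BitString (chalLen η) →
    BitString (respLen η) → Prop

/-- Quantum algorithms: unbounded, or of polynomial size. For the latter, the negligible
error is either uniform in the adversary or may depend on it. -/
inductive Security where
  | statistical
  | computational
  | computationalPerAdversary

/-- `μ` is negligible: it vanishes faster than the inverse of every polynomial. -/
def Negligible (μ : ℕ → ℝ) : Prop :=
  Asymptotics.SuperpolynomialDecay Filter.atTop (fun η : ℕ => (η : ℝ)) μ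

/-- `f` grows faster than every polynomial. -/
def Superpolynomial (f : ℕ → ℕ) : Prop := ∀ k : ℕ, ∀ᶠ η in Filter.atTop, η ^ k ≤ f η

/-- The bound `bound A μ`, with `μ` negligible, holds for all adversaries `A` of the class
described by the type of security; `eff` singles out the polynomial-size adversaries. -/
def ForAllAdversaries {Adv : Type*} (s : Security) (eff : Adv → Prop)
    (bound : Adv → (ℕ → ℝ) → Prop) : Prop :=
  match s with
  | .statistical => ∃ μ, Negligible μ ∧ ∀ A, bound A μ
  | .computational => ∃ μ, Negligible μ ∧ ∀ A, eff A → bound A μ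
  | .computationalPerAdversary => ∀ A, eff A → ∃ μ, Negligible μ ∧ bound A μ

namespace SigmaProtocol

variable (P : SigmaProtocol)

/-- The challenge space can be sampled efficiently, with exponentially small error: some function
`f` on uniformly random bits, with a circuit of size polynomial in `η` and `s`, has values in the
challenge space and a distribution within statistical distance `2 ^ (-s)` of uniform. -/
def ChallengeSamplable : Prop :=
  ∃ b : ℕ[X], ∀ η s : ℕ, ∃ (n anc : ℕ) (f : BitString n → BitString (P.chalLen η))
    (C : Circuit (Fin n ⊕ Fin (P.chalLen η) ⊕ Fin anc)),
    n ≤ b.eval (η + s) ∧ C.cost ≤ b.eval (η + s) ∧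
    (∀ r, f r ∈ P.chal η) ∧
    (1 / 2 : ℝ) * ∑ c ∈ P.chal η,
      |((Finset.univ.filter fun r => f r = c).card : ℝ) / 2 ^ n - 1 / ((P.chal η).card : ℝ)|
        ≤ (1 / 2 : ℝ) ^ s ∧
    ∀ r : BitString n,
      C.matrix.mulVec (Pi.single (Sum.elim r (Sum.elim (zeros _) (zeros _))) 1) =
        Pi.single (Sum.elim r (Sum.elim (f r) (zeros _))) 1

/-! #### Static adversaries against the interactive protocol -/

/-- The communication wires of a static prover: first message, challenge, response. -/
abbrev Wires (η : ℕ) : Type := Fin (P.msgLen η) ⊕ Fin (P.chalLen η) ⊕ Fin (P.respLen η)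

/-- A dishonest prover: a first stage, producing the first message, and a second stage, producing
the response. -/
abbrev Prover (η : ℕ) : Type 1 := Adversary (P.Wires η) 2

/-- Delivery of the challenge `c`: it is added bitwise to the challenge register. -/
def deliver {η : ℕ} {E : Type} (c : BitString (P.chalLen η)) (ψ : Bits (P.Wires η) × E → ℂ) :
    Bits (P.Wires η) × E → ℂ := fun p =>
  ψ (fun v => xor (p.1 v) (Sum.elim (zeros _) (Sum.elim c (zeros _)) v), p.2)

/-- `Pr[⟨A, V(x)⟩ = accept]`: run the first stage, measure the first message `a`, deliver a
uniformly random challenge `c`, run the second stage, measure the response `z`, check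
`V(x, a, c, z)`. -/
def acceptProb {η : ℕ} (A : P.Prover η) (x : BitString (P.instLen η)) : ℝ :=
  (∑ c ∈ P.chal η, ∑ a : BitString (P.msgLen η),
    measureProb
      ((A.step 1).1.mulVec (P.deliver c
        (({p | p.1 ∘ Sum.inl = a} : Set (Bits (P.Wires η) × A.E)).indicator
          ((A.step 0).1.mulVec A.init))))
      {p | P.verify η x a c (fun k => p.1 (Sum.inr (Sum.inr k)))}) / ((P.chal η).card : ℝ)

/-- A family of black-box extractors that, given an instance and a static prover, output a
candidate witness. -/
abbrev Extractor : Type :=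
  ∀ η, BlackBoxAlg (P.Wires η) (Fin (P.instLen η)) (Fin (P.witLen η)) 2

def Extractor.PolyTime {P : SigmaProtocol} (K : P.Extractor) : Prop :=
  ∃ b : ℕ[X], ∀ η, (K η).cost ≤ b.eval η

/-- `K` extracts witnesses from static provers, with parameters `p` and `d`. -/
def StaticExtracts (s : Security) (K : P.Extractor) (p : ℝ[X]) (d : ℝ) : Prop :=
  ForAllAdversaries s
    (fun A : ∀ η, P.Prover η => ∃ b : ℕ[X], ∀ η, (A η).HasCircuits (b.eval η))
    (fun A κ => ∀ η, ∀ x ∈ P.inst η,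
      1 / p.eval (η : ℝ) * P.acceptProb (A η) x ^ d - κ η
        ≤ (K η).outputProb (A η) x {w | P.rel η x w})

/-- The protocol is a proof of knowledge for static adversaries. -/
def IsStaticPoK (s : Security) : Prop :=
  ∃ (K : P.Extractor) (p : ℝ[X]) (d : ℝ), K.PolyTime ∧ (∀ η : ℕ, 0 < p.eval (η : ℝ)) ∧ 0 ≤ d ∧
    P.StaticExtracts s K p d

/-! #### The Fiat-Shamir transformation and its adaptive adversaries -/

/-- Hash functions; the random oracle is a uniformly random one. -/
abbrev Hash (η : ℕ) : Type :=
  BitString (P.instLen η) × BitString (P.msgLen η) → {c // c ∈ P.chal η}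

/-- The verifier of the Fiat-Shamir transform, for a proof `π = (a, z)`. -/
def fsVerify {η : ℕ} (H : P.Hash η) (x : BitString (P.instLen η))
    (π : BitString (P.msgLen η) × BitString (P.respLen η)) : Prop :=
  P.verify η x π.1 (H (x, π.1)) π.2

open Classical in
/-- The honest prover of the Fiat-Shamir transform, with a bounded number of retries. -/
def fsProve {η : ℕ} (H : P.Hash η) (x : BitString (P.instLen η)) (w : BitString (P.witLen η)) :
    ℕ → PMF (BitString (P.msgLen η) × BitString (P.respLen η))
  | 0 => (P.commit η x w).bind fun a => (P.respond η x w a (H (x, a))).map fun z => (a, z)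
  | n + 1 => ((P.commit η x w).bind fun a =>
      (P.respond η x w a (H (x, a))).map fun z => (a, z)).bind fun π =>
        if P.fsVerify H x π then PMF.pure π else fsProve H x w n

/-- The communication wires of an adaptive adversary against the Fiat-Shamir transform: the query
register, for an instance and a first message, which also receives this part of the final output;
the register for the oracle's answer; and the register for the response. -/
abbrev FSWires (η : ℕ) : Type :=
  (Fin (P.instLen η) ⊕ Fin (P.msgLen η)) ⊕ Fin (P.chalLen η) ⊕ Fin (P.respLen η)

/-- An adversary making `q` queries: unitary `j` is applied after query `j`. -/
abbrev FSAdversary (η q : ℕ) : Type 1 := Adversary (P.FSWires η) q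

/-- The instance part and the first-message part of the query register. -/
def queryReg {η : ℕ} (b : Bits (P.FSWires η)) :
    BitString (P.instLen η) × BitString (P.msgLen η) :=
  (fun i => b (Sum.inl (Sum.inl i)), fun i => b (Sum.inl (Sum.inr i)))

/-- A superposition query to `H`: `|x, a⟩|y⟩ ↦ |x, a⟩|y ⊕ H(x, a)⟩`. -/
def query {η : ℕ} {E : Type} (H : P.Hash η) (ψ : Bits (P.FSWires η) × E → ℂ) :
    Bits (P.FSWires η) × E → ℂ := fun p =>
  ψ (fun v => xor (p.1 v)
      (Sum.elim (zeros _) (Sum.elim (H (P.queryReg p.1)).1 (zeros _)) v), p.2)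

/-- The final state of the adversary, run with oracle `H`. -/
def fsFinalState {η q : ℕ} (A : P.FSAdversary η q) (H : P.Hash η) :
    Bits (P.FSWires η) × A.E → ℂ :=
  (List.finRange q).foldl (fun ψ j => (A.step j).1.mulVec (P.query H ψ)) A.init

/-- `Pr_H[x ∈ X ∧ V_FS^H(x, π) : (x, π) ← A^H]`. -/
def fsSuccessProb {η q : ℕ} (A : P.FSAdversary η q) (X : Set (BitString (P.instLen η))) : ℝ :=
  (∑ H : P.Hash η, measureProb (P.fsFinalState A H)
    {p | (P.queryReg p.1).1 ∈ X ∧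
      P.fsVerify H (P.queryReg p.1).1
        ((P.queryReg p.1).2, fun k => p.1 (Sum.inr (Sum.inr k)))}) / (Fintype.card (P.Hash η) : ℝ)

/-- A family of black-box extractors that, given an adaptive adversary making `q` queries, output
an instance and a candidate witness. They have no random oracle of their own. -/
abbrev FSExtractor : Type :=
  ∀ η q, BlackBoxAlg (P.FSWires η) Empty (Fin (P.instLen η) ⊕ Fin (P.witLen η)) q

/-- Size polynomial in the security parameter and the number of queries. -/
def FSExtractor.PolyTime {P : SigmaProtocol} (K : P.FSExtractor) : Prop :=
  ∃ b : ℕ[X], ∀ η q, (K η q).cost ≤ b.eval (η + q)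

/-- `K` extracts witnesses from adaptive adversaries against the Fiat-Shamir transform, with
parameters `p`, `d` and `e`. For an adversary without queries, `q` is read as 1. -/
def FSAdaptiveExtracts (s : Security) (K : P.FSExtractor) (p : ℝ[X]) (d e : ℝ) : Prop :=
  ForAllAdversaries s
    (fun A : ∀ η, Σ q, P.FSAdversary η q => ∃ b : ℕ[X], ∀ η,
      (A η).1 ≤ b.eval η ∧ (A η).2.HasCircuits (b.eval η))
    (fun A μ => ∀ η, ∀ X ⊆ P.inst η,
      1 / ((max (A η).1 1 : ℕ) ^ e * p.eval (η : ℝ)) * P.fsSuccessProb (A η).2 X ^ d - μ η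
        ≤ (K η (A η).1).outputProb (A η).2 Empty.elim
            {o | o ∘ Sum.inl ∈ X ∧ P.rel η (o ∘ Sum.inl) (o ∘ Sum.inr)})

/-- The Fiat-Shamir transform is a proof of knowledge for adaptive adversaries. -/
def FSIsAdaptivePoK (s : Security) : Prop :=
  ∃ (K : P.FSExtractor) (p : ℝ[X]) (d e : ℝ), K.PolyTime ∧ (∀ η : ℕ, 0 < p.eval (η : ℝ)) ∧
    0 ≤ d ∧ 0 ≤ e ∧ P.FSAdaptiveExtracts s K p d e

end SigmaProtocol

end FiatShamir

end

/-!
# Fiat-Shamir in the quantum random oracle model is a proof of knowledge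

From an adversary `A` against the Fiat-Shamir transform, which makes `q` queries, one derives static
provers for the `Σ`-protocol, and the adaptive extractor is the static extractor applied to them.

**The derived prover.** Choose at random one of the `q + 1` points where `A` makes a query or outputs
its result, and a flag. Run `A` up to this point and measure the query register; the result `(x, a)`
gives the instance and the first message. When the challenge `c` arrives, reprogram the hash function
at `(x, a)` to `c`, from this query on or from the next one on, according to the flag, and complete
the run of `A`. The central estimate is `measureProb_finalState_update_le`: a run with the
reprogrammed function is a telescoping sum of `2q + 1` runs of this kind (`runRounds_eq_add_sum`), as
replacing one function by the other in a single query makes a difference only where the query is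
`(x, a)`. By Cauchy-Schwarz, and since a random function reprogrammed to a random value is again a
random function, the derived prover is accepted, with the instance in `X`, with probability at least a
constant times `(q + 1)⁻² Pr[A succeeds]` (`fsSuccessProb_le_sum`).

**The hash function.** The extractor has no random oracle. The amplitudes of these runs are sums of
functions of at most `2q` hash values each (`juntas`), the probabilities accordingly of `4q` values,
so a polynomial of degree less than `4q` with random coefficients, over a field of characteristic 2,
behaves exactly as a random function (`sum_polyHash`). Its values are used as the random bits of the
sampler for the challenge space. The sampler is not exactly uniform, but if its error is exponentially
small in the length of the queries, then each hash function still has at least half of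
its uniform probability (`half_sum_le_sum`). This loses only a factor of 2 (`HashScheme.HalfFools`).

**Black-box access.** The static extractor has access to the prover through controlled calls of its
two stages and their inverses. The preparation, including the measurement of `x`, precedes these
calls: the first stage of the prover does nothing, its initial state is the state after the
preparation, projected to the held instance `x`. This state need not be efficient, as initial states
are arbitrary. The second stage is a program of gates and calls of `A`; it preserves the wires that
hold `x`, so the measurement of `x` may be deferred to the end. Hence the adaptive extractor succeeds
with the average over `x` of the success of the static one (`outputProb_extractor`). Controlling the
second stage is cheap: the gates that compute the hash value are undone anyhow, and each call of a
unitary of `A` is paired with a call of its inverse that is made when the first one is not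
(`stepBlock`), so only classical gates have to be controlled. The measured query is not measured
either, but copied to the wires of the instance and the first message.

**Conclusion.** The function `t ↦ t ^ max d 1` is convex, so the bounds for the single instances give the
one for the average (`fsExtractor_success`). In the variant with an error that depends on the
adversary, the instances for which the static extractor performs worst are hard-wired into the
derived prover (`fsAdaptiveExtracts`).
-/

set_option linter.unusedSectionVars false
set_option synthInstance.maxSize 1000

noncomputable section

namespace FiatShamir

open scoped Polynomial

/-! ### Operators on some of the wires -/

section Operators

variable {W W₁ W₂ W₃ E : Type} [Fintype W] [DecidableEq W] [Fintype W₁] [DecidableEq W₁]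
  [Fintype W₂] [DecidableEq W₂] [Fintype W₃] [DecidableEq W₃] [Fintype E] [DecidableEq E]

/-- Operators on the wires `W` together with a register with basis `E`. -/
abbrev Oper (W E : Type) : Type := Matrix (Bits W × E) (Bits W × E) ℂ

open Classical in
/-- The operator `M`, transported along an embedding of wires and acting as the identity on the
wires outside its range. -/
def ext (ι : W₁ ↪ W₂) (M : Oper W₁ E) : Oper W₂ E := fun p p' =>
  if ∀ v, v ∉ Set.range ι → p.1 v = p'.1 v then M (p.1 ∘ ι, p.2) (p'.1 ∘ ι, p'.2) else 0

/-- The state of the wires in the range of `ι` and of the register, when the values of the other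
wires are fixed to be those of `b`. -/
def slice (ι : W₁ ↪ W₂) (b : Bits W₂) (ψ : Bits W₂ × E → ℂ) : Bits W₁ × E → ℂ := fun p =>
  ψ (Function.extend ι p.1 b, p.2)

/-- The operator that applies `M` if the wire `c` holds 1 and `N` if it holds 0. -/
def sel (c : W) (M N : Oper W E) : Oper W E := fun p p' => if p.1 c = true then M p p' else N p p'

/-- `M` is block diagonal with respect to the value of the wire `c`. -/
def Keeps (c : W) (M : Oper W E) : Prop := ∀ p p', p.1 c ≠ p'.1 c → M p p' = 0

/-- `M ⊗ 1`, with the identity acting on the register. -/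
def tensorOne (M : Matrix (Bits W) (Bits W) ℂ) : Oper W E := fun p p' =>
  if p.2 = p'.2 then M p.1 p'.1 else 0

theorem extend_off {ι : W₁ ↪ W₂} {c : Bits W₁} {b : Bits W₂} {v : W₂} (h : v ∉ Set.range ι) :
    Function.extend ι c b v = b v := Function.extend_apply' _ _ _ h

theorem extend_comp {ι : W₁ ↪ W₂} (c : Bits W₁) (b : Bits W₂) :
    Function.extend ι c b ∘ ι = c := Function.extend_comp ι.injective _ _

theorem extend_extend {ι : W₁ ↪ W₂} (c c' : Bits W₁) (b : Bits W₂) :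
    Function.extend ι c (Function.extend ι c' b) = Function.extend ι c b := by
  funext v
  by_cases h : v ∈ Set.range ι
  · obtain ⟨w, rfl⟩ := h
    simp [ι.injective.extend_apply]
  · rw [extend_off h, extend_off h, extend_off h]

theorem extend_self {ι : W₁ ↪ W₂} {b b' : Bits W₂} (h : ∀ v, v ∉ Set.range ι → b v = b' v) :
    Function.extend ι (b' ∘ ι) b = b' := by
  funext v
  by_cases hv : v ∈ Set.range ι
  · obtain ⟨w, rfl⟩ := hv
    simp [ι.injective.extend_apply]
  · rw [extend_off hv, h v hv]

theorem ext_apply_of {ι : W₁ ↪ W₂} {M : Oper W₁ E} {p p' : Bits W₂ × E}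
    (h : ∀ v, v ∉ Set.range ι → p.1 v = p'.1 v) :
    ext ι M p p' = M (p.1 ∘ ι, p.2) (p'.1 ∘ ι, p'.2) := if_pos h

theorem ext_apply_of_not {ι : W₁ ↪ W₂} {M : Oper W₁ E} {p p' : Bits W₂ × E}
    (h : ¬ ∀ v, v ∉ Set.range ι → p.1 v = p'.1 v) : ext ι M p p' = 0 := if_neg h

theorem mulVec_eq {ι : Type*} [Fintype ι] (M : Matrix ι ι ℂ) (ψ : ι → ℂ) (p : ι) :
    M.mulVec ψ p = ∑ q, M p q * ψ q := rfl

/-- `ext ι M` acts as `M` on each of the states of the wires in the range of `ι` that are obtained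
by fixing the values of the other wires. -/
theorem ext_mulVec (ι : W₁ ↪ W₂) (M : Oper W₁ E) (ψ : Bits W₂ × E → ℂ) (p : Bits W₂ × E) :
    (ext ι M).mulVec ψ p = M.mulVec (slice ι p.1 ψ) (p.1 ∘ ι, p.2) := by
  classical
  rw [mulVec_eq, mulVec_eq]
  symm
  refine Fintype.sum_of_injective (fun q : Bits W₁ × E => (Function.extend ι q.1 p.1, q.2)) ?_ _ _
    ?_ ?_
  · rintro ⟨c, e⟩ ⟨c', e'⟩ h
    simp only [Prod.mk.injEq] at h ⊢
    refine ⟨?_, h.2⟩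
    rw [← extend_comp (ι := ι) c p.1, h.1, extend_comp]
  · rintro ⟨b', e'⟩ h
    rw [ext_apply_of_not, zero_mul]
    intro h'
    exact h ⟨(b' ∘ ι, e'), by simp only [Prod.mk.injEq, and_true]; exact extend_self h'⟩
  · rintro ⟨c, e⟩
    rw [ext_apply_of]
    · simp only [slice, extend_comp]
    · exact fun v hv => (extend_off hv).symm

theorem slice_slice (ι : W₁ ↪ W₂) (b : Bits W₂) (c : Bits W₁) (ψ : Bits W₂ × E → ℂ) :
    slice ι (Function.extend ι c b) ψ = slice ι b ψ := by
  funext p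
  simp only [slice, extend_extend]

theorem slice_ext_mulVec (ι : W₁ ↪ W₂) (M : Oper W₁ E) (ψ : Bits W₂ × E → ℂ) (b : Bits W₂) :
    slice ι b ((ext ι M).mulVec ψ) = M.mulVec (slice ι b ψ) := by
  funext p
  rw [slice, ext_mulVec, slice_slice, extend_comp]

theorem slice_eval (ι : W₁ ↪ W₂) (ψ : Bits W₂ × E → ℂ) (p : Bits W₂ × E) :
    slice ι p.1 ψ (p.1 ∘ ι, p.2) = ψ p := by
  rw [slice, extend_self (fun _ _ => rfl)]

theorem oper_ext {M N : Oper W E} (h : ∀ ψ p, M.mulVec ψ p = N.mulVec ψ p) : M = N :=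
  Matrix.ext_of_mulVec_single fun _ => funext fun _ => h _ _

theorem ext_mul (ι : W₁ ↪ W₂) (M N : Oper W₁ E) : ext ι (M * N) = ext ι M * ext ι N := by
  refine oper_ext fun ψ p => ?_
  rw [← Matrix.mulVec_mulVec, ext_mulVec, ext_mulVec, slice_ext_mulVec, Matrix.mulVec_mulVec]

theorem ext_one (ι : W₁ ↪ W₂) : ext ι (1 : Oper W₁ E) = 1 := by
  refine oper_ext fun ψ p => ?_
  rw [ext_mulVec, Matrix.one_mulVec, Matrix.one_mulVec, slice_eval]

theorem ext_conjTranspose (ι : W₁ ↪ W₂) (M : Oper W₁ E) :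
    ext ι M.conjTranspose = (ext ι M).conjTranspose := by
  classical
  funext p p'
  by_cases h : ∀ v, v ∉ Set.range ι → p.1 v = p'.1 v
  · rw [ext_apply_of h, Matrix.conjTranspose_apply, Matrix.conjTranspose_apply,
      ext_apply_of fun v hv => (h v hv).symm]
  · rw [ext_apply_of_not h, Matrix.conjTranspose_apply,
      ext_apply_of_not fun h' => h fun v hv => (h' v hv).symm, star_zero]

theorem ext_ext (ι : W₁ ↪ W₂) (κ : W₂ ↪ W₃) (M : Oper W₁ E) :
    ext κ (ext ι M) = ext (ι.trans κ) M := by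
  classical
  funext p p'
  by_cases h : ∀ v, v ∉ Set.range (ι.trans κ) → p.1 v = p'.1 v
  · rw [ext_apply_of h, ext_apply_of, ext_apply_of]
    · rfl
    · rintro v hv
      refine h _ ?_
      rintro ⟨w, hw⟩
      exact hv ⟨w, κ.injective hw⟩
    · rintro v hv
      refine h _ ?_
      rintro ⟨w, rfl⟩
      exact hv ⟨ι w, rfl⟩
  · rw [ext_apply_of_not h]
    by_cases h' : ∀ v, v ∉ Set.range κ → p.1 v = p'.1 v
    · rw [ext_apply_of h', ext_apply_of_not]
      intro h''
      refine h fun v hv => ?_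
      by_cases hvk : v ∈ Set.range κ
      · obtain ⟨u, rfl⟩ := hvk
        refine h'' u ?_
        rintro ⟨w, rfl⟩
        exact hv ⟨w, rfl⟩
      · exact h' v hvk
    · rw [ext_apply_of_not h']

theorem mul_conjTranspose_of_unitary {ι : Type*} [Fintype ι] [DecidableEq ι] {M : Matrix ι ι ℂ}
    (h : M ∈ Matrix.unitaryGroup ι ℂ) : M * M.conjTranspose = 1 := Matrix.mem_unitaryGroup_iff.1 h

theorem conjTranspose_mul_of_unitary {ι : Type*} [Fintype ι] [DecidableEq ι] {M : Matrix ι ι ℂ}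
    (h : M ∈ Matrix.unitaryGroup ι ℂ) : M.conjTranspose * M = 1 := Matrix.mem_unitaryGroup_iff'.1 h

theorem ext_mem_unitary (ι : W₁ ↪ W₂) {M : Oper W₁ E} (h : M ∈ Matrix.unitaryGroup _ ℂ) :
    ext ι M ∈ Matrix.unitaryGroup _ ℂ := by
  refine Matrix.mem_unitaryGroup_iff.2 ?_
  change ext ι M * (ext ι M).conjTranspose = 1
  rw [← ext_conjTranspose, ← ext_mul, mul_conjTranspose_of_unitary h, ext_one]

theorem Keeps.one (c : W) : Keeps c (1 : Oper W E) := by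
  intro p p' h
  rw [Matrix.one_apply_ne]
  rintro rfl
  exact h rfl

theorem Keeps.mul {c : W} {M N : Oper W E} (hM : Keeps c M) (hN : Keeps c N) :
    Keeps c (M * N) := by
  intro p p' h
  rw [Matrix.mul_apply]
  refine Finset.sum_eq_zero fun q _ => ?_
  by_cases h' : p.1 c = q.1 c
  · rw [hN q p' (h' ▸ h), mul_zero]
  · rw [hM p q h', zero_mul]

theorem Keeps.conjTranspose {c : W} {M : Oper W E} (hM : Keeps c M) : Keeps c M.conjTranspose := by
  intro p p' h
  rw [Matrix.conjTranspose_apply, hM p' p h.symm, star_zero]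

/-- An operator is block diagonal with respect to each wire that it does not touch. -/
theorem Keeps.ext_of_notMem {c : W₂} {ι : W₁ ↪ W₂} (h : c ∉ Set.range ι) (M : Oper W₁ E) :
    Keeps c (ext ι M) := fun _ _ hp => ext_apply_of_not fun h' => hp (h' c h)

theorem Keeps.ext {c : W₁} {M : Oper W₁ E} (ι : W₁ ↪ W₂) (h : Keeps c M) :
    Keeps (ι c) (ext ι M) := by
  classical
  intro p p' hp
  by_cases h' : ∀ v, v ∉ Set.range ι → p.1 v = p'.1 v
  · rw [ext_apply_of h']
    exact h _ _ hp
  · exact ext_apply_of_not h'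

theorem sel_apply (c : W) (M N : Oper W E) (p p' : Bits W × E) :
    sel c M N p p' = if p.1 c = true then M p p' else N p p' := rfl

theorem Keeps.sel {c d : W} {M N : Oper W E} (hM : Keeps d M) (hN : Keeps d N) :
    Keeps d (sel c M N) := by
  intro p p' h
  unfold FiatShamir.sel
  split
  · exact hM _ _ h
  · exact hN _ _ h

theorem sel_mul {c : W} {M M' N N' : Oper W E} (hM : Keeps c M) (hN : Keeps c N) :
    sel c M N * sel c M' N' = sel c (M * M') (N * N') := by
  funext p p'
  rw [sel_apply]
  split_ifs with h
  · rw [Matrix.mul_apply, Matrix.mul_apply]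
    refine Finset.sum_congr rfl fun q _ => ?_
    rw [sel_apply, sel_apply, if_pos h]
    by_cases hq : q.1 c = true
    · rw [if_pos hq]
    · rw [hM p q (by rw [h]; exact fun h' => hq h'.symm), zero_mul, zero_mul]
  · rw [Matrix.mul_apply, Matrix.mul_apply]
    refine Finset.sum_congr rfl fun q _ => ?_
    rw [sel_apply, sel_apply, if_neg h]
    by_cases hq : q.1 c = true
    · rw [hN p q (by rw [hq]; exact h), zero_mul, zero_mul]
    · rw [if_neg hq]

theorem sel_self (c : W) (M : Oper W E) : sel c M M = M := by
  funext p p'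
  simp [sel]

theorem sel_conjTranspose {c : W} {M N : Oper W E} (hM : Keeps c M) (hN : Keeps c N) :
    (sel c M N).conjTranspose = sel c M.conjTranspose N.conjTranspose := by
  funext p p'
  simp only [sel, Matrix.conjTranspose_apply]
  by_cases h : p.1 c = p'.1 c
  · rw [h]
    split_ifs <;> rfl
  · rw [hM p' p (Ne.symm h), hN p' p (Ne.symm h), ite_self, ite_self]

theorem sel_mem_unitary {c : W} {M N : Oper W E} (hM : Keeps c M) (hN : Keeps c N)
    (hM' : M ∈ Matrix.unitaryGroup _ ℂ) (hN' : N ∈ Matrix.unitaryGroup _ ℂ) :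
    sel c M N ∈ Matrix.unitaryGroup _ ℂ := by
  refine Matrix.mem_unitaryGroup_iff.2 ?_
  change sel c M N * (sel c M N).conjTranspose = 1
  rw [sel_conjTranspose hM hN, sel_mul hM hN, mul_conjTranspose_of_unitary hM',
    mul_conjTranspose_of_unitary hN', sel_self]

theorem ext_sel (ι : W₁ ↪ W₂) (c : W₁) (M N : Oper W₁ E) :
    ext ι (sel c M N) = sel (ι c) (ext ι M) (ext ι N) := by
  classical
  funext p p'
  simp only [ext, sel, Function.comp_apply]
  split_ifs <;> rfl

theorem sel_mulVec (c : W) (M N : Oper W E) (ψ : Bits W × E → ℂ) (p : Bits W × E) :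
    (sel c M N).mulVec ψ p = if p.1 c = true then M.mulVec ψ p else N.mulVec ψ p := by
  simp only [mulVec_eq, sel_apply]
  split_ifs <;> rfl

theorem tensorOne_one : tensorOne (1 : Matrix (Bits W) (Bits W) ℂ) = (1 : Oper W E) := by
  funext p p'
  simp only [tensorOne, Matrix.one_apply, Prod.ext_iff]
  split_ifs <;> simp_all

theorem tensorOne_mul (M N : Matrix (Bits W) (Bits W) ℂ) :
    tensorOne (M * N) = (tensorOne M * tensorOne N : Oper W E) := by
  funext p p'
  rw [Matrix.mul_apply, Fintype.sum_prod_type]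
  simp only [tensorOne, Matrix.mul_apply, ite_mul, zero_mul, mul_ite, mul_zero]
  by_cases h : p.2 = p'.2 <;> simp [h]

theorem tensorOne_conjTranspose (M : Matrix (Bits W) (Bits W) ℂ) :
    tensorOne M.conjTranspose = (tensorOne M : Oper W E).conjTranspose := by
  funext p p'
  simp only [tensorOne, Matrix.conjTranspose_apply, eq_comm (a := p'.2)]
  split_ifs <;> simp

theorem tensorOne_mem_unitary {M : Matrix (Bits W) (Bits W) ℂ}
    (h : M ∈ Matrix.unitaryGroup _ ℂ) : (tensorOne M : Oper W E) ∈ Matrix.unitaryGroup _ ℂ := by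
  refine Matrix.mem_unitaryGroup_iff.2 ?_
  change tensorOne M * (tensorOne M).conjTranspose = 1
  rw [← tensorOne_conjTranspose, ← tensorOne_mul, mul_conjTranspose_of_unitary h, tensorOne_one]

theorem tensorOne_mulVec (M : Matrix (Bits W) (Bits W) ℂ) (ψ : Bits W × E → ℂ) (p : Bits W × E) :
    (tensorOne M).mulVec ψ p = M.mulVec (fun b => ψ (b, p.2)) p.1 := by
  rw [mulVec_eq, mulVec_eq, Fintype.sum_prod_type]
  simp only [tensorOne, ite_mul, zero_mul, Finset.sum_ite_eq, Finset.mem_univ, if_true]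

end Operators

/-! ### Gates and programs -/

section Gates

variable {W W₁ W₂ E : Type} [Fintype W] [DecidableEq W] [Fintype W₁] [DecidableEq W₁]
  [Fintype W₂] [DecidableEq W₂] [Fintype E] [DecidableEq E]

/-- The action of a gate on wires and register. -/
def Gate.oper (g : Gate W) : Oper W E := ext g.wires (tensorOne g.unitary.1)

theorem Gate.oper_eq (g : Gate W) : (g.oper : Oper W E) = tensorOne g.matrix := by
  classical
  funext p p'
  simp only [Gate.oper, ext, tensorOne, Gate.matrix]
  split_ifs <;> rfl

/-- A gate on other wires. -/
def Gate.map (ι : W₁ ↪ W₂) (g : Gate W₁) : Gate W₂ := ⟨g.arity, g.wires.trans ι, g.unitary⟩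

/-- The inverse gate. -/
def Gate.inv (g : Gate W) : Gate W := ⟨g.arity, g.wires, g.unitary⁻¹⟩

theorem Gate.map_oper (ι : W₁ ↪ W₂) (g : Gate W₁) :
    ((g.map ι).oper : Oper W₂ E) = ext ι g.oper := (ext_ext _ _ _).symm

theorem Gate.inv_oper (g : Gate W) : (g.inv.oper : Oper W E) = g.oper.conjTranspose := by
  rw [Gate.oper, Gate.oper, ← ext_conjTranspose, ← tensorOne_conjTranspose]
  rfl

theorem Gate.oper_mem_unitary (g : Gate W) : (g.oper : Oper W E) ∈ Matrix.unitaryGroup _ ℂ :=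
  ext_mem_unitary _ (tensorOne_mem_unitary g.unitary.2)

/-- The operator of a list of operators, the head of which is applied first. -/
def seqProd (l : List (Oper W E)) : Oper W E := l.reverse.prod

@[simp] theorem seqProd_nil : seqProd ([] : List (Oper W E)) = 1 := rfl

@[simp] theorem seqProd_cons (M : Oper W E) (l : List (Oper W E)) :
    seqProd (M :: l) = seqProd l * M := by simp [seqProd]

@[simp] theorem seqProd_append (l l' : List (Oper W E)) :
    seqProd (l ++ l') = seqProd l' * seqProd l := by simp [seqProd]

theorem seqProd_mem_unitary (l : List (Oper W E))
    (h : ∀ M ∈ l, M ∈ Matrix.unitaryGroup _ ℂ) : seqProd l ∈ Matrix.unitaryGroup _ ℂ :=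
  Submonoid.list_prod_mem _ fun M hM => h M (List.mem_reverse.1 hM)

theorem ext_seqProd (ι : W₁ ↪ W₂) (l : List (Oper W₁ E)) :
    ext ι (seqProd l) = seqProd (l.map (ext ι)) := by
  induction l with
  | nil => exact ext_one ι
  | cons M l ih => rw [List.map_cons, seqProd_cons, seqProd_cons, ext_mul, ih]

theorem Keeps.seqProd {c : W} {l : List (Oper W E)} (h : ∀ M ∈ l, Keeps c M) :
    Keeps c (seqProd l) := by
  induction l with
  | nil => exact Keeps.one c
  | cons M l ih =>
    rw [seqProd_cons]
    exact (ih fun N hN => h N (List.mem_cons_of_mem _ hN)).mul (h M List.mem_cons_self)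

/-- The action of a circuit on wires and register. -/
def Circuit.oper (C : Circuit W) : Oper W E := seqProd (C.map Gate.oper)

/-- A circuit on other wires. -/
def Circuit.map (ι : W₁ ↪ W₂) (C : Circuit W₁) : Circuit W₂ := List.map (Gate.map ι) C

/-- The inverse circuit. -/
def Circuit.inv (C : Circuit W) : Circuit W := (List.map Gate.inv C).reverse

theorem Circuit.matrix_nil : Circuit.matrix ([] : Circuit W) = 1 := rfl

theorem Circuit.matrix_cons (g : Gate W) (C : Circuit W) :
    Circuit.matrix (g :: C) = Circuit.matrix C * g.matrix := by
  have key : ∀ (C : Circuit W) (M : Matrix (Bits W) (Bits W) ℂ),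
      C.foldl (fun M g => g.matrix * M) M = C.matrix * M := by
    intro C
    induction C with
    | nil => intro M; exact (one_mul M).symm
    | cons g C ih =>
      intro M
      rw [Circuit.matrix, List.foldl_cons, List.foldl_cons, ih, ih, mul_one, mul_assoc]
  rw [Circuit.matrix, List.foldl_cons, key, mul_one]

theorem Circuit.oper_eq (C : Circuit W) : (C.oper : Oper W E) = tensorOne C.matrix := by
  induction C with
  | nil => exact tensorOne_one.symm
  | cons g C ih =>
    rw [Circuit.matrix_cons, tensorOne_mul, ← ih, ← Gate.oper_eq]
    simp [Circuit.oper]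

theorem Circuit.map_oper (ι : W₁ ↪ W₂) (C : Circuit W₁) :
    ((C.map ι).oper : Oper W₂ E) = ext ι C.oper := by
  rw [Circuit.oper, Circuit.oper, ext_seqProd, Circuit.map, List.map_map, List.map_map]
  congr 1
  exact List.map_congr_left fun g _ => Gate.map_oper ι g

theorem Circuit.append_oper (C D : Circuit W) :
    (Circuit.oper (C ++ D) : Oper W E) = D.oper * C.oper := by
  simp [Circuit.oper]

theorem Circuit.inv_oper (C : Circuit W) : (C.inv.oper : Oper W E) = C.oper.conjTranspose := by
  induction C with
  | nil => simp [Circuit.inv, Circuit.oper]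
  | cons g C ih =>
    have : Circuit.inv (g :: C) = Circuit.inv C ++ [g.inv] := by simp [Circuit.inv]
    rw [this, Circuit.append_oper, ih]
    simp [Circuit.oper, Gate.inv_oper, Matrix.conjTranspose_mul]

theorem Circuit.oper_mem_unitary (C : Circuit W) : (C.oper : Oper W E) ∈ Matrix.unitaryGroup _ ℂ :=
  seqProd_mem_unitary _ fun M hM => by
    obtain ⟨g, -, rfl⟩ := List.mem_map.1 hM
    exact g.oper_mem_unitary

theorem Circuit.map_cost (ι : W₁ ↪ W₂) (C : Circuit W₁) : (C.map ι).cost = C.cost := by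
  simp only [Circuit.cost, Circuit.map, List.map_map]
  rfl

theorem Circuit.inv_cost (C : Circuit W) : C.inv.cost = C.cost := by
  simp only [Circuit.cost, Circuit.inv, List.map_reverse, List.sum_reverse, List.map_map]
  rfl

theorem Circuit.append_cost (C D : Circuit W) : Circuit.cost (C ++ D) = C.cost + D.cost := by
  simp [Circuit.cost]

end Gates

/-! ### Programs with calls of an adversary -/

section Programs

variable {N W W₁ W₂ : Type} [Fintype N] [DecidableEq N] [Fintype W] [DecidableEq W]
  [Fintype W₁] [DecidableEq W₁] [Fintype W₂] [DecidableEq W₂] {m : ℕ}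

/-- The unitary, or its inverse, that is called. -/
def Adversary.callOper (A : Adversary N m) (j : Fin m) (inverse : Bool) : Oper N A.E :=
  if inverse = true then (A.step j).1.conjTranspose else (A.step j).1

theorem Adversary.callOper_mem_unitary (A : Adversary N m) (j : Fin m) (i : Bool) :
    A.callOper j i ∈ Matrix.unitaryGroup _ ℂ := by
  unfold Adversary.callOper
  split
  · exact Unitary.star_mem (A.step j).2
  · exact (A.step j).2

theorem Adversary.callOper_not (A : Adversary N m) (j : Fin m) (i : Bool) :
    A.callOper j (!i) = (A.callOper j i).conjTranspose := by
  cases i <;> simp [Adversary.callOper]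

theorem Instr.matrix_gate (A : Adversary N m) (g : Gate W) :
    (Instr.gate g : Instr N W m).matrix A = g.oper := by
  rw [Gate.oper_eq]
  rfl

theorem Instr.matrix_call (A : Adversary N m) (j : Fin m) (i : Bool) (port : N ↪ W) (c : W)
    (h : c ∉ Set.range port) :
    (Instr.call j i port c h : Instr N W m).matrix A
      = sel c (ext port (A.callOper j i)) 1 := by
  classical
  funext p p'
  simp only [Instr.matrix, sel, ext, Adversary.callOper]
  cases i <;> simp

/-- An instruction on other wires. -/
def Instr.map (ι : W₁ ↪ W₂) : Instr N W₁ m → Instr N W₂ m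
  | .gate g => .gate (g.map ι)
  | .call j i port c h => .call j i (port.trans ι) (ι c) (by
      rintro ⟨w, hw⟩
      exact h ⟨w, ι.injective hw⟩)

/-- The inverse instruction. -/
def Instr.inv : Instr N W m → Instr N W m
  | .gate g => .gate g.inv
  | .call j i port c h => .call j (!i) port c h

theorem Instr.map_matrix (A : Adversary N m) (ι : W₁ ↪ W₂) (i : Instr N W₁ m) :
    (i.map ι).matrix A = ext ι (i.matrix A) := by
  cases i with
  | gate g => rw [Instr.map, Instr.matrix_gate, Instr.matrix_gate, Gate.map_oper]
  | call j i port c h =>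
    rw [Instr.map, Instr.matrix_call, Instr.matrix_call, ext_sel, ext_ext, ext_one]

theorem Instr.inv_matrix (A : Adversary N m) (i : Instr N W m) :
    i.inv.matrix A = (i.matrix A).conjTranspose := by
  cases i with
  | gate g => rw [Instr.inv, Instr.matrix_gate, Instr.matrix_gate, Gate.inv_oper]
  | call j i port c h =>
    rw [Instr.inv, Instr.matrix_call, Instr.matrix_call,
      sel_conjTranspose (Keeps.ext_of_notMem h _) (Keeps.one _), Adversary.callOper_not,
      ext_conjTranspose, Matrix.conjTranspose_one]

theorem Instr.matrix_mem_unitary (A : Adversary N m) (i : Instr N W m) :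
    i.matrix A ∈ Matrix.unitaryGroup _ ℂ := by
  cases i with
  | gate g => rw [Instr.matrix_gate]; exact g.oper_mem_unitary
  | call j i port c h =>
    rw [Instr.matrix_call]
    exact sel_mem_unitary (Keeps.ext_of_notMem h _) (Keeps.one _)
      (ext_mem_unitary _ (A.callOper_mem_unitary j i)) (one_mem _)

theorem Instr.map_cost (ι : W₁ ↪ W₂) (i : Instr N W₁ m) : (i.map ι).cost = i.cost := by
  cases i <;> rfl

theorem Instr.inv_cost (i : Instr N W m) : i.inv.cost = i.cost := by
  cases i <;> rfl

/-- A list of instructions, the head of which is performed first. -/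
abbrev Program (N W : Type) (m : ℕ) : Type := List (Instr N W m)

namespace Program

/-- The operator of a program. -/
def oper (A : Adversary N m) (prog : Program N W m) : Oper W A.E :=
  seqProd (List.map (Instr.matrix A) prog)

/-- The cost of a program. -/
def cost (prog : Program N W m) : ℕ := (List.map Instr.cost prog).sum

/-- A program on other wires. -/
def map (ι : W₁ ↪ W₂) (prog : Program N W₁ m) : Program N W₂ m := List.map (Instr.map ι) prog

/-- The inverse program. -/
def inv (prog : Program N W m) : Program N W m := (List.map Instr.inv prog).reverse

/-- A circuit, as a program without calls. -/
def ofCircuit (C : Circuit W) : Program N W m := List.map Instr.gate C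

@[simp] theorem oper_nil (A : Adversary N m) : oper A ([] : Program N W m) = 1 := rfl

theorem oper_cons (A : Adversary N m) (i : Instr N W m) (l : Program N W m) :
    oper A (i :: l) = oper A l * i.matrix A := by simp [oper]

theorem oper_append (A : Adversary N m) (l l' : Program N W m) :
    oper A (l ++ l') = oper A l' * oper A l := by simp [oper]

theorem oper_map (A : Adversary N m) (ι : W₁ ↪ W₂) (l : Program N W₁ m) :
    oper A (l.map ι) = ext ι (oper A l) := by
  rw [oper, oper, ext_seqProd, Program.map, List.map_map, List.map_map]
  congr 1
  exact List.map_congr_left fun i _ => Instr.map_matrix A ι i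

theorem oper_inv (A : Adversary N m) (l : Program N W m) :
    oper A l.inv = (oper A l).conjTranspose := by
  induction l with
  | nil => simp [Program.inv]
  | cons i l ih =>
    have : Program.inv (i :: l) = Program.inv l ++ [i.inv] := by simp [Program.inv]
    rw [this, oper_append, ih, oper_cons, oper_cons, oper_nil, one_mul, Instr.inv_matrix,
      Matrix.conjTranspose_mul]

theorem oper_ofCircuit (A : Adversary N m) (C : Circuit W) :
    oper A (ofCircuit C : Program N W m) = C.oper := by
  rw [oper, ofCircuit, List.map_map, Circuit.oper]
  congr 1
  exact List.map_congr_left fun g _ => Instr.matrix_gate A g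

theorem oper_mem_unitary (A : Adversary N m) (l : Program N W m) :
    oper A l ∈ Matrix.unitaryGroup _ ℂ :=
  seqProd_mem_unitary _ fun M hM => by
    obtain ⟨i, -, rfl⟩ := List.mem_map.1 hM
    exact i.matrix_mem_unitary A

/-- The state computed by `BlackBoxAlg.outputProb` is given by the operator of the program. -/
theorem foldl_mulVec (A : Adversary N m) (l : Program N W m) (ψ : Bits W × A.E → ℂ) :
    l.foldl (fun ψ i => (i.matrix A).mulVec ψ) ψ = (oper A l).mulVec ψ := by
  induction l generalizing ψ with
  | nil => simp
  | cons i l ih => rw [List.foldl_cons, ih, oper_cons, Matrix.mulVec_mulVec]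

theorem cost_append (l l' : Program N W m) : cost (l ++ l') = cost l + cost l' := by
  simp [cost]

theorem cost_map (ι : W₁ ↪ W₂) (l : Program N W₁ m) : cost (l.map ι) = cost l := by
  rw [cost, cost, Program.map, List.map_map]
  congr 1
  exact List.map_congr_left fun i _ => Instr.map_cost ι i

theorem cost_inv (l : Program N W m) : cost l.inv = cost l := by
  rw [cost, cost, Program.inv, List.map_reverse, List.sum_reverse, List.map_map]
  congr 1
  exact List.map_congr_left fun i _ => Instr.inv_cost i

theorem cost_ofCircuit (C : Circuit W) : cost (ofCircuit C : Program N W m) = C.cost := by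
  rw [cost, ofCircuit, List.map_map]
  rfl

end Program

end Programs

/-! ### Action on basis states -/

section Maps

variable {W W₁ W₂ E : Type} [Fintype W] [DecidableEq W] [Fintype W₁] [DecidableEq W₁]
  [Fintype W₂] [DecidableEq W₂] [Fintype E] [DecidableEq E]

/-- `M` maps the basis state `b` of the wires to the basis state `b'`, and does not touch the
register. -/
def Maps (M : Oper W E) (b b' : Bits W) : Prop :=
  ∀ p e, M p (b, e) = if p = (b', e) then 1 else 0

theorem Maps.one (b : Bits W) : Maps (1 : Oper W E) b b := fun _ _ => Matrix.one_apply

theorem Maps.mul {M N : Oper W E} {b b' b'' : Bits W} (hN : Maps N b' b'') (hM : Maps M b b') :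
    Maps (N * M) b b'' := by
  intro p e
  rw [Matrix.mul_apply, Finset.sum_eq_single (b', e), hM, if_pos rfl, mul_one, hN]
  · intro q _ hq
    rw [hM, if_neg hq, mul_zero]
  · simp

/-- An operator that maps basis states to basis states does so on larger sets of wires. -/
theorem Maps.lift {M : Oper W₁ E} {ι : W₁ ↪ W₂} {b : Bits W₂} {c : Bits W₁}
    (h : Maps M (b ∘ ι) c) : Maps (ext ι M) b (Function.extend ι c b) := by
  classical
  intro p e
  by_cases hp : ∀ v, v ∉ Set.range ι → p.1 v = b v
  · rw [ext_apply_of hp, h]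
    congr 1
    simp only [Prod.ext_iff, eq_iff_iff]
    refine and_congr_left fun _ => ⟨fun h' => ?_, fun h' => ?_⟩
    · rw [← h', extend_self fun v hv => (hp v hv).symm]
    · rw [h', extend_comp]
  · rw [ext_apply_of_not hp, if_neg]
    rintro rfl
    exact hp fun v hv => extend_off hv

/-- The converse of `Maps.lift`: idle wires may be dropped. -/
theorem Maps.of_ext {M : Oper W₁ E} {ι : W₁ ↪ W₂} {b : Bits W₂} {c : Bits W₁}
    (h : Maps (ext ι M) b (Function.extend ι c b)) : Maps M (b ∘ ι) c := by
  rintro ⟨d, e'⟩ e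
  have := h (Function.extend ι d b, e') e
  rw [ext_apply_of fun v hv => extend_off hv] at this
  rw [extend_comp] at this
  rw [this]
  congr 1
  simp only [Prod.mk.injEq, eq_iff_iff]
  refine and_congr_left fun _ => ⟨fun h' => ?_, fun h' => by rw [h']⟩
  rw [← extend_comp (ι := ι) d b, h', extend_comp]

theorem Maps.conjTranspose {M : Oper W E} {b b' : Bits W} (hM : M ∈ Matrix.unitaryGroup _ ℂ)
    (h : Maps M b b') : Maps M.conjTranspose b' b := by
  intro p e
  have h1 := congrFun (congrFun (conjTranspose_mul_of_unitary hM) p) (b, e)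
  rw [Matrix.mul_apply, Finset.sum_eq_single (b', e), h, if_pos rfl, mul_one] at h1
  · rw [h1, Matrix.one_apply]
  · intro q _ hq
    rw [h, if_neg hq, mul_zero]
  · simp

theorem maps_tensorOne {M : Matrix (Bits W) (Bits W) ℂ} {b b' : Bits W}
    (h : M.mulVec (Pi.single b 1) = Pi.single b' 1) : Maps (tensorOne M : Oper W E) b b' := by
  intro p e
  have h1 := congrFun h p.1
  rw [Matrix.mulVec_single_one, Matrix.col_apply, Pi.single_apply] at h1
  rw [tensorOne, h1]
  by_cases h2 : p.2 = e <;> by_cases h3 : p.1 = b' <;> simp [h2, h3, Prod.ext_iff]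

/-- The action of an operator that permutes the basis states in `Z` by the involution `σ`. -/
theorem mulVec_of_maps {M : Oper W E} (Z : Set (Bits W)) (σ : Bits W → Bits W)
    (hM : ∀ b ∈ Z, Maps M b (σ b)) (hZ : ∀ b ∈ Z, σ b ∈ Z) (hσ : ∀ b ∈ Z, σ (σ b) = b)
    (ψ : Bits W × E → ℂ) (hψ : ∀ p : Bits W × E, p.1 ∉ Z → ψ p = 0) (p : Bits W × E) :
    (p.1 ∈ Z → M.mulVec ψ p = ψ (σ p.1, p.2)) ∧ (p.1 ∉ Z → M.mulVec ψ p = 0) := by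
  constructor
  · intro hp
    rw [mulVec_eq, Finset.sum_eq_single (σ p.1, p.2), hM _ (hZ _ hp), hσ _ hp, if_pos rfl, one_mul]
    · rintro ⟨b, e⟩ _ hq
      by_cases hb : b ∈ Z
      · rw [hM _ hb, if_neg, zero_mul]
        rintro rfl
        exact hq (by rw [hσ _ hb])
      · rw [hψ _ hb, mul_zero]
    · simp
  · intro hp
    rw [mulVec_eq]
    refine Finset.sum_eq_zero ?_
    rintro ⟨b, e⟩ _
    by_cases hb : b ∈ Z
    · rw [hM _ hb, if_neg, zero_mul]
      rintro rfl
      exact hp (hZ _ hb)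
    · rw [hψ _ hb, mul_zero]

end Maps

/-! ### Toggle gates -/

section Toggles

variable {W W₁ W₂ E : Type} [Fintype W] [DecidableEq W] [Fintype W₁] [DecidableEq W₁]
  [Fintype W₂] [DecidableEq W₂] [Fintype E] [DecidableEq E]

/-- The permutation matrix of an involution. -/
def involMatrix {ι : Type*} [DecidableEq ι] (σ : ι → ι) : Matrix ι ι ℂ :=
  Matrix.of fun i j => if i = σ j then 1 else 0

theorem involMatrix_mem_unitary {ι : Type*} [Fintype ι] [DecidableEq ι] {σ : ι → ι}
    (hσ : Function.Involutive σ) : involMatrix σ ∈ Matrix.unitaryGroup ι ℂ := by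
  rw [Matrix.mem_unitaryGroup_iff]
  ext i j
  rw [Matrix.mul_apply, Finset.sum_eq_single (σ i)]
  · simp [involMatrix, Matrix.one_apply, hσ i, eq_comm]
  · intro k _ hk
    simp only [involMatrix, Matrix.of_apply]
    rw [if_neg, zero_mul]
    rintro rfl
    exact hk (hσ k).symm
  · simp

/-- A reversible classical instruction: the wire `tgt` is flipped if the Boolean function `fn`,
which depends only on the wires in `supp`, has the value 1. -/
structure Toggle (W : Type) where
  supp : Finset W
  tgt : W
  fn : Bits W → Bool
  tgt_notMem : tgt ∉ supp
  fn_congr : ∀ b b' : Bits W, (∀ v ∈ supp, b v = b' v) → fn b = fn b'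

namespace Toggle

/-- The permutation of basis states performed by a toggle. -/
def flip (t : Toggle W) (b : Bits W) : Bits W := Function.update b t.tgt (xor (b t.tgt) (t.fn b))

theorem fn_update (t : Toggle W) (b : Bits W) (x : Bool) :
    t.fn (Function.update b t.tgt x) = t.fn b :=
  t.fn_congr _ _ fun v hv => Function.update_of_ne (by rintro rfl; exact t.tgt_notMem hv) _ _

theorem flip_tgt (t : Toggle W) (b : Bits W) : t.flip b t.tgt = xor (b t.tgt) (t.fn b) :=
  Function.update_self _ _ _

theorem flip_of_ne (t : Toggle W) (b : Bits W) {v : W} (h : v ≠ t.tgt) : t.flip b v = b v :=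
  Function.update_of_ne h _ _

theorem flip_flip (t : Toggle W) (b : Bits W) : t.flip (t.flip b) = b := by
  simp [flip, fn_update]

/-- The wires of the gate of a toggle. -/
def wires (t : Toggle W) : Fin (insert t.tgt t.supp).card ↪ W :=
  ⟨fun i => ((insert t.tgt t.supp).equivFin.symm i).1,
    Subtype.val_injective.comp (Equiv.injective _)⟩

theorem range_wires (t : Toggle W) : Set.range t.wires = ↑(insert t.tgt t.supp) := by
  ext v
  constructor
  · rintro ⟨i, rfl⟩
    exact ((insert t.tgt t.supp).equivFin.symm i).2
  · intro h
    exact ⟨(insert t.tgt t.supp).equivFin ⟨v, h⟩, by simp [wires]⟩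

/-- The index of the target among the wires of the gate. -/
def tgtIdx (t : Toggle W) : Fin (insert t.tgt t.supp).card :=
  (insert t.tgt t.supp).equivFin ⟨t.tgt, Finset.mem_insert_self _ _⟩

theorem wires_tgtIdx (t : Toggle W) : t.wires t.tgtIdx = t.tgt := by simp [wires, tgtIdx]

/-- The permutation performed by a toggle, on its own wires. -/
def localFlip (t : Toggle W) (c : BitString (insert t.tgt t.supp).card) :
    BitString (insert t.tgt t.supp).card :=
  Function.update c t.tgtIdx (xor (c t.tgtIdx)
    (t.fn (Function.extend t.wires (Function.update c t.tgtIdx false) (zeros W))))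

theorem localFlip_involutive (t : Toggle W) : Function.Involutive t.localFlip := by
  intro c
  simp [localFlip]

/-- The gate that performs a toggle. -/
def gate (t : Toggle W) : Gate W :=
  ⟨(insert t.tgt t.supp).card, t.wires,
    ⟨involMatrix t.localFlip, involMatrix_mem_unitary t.localFlip_involutive⟩⟩

theorem gate_cost (t : Toggle W) : t.gate.cost ≤ 4 ^ (t.supp.card + 1) :=
  Nat.pow_le_pow_right (by norm_num) (Finset.card_insert_le _ _)

theorem extend_localFlip (t : Toggle W) (b : Bits W) :
    Function.extend t.wires (t.localFlip (b ∘ t.wires)) b = t.flip b := by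
  have hfn : t.fn (Function.extend t.wires (Function.update (b ∘ t.wires) t.tgtIdx false)
      (zeros W)) = t.fn b := by
    refine t.fn_congr _ _ fun v hv => ?_
    have hv' : v ∈ Set.range t.wires := by
      rw [range_wires]
      exact Finset.mem_insert_of_mem hv
    obtain ⟨i, rfl⟩ := hv'
    rw [t.wires.injective.extend_apply, Function.update_of_ne]
    · rfl
    · rintro rfl
      rw [wires_tgtIdx] at hv
      exact t.tgt_notMem hv
  funext v
  by_cases hv : v ∈ Set.range t.wires
  · obtain ⟨i, rfl⟩ := hv
    rw [t.wires.injective.extend_apply, localFlip, hfn]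
    by_cases hi : i = t.tgtIdx
    · subst hi
      rw [Function.update_self, Function.comp_apply, wires_tgtIdx, flip_tgt]
    · rw [Function.update_of_ne hi, flip_of_ne, Function.comp_apply]
      exact fun h => hi (t.wires.injective (h.trans t.wires_tgtIdx.symm))
  · rw [extend_off hv, flip_of_ne]
    rintro rfl
    exact hv ⟨_, t.wires_tgtIdx⟩

theorem maps_gate (t : Toggle W) (b : Bits W) : Maps (t.gate.oper : Oper W E) b (t.flip b) := by
  rw [← extend_localFlip]
  refine Maps.lift (maps_tensorOne ?_)
  rw [Matrix.mulVec_single_one]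
  exact funext fun c => (Pi.single_apply _ _ _).symm

theorem gate_mulVec (t : Toggle W) (ψ : Bits W × E → ℂ) (p : Bits W × E) :
    t.gate.oper.mulVec ψ p = ψ (t.flip p.1, p.2) :=
  (mulVec_of_maps Set.univ t.flip (fun b _ => t.maps_gate b) (fun _ _ => Set.mem_univ _)
    (fun b _ => t.flip_flip b) ψ (fun _ h => absurd (Set.mem_univ _) h) p).1 (Set.mem_univ _)

theorem keeps_gate (t : Toggle W) {c : W} (h : c ≠ t.tgt) :
    Keeps c (t.gate.oper : Oper W E) := by
  rintro p ⟨b, e⟩ hp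
  rw [t.maps_gate b, if_neg]
  rintro rfl
  exact hp (t.flip_of_ne b h)

/-- A toggle, on other wires and with an additional control wire `c`. -/
def ctrl (t : Toggle W₁) (ι : W₁ ↪ W₂) (c : W₂) (hc : c ∉ Set.range ι) : Toggle W₂ where
  supp := insert c (t.supp.map ι)
  tgt := ι t.tgt
  fn b := b c && t.fn (b ∘ ι)
  tgt_notMem := by
    rw [Finset.mem_insert, Finset.mem_map' ι]
    rintro (h | h)
    · exact hc ⟨_, h⟩
    · exact t.tgt_notMem h
  fn_congr b b' h := by
    rw [h c (Finset.mem_insert_self _ _), t.fn_congr (b ∘ ι) (b' ∘ ι)]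
    exact fun v hv => h _ (Finset.mem_insert_of_mem (Finset.mem_map_of_mem ι hv))

theorem ctrl_oper (t : Toggle W₁) (ι : W₁ ↪ W₂) (c : W₂) (hc : c ∉ Set.range ι) :
    ((t.ctrl ι c hc).gate.oper : Oper W₂ E) = sel c (FiatShamir.ext ι t.gate.oper) 1 := by
  refine oper_ext fun ψ p => ?_
  rw [gate_mulVec, sel_mulVec, ext_mulVec, gate_mulVec, Matrix.one_mulVec, slice]
  have hne : ∀ w, ι w = ι t.tgt ↔ w = t.tgt := fun w => ι.injective.eq_iff
  split_ifs with h
  · congr 2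
    funext v
    by_cases hv : v ∈ Set.range ι
    · obtain ⟨w, rfl⟩ := hv
      rw [ι.injective.extend_apply]
      simp [flip, ctrl, h, Function.update_apply, hne]
    · rw [extend_off hv, flip_of_ne]
      rintro rfl
      exact hv ⟨_, rfl⟩
  · congr 2
    simp [flip, ctrl, h]

theorem ctrl_cost (t : Toggle W₁) (ι : W₁ ↪ W₂) (c : W₂) (hc : c ∉ Set.range ι) :
    (t.ctrl ι c hc).gate.cost ≤ 4 * 4 ^ (t.supp.card + 1) := by
  refine (gate_cost _).trans ?_
  rw [← pow_succ']
  refine Nat.pow_le_pow_right (by norm_num) (Nat.succ_le_succ ?_)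
  exact (Finset.card_insert_le _ _).trans (by rw [Finset.card_map])

end Toggle

end Toggles

/-! ### Programs that can be controlled by a wire -/

section Controlled

variable {N W W₁ W₂ : Type} [Fintype N] [DecidableEq N] [Fintype W] [DecidableEq W]
  [Fintype W₁] [DecidableEq W₁] [Fintype W₂] [DecidableEq W₂] {m : ℕ}

/-- An instruction of a controllable program: an instruction that is performed also when the
control is off, or a toggle that is performed only when it is on. -/
abbrev CInstr (N W : Type) (m : ℕ) : Type := Instr N W m ⊕ Toggle W

/-- The instruction, without a control. -/
def CInstr.plain : CInstr N W m → Instr N W m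
  | .inl i => i
  | .inr t => .gate t.gate

/-- The instruction, on other wires and with control `c`. -/
def CInstr.ctrl (ι : W₁ ↪ W₂) (c : W₂) (hc : c ∉ Set.range ι) : CInstr N W₁ m → Instr N W₂ m
  | .inl i => i.map ι
  | .inr t => .gate (t.ctrl ι c hc).gate

/-- What remains of the instruction when the control is off. -/
def CInstr.off : CInstr N W m → Program N W m
  | .inl i => [i]
  | .inr _ => []

/-- A controllable program; the head is performed first. -/
abbrev CProgram (N W : Type) (m : ℕ) : Type := List (CInstr N W m)

namespace CProgram

/-- The program, without a control. -/
def plain (l : CProgram N W m) : Program N W m := List.map CInstr.plain l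

/-- The program, on other wires and with control `c`. -/
def ctrl (ι : W₁ ↪ W₂) (c : W₂) (hc : c ∉ Set.range ι) (l : CProgram N W₁ m) : Program N W₂ m :=
  List.map (CInstr.ctrl ι c hc) l

/-- What remains of the program when the control is off. -/
def off (l : CProgram N W m) : Program N W m := List.flatMap CInstr.off l

theorem plain_append (l l' : CProgram N W m) : plain (l ++ l') = plain l ++ plain l' :=
  List.map_append

theorem off_append (l l' : CProgram N W m) : off (l ++ l') = off l ++ off l' :=
  List.flatMap_append

/-- A list of toggles, all of them controlled. -/
def ofToggles (l : List (Toggle W)) : CProgram N W m := List.map Sum.inr l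

/-- A program that ignores the control. -/
def ofProgram (l : Program N W m) : CProgram N W m := List.map Sum.inl l

theorem plain_ofProgram (l : Program N W m) : plain (ofProgram l) = l := by
  rw [plain, ofProgram, List.map_map]
  exact List.map_id l

theorem off_ofProgram (l : Program N W m) : off (ofProgram l) = l := by
  induction l with
  | nil => rfl
  | cons i l ih =>
    change i :: off (ofProgram l) = i :: l
    rw [ih]

theorem off_ofToggles (l : List (Toggle W)) : off (ofToggles l : CProgram N W m) = [] := by
  induction l with
  | nil => rfl
  | cons i l ih => exact ih

/-- If a controllable program does nothing when its toggles are left out, then its controlled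
version performs it if the control wire holds 1 and does nothing otherwise. -/
theorem oper_ctrl (A : Adversary N m) (ι : W₁ ↪ W₂) (c : W₂) (hc : c ∉ Set.range ι)
    (l : CProgram N W₁ m) :
    (l.ctrl ι c hc).oper A
      = sel c (ext ι (Program.oper A (plain l))) (ext ι (Program.oper A (off l))) := by
  induction l with
  | nil =>
    change Program.oper A [] = sel c (ext ι (Program.oper A [])) (ext ι (Program.oper A []))
    rw [sel_self, Program.oper_nil, Program.oper_nil, ext_one]
  | cons i l ih =>
    have h1 : ctrl ι c hc (i :: l) = i.ctrl ι c hc :: ctrl ι c hc l := rfl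
    have h2 : plain (i :: l) = i.plain :: plain l := rfl
    have h3 : off (i :: l) = i.off ++ off l := rfl
    rw [h1, h2, h3, Program.oper_cons, Program.oper_cons, Program.oper_append, ih, ext_mul, ext_mul,
      ← sel_mul (Keeps.ext_of_notMem hc _) (Keeps.ext_of_notMem hc _)]
    congr 1
    cases i with
    | inl i =>
      simp only [CInstr.ctrl, CInstr.plain, CInstr.off, Program.oper_cons, Program.oper_nil,
        one_mul, Instr.map_matrix, sel_self]
    | inr t =>
      simp only [CInstr.ctrl, CInstr.plain, CInstr.off, Program.oper_nil, Instr.matrix_gate,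
        Toggle.ctrl_oper, ext_one]

end CProgram

end Controlled

/-! ### Norms and measurements -/

section Norms

variable {ι κ : Type} [Fintype ι] [Fintype κ]

/-- The squared norm of a state. -/
def normSq (ψ : ι → ℂ) : ℝ := ∑ i, ‖ψ i‖ ^ 2

theorem normSq_nonneg (ψ : ι → ℂ) : 0 ≤ normSq ψ := Finset.sum_nonneg fun _ _ => sq_nonneg _

theorem normSq_mulVec [DecidableEq ι] {M : Matrix ι ι ℂ} (hM : M ∈ Matrix.unitaryGroup ι ℂ)
    (ψ : ι → ℂ) : normSq (M.mulVec ψ) = normSq ψ := by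
  have key : ∀ φ : ι → ℂ, (normSq φ : ℂ) = star φ ⬝ᵥ φ := by
    intro φ
    simp only [normSq, dotProduct, Complex.ofReal_sum, Complex.ofReal_pow]
    refine Finset.sum_congr rfl fun i _ => ?_
    rw [Pi.star_apply, Complex.star_def, Complex.conj_mul']
  have : (normSq (M.mulVec ψ) : ℂ) = normSq ψ := by
    rw [key, key, Matrix.star_mulVec, Matrix.dotProduct_mulVec, Matrix.vecMul_vecMul,
      conjTranspose_mul_of_unitary hM, Matrix.vecMul_one]
  exact_mod_cast this

theorem measureProb_nonneg (ψ : ι → ℂ) (S : Set ι) : 0 ≤ measureProb ψ S :=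
  Finset.sum_nonneg fun _ _ => Set.indicator_nonneg (fun _ _ => sq_nonneg _) _

theorem measureProb_le_normSq (ψ : ι → ℂ) (S : Set ι) : measureProb ψ S ≤ normSq ψ :=
  Finset.sum_le_sum fun i _ => Set.indicator_le_self' (fun _ _ => sq_nonneg _) i

theorem measureProb_comp_equiv (e : ι ≃ κ) (ψ : κ → ℂ) (S : Set κ) :
    measureProb (ψ ∘ e) (e ⁻¹' S) = measureProb ψ S := by
  classical
  unfold measureProb
  rw [← e.sum_comp]
  simp only [Set.indicator, Set.mem_preimage, Function.comp_apply]

theorem normSq_comp_equiv (e : ι ≃ κ) (ψ : κ → ℂ) : normSq (ψ ∘ e) = normSq ψ :=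
  e.sum_comp fun i => ‖ψ i‖ ^ 2

theorem measureProb_smul (c : ℝ) (ψ : ι → ℂ) (S : Set ι) :
    measureProb ((c : ℂ) • ψ) S = c ^ 2 * measureProb ψ S := by
  classical
  unfold measureProb
  rw [Finset.mul_sum]
  refine Finset.sum_congr rfl fun i _ => ?_
  by_cases h : i ∈ S <;> simp [h, mul_pow]

/-- The normalised multiple of `ψ`; for `ψ = 0`, an arbitrary basis state. -/
def normalise [DecidableEq ι] (i₀ : ι) (ψ : ι → ℂ) : ι → ℂ :=
  if normSq ψ = 0 then Pi.single i₀ 1 else ((Real.sqrt (normSq ψ))⁻¹ : ℝ) • ψ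

theorem normSq_normalise [DecidableEq ι] (i₀ : ι) (ψ : ι → ℂ) : normSq (normalise i₀ ψ) = 1 := by
  unfold normalise
  split_ifs with h
  · unfold normSq
    rw [Finset.sum_eq_single i₀]
    · simp
    · intro i _ hi
      simp [hi]
    · simp
  · have h1 : normSq (((Real.sqrt (normSq ψ))⁻¹ : ℝ) • ψ)
        = ((Real.sqrt (normSq ψ))⁻¹) ^ 2 * normSq ψ := by
      unfold normSq
      rw [Finset.mul_sum]
      refine Finset.sum_congr rfl fun i _ => ?_
      rw [Pi.smul_apply, norm_smul, mul_pow, Real.norm_eq_abs, sq_abs]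
    rw [h1, inv_pow, Real.sq_sqrt (normSq_nonneg _), inv_mul_cancel₀ h]

theorem sqrt_smul_normalise [DecidableEq ι] (i₀ : ι) (ψ : ι → ℂ) :
    ((Real.sqrt (normSq ψ) : ℝ) : ℂ) • normalise i₀ ψ = ψ := by
  unfold normalise
  split_ifs with h
  · rw [h, Real.sqrt_zero, Complex.ofReal_zero, zero_smul]
    have := (Finset.sum_eq_zero_iff_of_nonneg fun i _ => sq_nonneg ‖ψ i‖).1 h
    funext i
    exact (norm_eq_zero.1 (pow_eq_zero_iff two_ne_zero |>.1 (this i (Finset.mem_univ i)))).symm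
  · have h0 : Real.sqrt (normSq ψ) ≠ 0 := by
      rw [Real.sqrt_ne_zero (normSq_nonneg _)]
      exact h
    funext i
    simp only [Pi.smul_apply, smul_eq_mul, Complex.real_smul]
    rw [← mul_assoc, ← Complex.ofReal_mul, mul_inv_cancel₀ h0]
    simp

end Norms

/-! ### Moving wires into the register -/

section Assoc

variable {W V E : Type} [Fintype W] [DecidableEq W] [Fintype V] [DecidableEq V]
  [Fintype E] [DecidableEq E]

/-- Some wires may be counted as part of the register. -/
def assocEquiv (W V E : Type) : Bits W × (Bits V × E) ≃ Bits (W ⊕ V) × E where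
  toFun p := (Sum.elim p.1 p.2.1, p.2.2)
  invFun p := (p.1 ∘ Sum.inl, (p.1 ∘ Sum.inr, p.2))
  left_inv _ := rfl
  right_inv p := by
    refine Prod.ext (funext fun v => ?_) rfl
    cases v <;> rfl

/-- An operator, when the wires `V` are counted as part of the register. -/
def absorb (M : Oper (W ⊕ V) E) : Oper W (Bits V × E) :=
  M.submatrix (assocEquiv W V E) (assocEquiv W V E)

theorem absorb_mul (M N : Oper (W ⊕ V) E) : absorb (M * N) = absorb M * absorb N :=
  (Matrix.submatrix_mul_equiv M N _ (assocEquiv W V E) _).symm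

theorem absorb_one : absorb (1 : Oper (W ⊕ V) E) = 1 :=
  Matrix.submatrix_one_equiv _

theorem absorb_conjTranspose (M : Oper (W ⊕ V) E) :
    absorb M.conjTranspose = (absorb M).conjTranspose := rfl

theorem absorb_mem_unitary {M : Oper (W ⊕ V) E} (h : M ∈ Matrix.unitaryGroup _ ℂ) :
    absorb M ∈ Matrix.unitaryGroup _ ℂ := by
  refine Matrix.mem_unitaryGroup_iff.2 ?_
  change absorb M * (absorb M).conjTranspose = 1
  rw [← absorb_conjTranspose, ← absorb_mul, mul_conjTranspose_of_unitary h, absorb_one]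

theorem absorb_mulVec (M : Oper (W ⊕ V) E) (ψ : Bits (W ⊕ V) × E → ℂ) :
    (absorb M).mulVec (ψ ∘ assocEquiv W V E) = M.mulVec ψ ∘ assocEquiv W V E := by
  rw [absorb, Matrix.submatrix_mulVec_equiv]
  simp [Function.comp_assoc]

theorem absorb_sel (c : W) (M N : Oper (W ⊕ V) E) :
    absorb (sel (Sum.inl c) M N) = sel c (absorb M) (absorb N) := rfl

theorem absorb_gate (g : Gate W) :
    absorb ((g.map Function.Embedding.inl).oper : Oper (W ⊕ V) E) = g.oper := by
  classical
  funext p p'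
  have h1 : (∀ v, v ∉ Set.range (g.wires.trans (Function.Embedding.inl : W ↪ W ⊕ V)) →
      (Sum.elim p.1 p.2.1 : Bits (W ⊕ V)) v = (Sum.elim p'.1 p'.2.1 : Bits (W ⊕ V)) v)
      ↔ (∀ v, v ∉ Set.range g.wires → p.1 v = p'.1 v) ∧ p.2.1 = p'.2.1 := by
    constructor
    · intro h
      refine ⟨fun v hv => h (Sum.inl v) ?_, funext fun v => h (Sum.inr v) ?_⟩
      · rintro ⟨i, hi⟩
        exact hv ⟨i, Sum.inl.inj hi⟩
      · rintro ⟨i, hi⟩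
        exact Sum.inl_ne_inr hi
    · rintro ⟨h, h'⟩ (v | v) hv
      · refine h v ?_
        rintro ⟨i, rfl⟩
        exact hv ⟨i, rfl⟩
      · exact congrFun h' v
  change ext (g.wires.trans Function.Embedding.inl) (tensorOne g.unitary.1)
    (assocEquiv W V E p) (assocEquiv W V E p') = ext g.wires (tensorOne g.unitary.1) p p'
  by_cases ha : ∀ v, v ∉ Set.range g.wires → p.1 v = p'.1 v
  · rw [ext_apply_of ha]
    by_cases hb : p.2.1 = p'.2.1
    · rw [ext_apply_of (h1.2 ⟨ha, hb⟩)]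
      have h2 : p.2 = p'.2 ↔ (assocEquiv W V E p).2 = (assocEquiv W V E p').2 := by
        rw [Prod.ext_iff]
        exact and_iff_right hb
      simp only [tensorOne, h2]
      rfl
    · rw [ext_apply_of_not fun h => hb (h1.1 h).2]
      exact (if_neg fun h => hb (congrArg Prod.fst h)).symm
  · rw [ext_apply_of_not ha, ext_apply_of_not fun h => ha (h1.1 h).1]

variable {W' : Type} [Fintype W'] [DecidableEq W']

/-- The wires `V` are kept in place. -/
def withSpectators (V : Type) (port : W ↪ W') : W ⊕ V ↪ W' ⊕ V :=
  port.sumMap (Function.Embedding.refl V)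

theorem absorb_ext (port : W ↪ W') (M : Oper (W ⊕ V) E) :
    absorb (ext (withSpectators V port) M) = ext port (absorb M) := by
  classical
  funext p p'
  have h1 : (∀ v, v ∉ Set.range (withSpectators V port) →
      (Sum.elim p.1 p.2.1 : Bits (W' ⊕ V)) v = (Sum.elim p'.1 p'.2.1 : Bits (W' ⊕ V)) v)
      ↔ (∀ v, v ∉ Set.range port → p.1 v = p'.1 v) := by
    constructor
    · intro h v hv
      refine h (Sum.inl v) ?_
      rintro ⟨i | i, hi⟩
      · exact hv ⟨i, Sum.inl.inj hi⟩
      · exact Sum.inr_ne_inl hi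
    · rintro h (v | v) hv
      · refine h v ?_
        rintro ⟨i, rfl⟩
        exact hv ⟨Sum.inl i, rfl⟩
      · exact absurd ⟨Sum.inr v, rfl⟩ hv
  change ext _ _ _ _ = ext _ _ _ _
  by_cases h : ∀ v, v ∉ Set.range port → p.1 v = p'.1 v
  · rw [ext_apply_of h, ext_apply_of (h1.2 h)]
    have aux : ∀ r : Bits W' × (Bits V × E),
        ((assocEquiv W' V E r).1 ∘ withSpectators V port, (assocEquiv W' V E r).2)
          = assocEquiv W V E (r.1 ∘ port, r.2) := by
      intro r
      refine Prod.ext (funext fun v => ?_) rfl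
      cases v <;> rfl
    rw [aux, aux]
    rfl
  · rw [ext_apply_of_not h, ext_apply_of_not fun h' => h (h1.1 h')]

end Assoc

/-! ### Provers built from programs -/

section Simulation

variable {N₁ N₂ V W : Type} [Fintype N₁] [DecidableEq N₁] [Fintype N₂] [DecidableEq N₂]
  [Fintype V] [DecidableEq V] [Fintype W] [DecidableEq W] {q : ℕ}

/-- A two-stage adversary with communication wires `N₂`: its internal register consists of the
internal register of `A` and the wires `V`, it does nothing in its first stage and runs the program
`prog` in the second one. -/
def programAdversary (A : Adversary N₁ q) (prog : Program N₁ (N₂ ⊕ V) q)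
    (χ : Bits (N₂ ⊕ V) × A.E → ℂ) (hχ : normSq χ = 1) : Adversary N₂ 2 where
  E := Bits V × A.E
  fintypeE := inferInstance
  decidableEqE := inferInstance
  init := χ ∘ assocEquiv N₂ V A.E
  init_norm := (normSq_comp_equiv _ _).trans hχ
  step j := if j = 0 then 1 else ⟨absorb (prog.oper A), absorb_mem_unitary (prog.oper_mem_unitary A)⟩

theorem inl_notMem_withSpectators {port : N₂ ↪ W} {c : W} (h : c ∉ Set.range port) :
    (Sum.inl c : W ⊕ V) ∉ Set.range (withSpectators V port) := by
  rintro ⟨i | i, hi⟩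
  · exact h ⟨i, Sum.inl.inj hi⟩
  · exact Sum.inr_ne_inl hi

/-- The simulation of an instruction with calls of a `programAdversary`: calls of the first stage
are dropped and calls of the second one are replaced by its program, controlled. -/
def simulateInstr (l : CProgram N₁ (N₂ ⊕ V) q) : Instr N₂ W 2 → Program N₁ (W ⊕ V) q
  | .gate g => [.gate (g.map Function.Embedding.inl)]
  | .call j inverse port c h =>
      if j = 0 then [] else
        if inverse = true then
          (l.ctrl (withSpectators V port) (Sum.inl c) (inl_notMem_withSpectators h)).inv
        else l.ctrl (withSpectators V port) (Sum.inl c) (inl_notMem_withSpectators h)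

/-- The simulation of a program with calls of a `programAdversary`. -/
def simulate (l : CProgram N₁ (N₂ ⊕ V) q) (prog : Program N₂ W 2) : Program N₁ (W ⊕ V) q :=
  List.flatMap (simulateInstr l) prog

theorem absorb_simulateInstr (A : Adversary N₁ q) (l : CProgram N₁ (N₂ ⊕ V) q)
    (hl : Program.oper A l.off = 1) (χ : Bits (N₂ ⊕ V) × A.E → ℂ) (hχ : normSq χ = 1)
    (i : Instr N₂ W 2) :
    absorb (Program.oper A (simulateInstr l i))
      = i.matrix (programAdversary A l.plain χ hχ) := by
  have hctrl : ∀ (port : N₂ ↪ W) (c : W) (h : c ∉ Set.range port),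
      absorb (Program.oper A (l.ctrl (withSpectators V port) (Sum.inl c)
        (inl_notMem_withSpectators h))) = sel c (ext port (absorb (Program.oper A l.plain))) 1 := by
    intro port c h
    rw [CProgram.oper_ctrl, hl, ext_one, absorb_sel, absorb_ext, absorb_one]
  cases i with
  | gate g =>
    rw [Instr.matrix_gate, simulateInstr, Program.oper_cons, Program.oper_nil, one_mul,
      Instr.matrix_gate]
    exact absorb_gate g
  | call j inverse port c h =>
    rw [Instr.matrix_call, simulateInstr]
    by_cases hj : j = 0
    · subst hj
      have : (programAdversary A l.plain χ hχ).callOper 0 inverse = 1 := by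
        cases inverse
        · rfl
        · exact Matrix.conjTranspose_one
      rw [this, ext_one, sel_self, if_pos rfl, Program.oper_nil]
      exact absorb_one
    · have hstep : ((programAdversary A l.plain χ hχ).step j).1 = absorb (Program.oper A l.plain) := by
        simp only [programAdversary, if_neg hj]
      rw [if_neg hj]
      cases inverse
      · have : (programAdversary A l.plain χ hχ).callOper j false
            = absorb (Program.oper A l.plain) := hstep
        rw [this]
        exact hctrl port c h
      · have : (programAdversary A l.plain χ hχ).callOper j true
            = (absorb (Program.oper A l.plain)).conjTranspose :=
          congrArg Matrix.conjTranspose hstep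
        rw [this, if_pos rfl, Program.oper_inv, absorb_conjTranspose, hctrl port c h,
          sel_conjTranspose (Keeps.ext_of_notMem h _) (Keeps.one _), ← ext_conjTranspose,
          Matrix.conjTranspose_one]
        rfl

/-- The static extractor, with access to the prover `programAdversary A l.plain`, performs the
simulation of its program with access to `A`. -/
theorem absorb_simulate (A : Adversary N₁ q) (l : CProgram N₁ (N₂ ⊕ V) q)
    (hl : Program.oper A l.off = 1) (χ : Bits (N₂ ⊕ V) × A.E → ℂ) (hχ : normSq χ = 1)
    (prog : Program N₂ W 2) :
    absorb (Program.oper A (simulate l prog))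
      = Program.oper (programAdversary A l.plain χ hχ) prog := by
  induction prog with
  | nil => exact absorb_one
  | cons i prog ih =>
    have : simulate l (i :: prog) = simulateInstr l i ++ simulate l prog := List.flatMap_cons
    rw [this, Program.oper_append, Program.oper_cons, absorb_mul, ih,
      absorb_simulateInstr A l hl χ hχ]
    rfl

/-- The simulation preserves the wires that the prover's program preserves; in particular, those
that hold the instance. -/
theorem keeps_simulate (A : Adversary N₁ q) (l : CProgram N₁ (N₂ ⊕ V) q)
    (hl : Program.oper A l.off = 1) (v : V)
    (hv : Keeps (Sum.inr v) (Program.oper A l.plain)) (prog : Program N₂ W 2) :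
    Keeps (Sum.inr v) (Program.oper A (simulate l prog)) := by
  induction prog with
  | nil => exact Keeps.one _
  | cons i prog ih =>
    have : simulate l (i :: prog) = simulateInstr l i ++ simulate l prog := List.flatMap_cons
    rw [this, Program.oper_append]
    refine ih.mul ?_
    have hctrl : ∀ (port : N₂ ↪ W) (c : W) (h : c ∉ Set.range port),
        Keeps (Sum.inr v) (Program.oper A (l.ctrl (withSpectators V port) (Sum.inl c)
          (inl_notMem_withSpectators h))) := by
      intro port c h
      rw [CProgram.oper_ctrl, hl, ext_one]
      exact (Keeps.ext (withSpectators V port) hv).sel (Keeps.one _)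
    cases i with
    | gate g =>
      rw [simulateInstr, Program.oper_cons, Program.oper_nil, one_mul, Instr.matrix_gate]
      refine Keeps.ext_of_notMem ?_ _
      rintro ⟨i, hi⟩
      exact Sum.inl_ne_inr hi
    | call j inverse port c h =>
      rw [simulateInstr]
      split_ifs
      · exact Keeps.one _
      · rw [Program.oper_inv]
        exact (hctrl port c h).conjTranspose
      · exact hctrl port c h

/-- Each call of the prover is replaced by its controlled program, and each other instruction is
kept. -/
theorem simulate_cost (l : CProgram N₁ (N₂ ⊕ V) q) (B : ℕ)
    (hB : ∀ (ι : N₂ ⊕ V ↪ W ⊕ V) c hc, Program.cost (l.ctrl ι c hc) ≤ B) (prog : Program N₂ W 2) :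
    Program.cost (simulate l prog) ≤ prog.cost * (B + 1) := by
  induction prog with
  | nil => simp [simulate, Program.cost]
  | cons i prog ih =>
    have : simulate l (i :: prog) = simulateInstr l i ++ simulate l prog := List.flatMap_cons
    rw [this, Program.cost_append]
    have h1 : Program.cost (i :: prog) = i.cost + Program.cost prog := by simp [Program.cost]
    rw [h1, add_mul]
    refine add_le_add ?_ ih
    cases i with
    | gate g =>
      simp only [simulateInstr, Program.cost, Instr.cost, List.map_cons, List.map_nil,
        List.sum_cons, List.sum_nil, add_zero]
      exact Nat.le_mul_of_pos_right _ (Nat.succ_pos B)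
    | call j inverse port c h =>
      rw [simulateInstr]
      split_ifs
      · simp [Program.cost]
      · rw [Program.cost_inv]
        simpa [Instr.cost] using (hB _ _ _).trans (Nat.le_succ B)
      · simpa [Instr.cost] using (hB _ _ _).trans (Nat.le_succ B)

end Simulation

/-! ### The extractor -/

section Extractor

variable {N₁ N₂ X O R : Type} [Fintype N₁] [DecidableEq N₁] [Fintype N₂] [DecidableEq N₂]
  [Fintype X] [DecidableEq X] [Fintype O] [DecidableEq O] [Fintype R] [DecidableEq R] {q : ℕ}

/-- The internal wires of the derived prover: the communication register of the adversary, a copy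
of the instance, and the remaining wires `R`. -/
abbrev Inner (N₁ X R : Type) : Type := N₁ ⊕ (X ⊕ R)

/-- The wires of a static extractor with `k` work wires. -/
abbrev KWires (N₂ X O : Type) (k : ℕ) : Type := N₂ ⊕ X ⊕ O ⊕ Fin k

/-- The wires of the adaptive extractor, in the order required by `BlackBoxAlg`: its instance
output is the copy of the instance held by the prover, its witness output is the output of the
static extractor. -/
def wireEquiv (N₁ N₂ X O R : Type) [Fintype N₂] [Fintype X] [Fintype R] (k : ℕ) :
    KWires N₂ X O k ⊕ Inner N₁ X R ≃
      N₁ ⊕ Empty ⊕ (X ⊕ O) ⊕ Fin (Fintype.card (N₂ ⊕ X ⊕ Fin k ⊕ R)) where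
  toFun
    | .inl (.inl n) => .inr (.inr (.inr (Fintype.equivFin _ (.inl n))))
    | .inl (.inr (.inl x)) => .inr (.inr (.inr (Fintype.equivFin _ (.inr (.inl x)))))
    | .inl (.inr (.inr (.inl o))) => .inr (.inr (.inl (.inr o)))
    | .inl (.inr (.inr (.inr i))) => .inr (.inr (.inr (Fintype.equivFin _ (.inr (.inr (.inl i))))))
    | .inr (.inl n) => .inl n
    | .inr (.inr (.inl x)) => .inr (.inr (.inl (.inl x)))
    | .inr (.inr (.inr r)) => .inr (.inr (.inr (Fintype.equivFin _ (.inr (.inr (.inr r))))))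
  invFun
    | .inl n => .inr (.inl n)
    | .inr (.inr (.inl (.inl x))) => .inr (.inr (.inl x))
    | .inr (.inr (.inl (.inr o))) => .inl (.inr (.inr (.inl o)))
    | .inr (.inr (.inr i)) => match (Fintype.equivFin (N₂ ⊕ X ⊕ Fin k ⊕ R)).symm i with
      | .inl n => .inl (.inl n)
      | .inr (.inl x) => .inl (.inr (.inl x))
      | .inr (.inr (.inl i)) => .inl (.inr (.inr (.inr i)))
      | .inr (.inr (.inr r)) => .inr (.inr (.inr r))
  left_inv v := by
    rcases v with ((n | (x | (o | i))) | (n | (x | r))) <;> simp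
  right_inv v := by
    rcases v with (n | (e | ((x | o) | i)))
    · rfl
    · exact e.elim
    · rfl
    · rfl
    · obtain ⟨s, rfl⟩ := (Fintype.equivFin (N₂ ⊕ X ⊕ Fin k ⊕ R)).surjective i
      rcases s with (n | (x | (i | r))) <;> simp

/-- The copy of the instance to the input wires of the static extractor. -/
def copyToInput (N₁ N₂ O R : Type) [DecidableEq N₁] [DecidableEq N₂] [DecidableEq O]
    [DecidableEq R] (k : ℕ) (x : X) : Toggle (KWires N₂ X O k ⊕ Inner N₁ X R) where
  supp := {.inr (.inr (.inl x))}
  tgt := .inl (.inr (.inl x))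
  fn b := b (.inr (.inr (.inl x)))
  tgt_notMem := by simp
  fn_congr b b' h := h _ (Finset.mem_singleton_self _)

/-- The wires of the prover among those of the extractor. -/
def proverWires (N₁ N₂ X O R : Type) (k : ℕ) :
    N₂ ⊕ Inner N₁ X R ↪ KWires N₂ X O k ⊕ Inner N₁ X R :=
  withSpectators _ Function.Embedding.inl

/-- The program of the adaptive extractor: prepare the prover, give the instance to the static
extractor, run the latter. -/
def extractorProgram (pre : Program N₁ (N₂ ⊕ Inner N₁ X R) q) (l : CProgram N₁ (N₂ ⊕ Inner N₁ X R) q)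
    (K : BlackBoxAlg N₂ X O 2) : Program N₁ (KWires N₂ X O K.work ⊕ Inner N₁ X R) q :=
  pre.map (proverWires N₁ N₂ X O R K.work) ++
    Program.ofCircuit ((Finset.univ : Finset X).toList.map
      fun x => (copyToInput N₁ N₂ O R K.work x).gate) ++
    simulate l K.prog

/-- The adaptive extractor built from a static one. -/
def extractor (pre : Program N₁ (N₂ ⊕ Inner N₁ X R) q) (l : CProgram N₁ (N₂ ⊕ Inner N₁ X R) q)
    (K : BlackBoxAlg N₂ X O 2) : BlackBoxAlg N₁ Empty (X ⊕ O) q where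
  work := _
  prog := (extractorProgram pre l K).map (wireEquiv N₁ N₂ X O R K.work).toEmbedding

open Classical in
/-- The initial state of the prover's wires: those of the adversary hold its initial state, the
other ones hold 0. -/
def startState (N₂ X R : Type) (A : Adversary N₁ q) : Bits (N₂ ⊕ Inner N₁ X R) × A.E → ℂ := fun p =>
  if (∀ v, p.1 (.inl v) = false) ∧ ∀ v, p.1 (.inr (.inr v)) = false then
    A.init (fun v => p.1 (.inr (.inl v)), p.2) else 0

/-- The instance held by the prover. -/
def heldInstance (b : Bits (N₂ ⊕ Inner N₁ X R)) : Bits X := fun x => b (.inr (.inr (.inl x)))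

/-- The part of the state `ψ` in which the prover holds the instance `x`. -/
def restrict (x : Bits X) {E : Type} (ψ : Bits (N₂ ⊕ Inner N₁ X R) × E → ℂ) :
    Bits (N₂ ⊕ Inner N₁ X R) × E → ℂ :=
  {p : Bits (N₂ ⊕ Inner N₁ X R) × E | heldInstance p.1 = x}.indicator ψ

theorem Adversary.nonempty (A : Adversary N₁ q) : Nonempty (Bits N₁ × A.E) := by
  by_contra h
  rw [not_nonempty_iff] at h
  have := A.init_norm
  simp at this

/-- An arbitrary basis state. -/
def someState (N₂ X R : Type) (A : Adversary N₁ q) : Bits (N₂ ⊕ Inner N₁ X R) × A.E :=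
  (zeros _, (Classical.choice A.nonempty).2)

/-- The static prover that holds the instance `x`, after the preparation `pre`. -/
def proverAt (A : Adversary N₁ q) (pre : Program N₁ (N₂ ⊕ Inner N₁ X R) q)
    (l : CProgram N₁ (N₂ ⊕ Inner N₁ X R) q) (x : Bits X) : Adversary N₂ 2 :=
  programAdversary A l.plain
    (normalise (someState N₂ X R A) (restrict x ((pre.oper A).mulVec (startState N₂ X R A))))
    (normSq_normalise _ _)

/-- The probability that the prover holds the instance `x`, after the preparation `pre`. -/
def instProb (A : Adversary N₁ q) (pre : Program N₁ (N₂ ⊕ Inner N₁ X R) q) (x : Bits X) : ℝ :=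
  normSq (restrict x ((pre.oper A).mulVec (startState N₂ X R A)))

theorem instProb_nonneg (A : Adversary N₁ q) (pre : Program N₁ (N₂ ⊕ Inner N₁ X R) q)
    (x : Bits X) : 0 ≤ instProb A pre x := normSq_nonneg _

theorem normSq_startState (A : Adversary N₁ q) : normSq (startState N₂ X R A) = 1 := by
  classical
  rw [← A.init_norm]
  unfold normSq
  symm
  refine Fintype.sum_of_injective (fun p : Bits N₁ × A.E =>
    (((fun v => match v with
      | .inr (.inl n) => p.1 n
      | _ => false : Bits (N₂ ⊕ Inner N₁ X R))), p.2)) ?_ _ _ ?_ ?_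
  · rintro ⟨b, e⟩ ⟨b', e'⟩ h
    simp only [Prod.mk.injEq] at h ⊢
    exact ⟨funext fun n => congrFun h.1 (.inr (.inl n)), h.2⟩
  · rintro ⟨b, e⟩ h
    unfold startState
    rw [if_neg, norm_zero, zero_pow two_ne_zero]
    rintro ⟨h1, h2⟩
    refine h ⟨(fun n => b (.inr (.inl n)), e), Prod.ext (funext fun v => ?_) rfl⟩
    rcases v with (v | (v | v))
    · exact (h1 v).symm
    · rfl
    · exact (h2 v).symm
  · rintro ⟨b, e⟩
    simp [startState]

theorem sum_normSq_restrict {E : Type} [Fintype E] [DecidableEq E]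
    (ψ : Bits (N₂ ⊕ Inner N₁ X R) × E → ℂ) : ∑ x : Bits X, normSq (restrict x ψ) = normSq ψ := by
  classical
  unfold normSq
  rw [Finset.sum_comm]
  refine Finset.sum_congr rfl fun p _ => ?_
  rw [Finset.sum_eq_single (heldInstance p.1)]
  · simp [restrict]
  · intro x _ hx
    simp [restrict, hx.symm]
  · simp

/-- The preparation produces some instance. -/
theorem sum_instProb (A : Adversary N₁ q) (pre : Program N₁ (N₂ ⊕ Inner N₁ X R) q) :
    ∑ x, instProb A pre x = 1 := by
  unfold instProb
  rw [sum_normSq_restrict, normSq_mulVec (pre.oper_mem_unitary A), normSq_startState]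

open Classical in
/-- The state of the extractor before the static extractor runs, expressed by the state of the
prover. -/
def handover {k : ℕ} {E : Type} (ψ : Bits (N₂ ⊕ Inner N₁ X R) × E → ℂ) :
    Bits (KWires N₂ X O k ⊕ Inner N₁ X R) × E → ℂ := fun p =>
  if (∀ x, p.1 (.inl (.inr (.inl x))) = p.1 (.inr (.inr (.inl x)))) ∧
    ∀ v, p.1 (.inl (.inr (.inr v))) = false then
    ψ (p.1 ∘ proverWires N₁ N₂ X O R k, p.2) else 0

open Classical in
/-- The state of the extractor before the instance is copied to its input wires. -/
def preHandover {k : ℕ} {E : Type} (ψ : Bits (N₂ ⊕ Inner N₁ X R) × E → ℂ) :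
    Bits (KWires N₂ X O k ⊕ Inner N₁ X R) × E → ℂ := fun p =>
  if ∀ v, p.1 (.inl (.inr v)) = false then ψ (p.1 ∘ proverWires N₁ N₂ X O R k, p.2) else 0

theorem inl_inr_notMem_proverWires {k : ℕ} (v : X ⊕ O ⊕ Fin k) :
    (.inl (.inr v) : KWires N₂ X O k ⊕ Inner N₁ X R) ∉ Set.range (proverWires N₁ N₂ X O R k) := by
  rintro ⟨i | i, hi⟩
  · exact Sum.inl_ne_inr (Sum.inl.inj hi)
  · exact Sum.inr_ne_inl hi

theorem ext_mulVec_preHandover {k : ℕ} {E : Type} [Fintype E] [DecidableEq E]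
    (M : Oper (N₂ ⊕ Inner N₁ X R) E) (ψ : Bits (N₂ ⊕ Inner N₁ X R) × E → ℂ) :
    (ext (proverWires N₁ N₂ X O R k) M).mulVec (preHandover ψ) = preHandover (M.mulVec ψ) := by
  classical
  funext p
  rw [ext_mulVec, preHandover]
  have h : ∀ (c : Bits (N₂ ⊕ Inner N₁ X R)) (v : X ⊕ O ⊕ Fin k),
      Function.extend (proverWires N₁ N₂ X O R k) c p.1 (.inl (.inr v)) = p.1 (.inl (.inr v)) :=
    fun c v => extend_off (inl_inr_notMem_proverWires v)
  split_ifs with hp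
  · congr 1
    funext r
    simp only [slice, preHandover, h]
    rw [if_pos hp, extend_comp]
  · rw [show slice (proverWires N₁ N₂ X O R k) p.1 (preHandover ψ) = 0 by
      funext r
      simp only [slice, preHandover, h]
      rw [if_neg hp]
      rfl, Matrix.mulVec_zero]
    rfl

/-- The copies of the instance turn the state before the handover into that after the handover. -/
theorem copies_mulVec {k : ℕ} {E : Type} [Fintype E] [DecidableEq E]
    (L : List X) (hL : L.Nodup) (ψ : Bits (KWires N₂ X O k ⊕ Inner N₁ X R) × E → ℂ)
    (p : Bits (KWires N₂ X O k ⊕ Inner N₁ X R) × E) :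
    (Circuit.oper (L.map fun x => (copyToInput N₁ N₂ O R k x).gate)).mulVec ψ p
      = ψ (fun v => match v with
          | .inl (.inr (.inl x)) =>
              xor (p.1 (.inl (.inr (.inl x)))) (decide (x ∈ L) && p.1 (.inr (.inr (.inl x))))
          | v => p.1 v, p.2) := by
  induction L generalizing ψ with
  | nil =>
    simp only [List.map_nil, Circuit.oper, seqProd_nil, Matrix.one_mulVec]
    congr 1
    refine Prod.ext (funext fun v => ?_) rfl
    rcases v with ((n | (x | (o | i))) | (n | (x | r))) <;> simp
  | cons x L ih =>
    have hx := (List.nodup_cons.1 hL)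
    have h1 : (Circuit.oper ((x :: L).map fun x => (copyToInput N₁ N₂ O R k x).gate) : Oper _ E)
        = Circuit.oper (L.map fun x => (copyToInput N₁ N₂ O R k x).gate)
          * (copyToInput N₁ N₂ O R k x).gate.oper := by
      simp [Circuit.oper]
    rw [h1, ← Matrix.mulVec_mulVec, ih hx.2, Toggle.gate_mulVec]
    congr 1
    refine Prod.ext (funext fun v => ?_) rfl
    rcases v with ((n | (y | (o | i))) | (n | (y | r)))
    all_goals simp only [Toggle.flip, copyToInput, Function.update_apply, reduceCtorEq, if_false,
      Sum.inl.injEq, Sum.inr.injEq]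
    by_cases hy : y = x
    · subst hy
      simp [hx.1]
    · simp [hy]

theorem copies_mulVec_preHandover {k : ℕ} {E : Type} [Fintype E] [DecidableEq E]
    (ψ : Bits (N₂ ⊕ Inner N₁ X R) × E → ℂ) :
    (Circuit.oper ((Finset.univ : Finset X).toList.map
      fun x => (copyToInput N₁ N₂ O R k x).gate)).mulVec (preHandover ψ) = handover ψ := by
  classical
  funext p
  rw [copies_mulVec _ (Finset.nodup_toList _)]
  simp only [Finset.mem_toList, Finset.mem_univ, decide_true, Bool.true_and, preHandover, handover]
  congr 1
  · rw [eq_iff_iff]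
    constructor
    · intro h
      refine ⟨fun x => ?_, fun v => ?_⟩
      · have := h (.inl x)
        simpa using this
      · exact h (.inr v)
    · rintro ⟨h, h'⟩ (x | v)
      · simpa using h x
      · exact h' v
  · congr 1
    refine Prod.ext (funext fun v => ?_) rfl
    rcases v with (n | (n | (x | r))) <;> rfl

theorem outputProb_eq (A : Adversary N₁ q) (pre : Program N₁ (N₂ ⊕ Inner N₁ X R) q)
    (l : CProgram N₁ (N₂ ⊕ Inner N₁ X R) q) (K : BlackBoxAlg N₂ X O 2) (S : Set (Bits (X ⊕ O))) :
    (extractor pre l K).outputProb A Empty.elim S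
      = measureProb ((Program.oper A (simulate l K.prog)).mulVec
          (handover ((pre.oper A).mulVec (startState N₂ X R A))))
        {p | Sum.elim (fun x => p.1 (.inr (.inr (.inl x))))
          (fun o => p.1 (.inl (.inr (.inr (.inl o))))) ∈ S} := by
  classical
  set ε := wireEquiv N₁ N₂ X O R K.work with hε
  -- reindexing of basis states along `wireEquiv`
  let F : Bits (KWires N₂ X O K.work ⊕ Inner N₁ X R) × A.E ≃
      Bits (N₁ ⊕ Empty ⊕ (X ⊕ O) ⊕ Fin (Fintype.card (N₂ ⊕ X ⊕ Fin K.work ⊕ R))) × A.E :=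
    { toFun := fun p => (p.1 ∘ ε.symm, p.2)
      invFun := fun p => (p.1 ∘ ε, p.2)
      left_inv := fun p => Prod.ext (funext fun v => by simp) rfl
      right_inv := fun p => Prod.ext (funext fun v => by simp) rfl }
  have hfin : ∀ (M : Oper (KWires N₂ X O K.work ⊕ Inner N₁ X R) A.E)
      (ψ : Bits (N₁ ⊕ Empty ⊕ (X ⊕ O) ⊕ Fin (Fintype.card (N₂ ⊕ X ⊕ Fin K.work ⊕ R))) × A.E → ℂ),
      (ext ε.toEmbedding M).mulVec ψ ∘ F = M.mulVec (ψ ∘ F) := by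
    intro M ψ
    funext p
    rw [Function.comp_apply, ext_mulVec]
    have h1 : ((F p).1 ∘ ε.toEmbedding, (F p).2) = p := F.left_inv p
    rw [h1]
    congr 1
    funext r
    change ψ _ = ψ _
    congr 1
    refine Prod.ext (funext fun v => ?_) rfl
    obtain ⟨w, rfl⟩ := ε.surjective v
    change Function.extend ε r.1 _ (ε w) = r.1 (ε.symm (ε w))
    rw [ε.injective.extend_apply, ε.symm_apply_apply]
  have hinit : (extractor pre l K).initState A Empty.elim ∘ F
      = preHandover (startState N₂ X R A) := by
    funext p
    unfold preHandover startState
    have h3 : (F p).1 ∘ Sum.inr = Sum.elim Empty.elim (zeros ((X ⊕ O) ⊕ Fin (extractor pre l K).work))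
        ↔ (∀ v, p.1 (.inl (.inr v)) = false) ∧ (∀ v, p.1 (.inl (.inl v)) = false) ∧
          ∀ v, p.1 (.inr (.inr v)) = false := by
      constructor
      · intro h
        have h' : ∀ v, p.1 (ε.symm (.inr (.inr v))) = false := fun v => congrFun h (.inr v)
        have h'' : ∀ (w) (v), ε w = .inr (.inr v) → p.1 w = false := by
          intro w v hw
          rw [← h' v, ← hw, ε.symm_apply_apply]
        refine ⟨?_, ?_, ?_⟩
        · rintro (x | (o | i))
          · exact h'' _ _ rfl
          · exact h'' _ _ rfl
          · exact h'' _ _ rfl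
        · exact fun v => h'' _ _ rfl
        · rintro (x | r)
          · exact h'' _ _ rfl
          · exact h'' _ _ rfl
      · rintro ⟨ha, hb, hc⟩
        funext v
        rcases v with e | v
        · exact e.elim
        · change p.1 (ε.symm (.inr (.inr v))) = false
          obtain ⟨w, hw⟩ := ε.surjective (.inr (.inr v))
          rw [← hw, ε.symm_apply_apply]
          rcases w with ((n | w) | (n | w))
          · exact hb n
          · exact ha w
          · exact absurd hw Sum.inl_ne_inr
          · exact hc w
    by_cases ha : ∀ v, p.1 (.inl (.inr v)) = false
    · rw [if_pos ha]
      by_cases hb : (∀ v, p.1 (.inl (.inl v)) = false) ∧ ∀ v, p.1 (.inr (.inr v)) = false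
      · exact (if_pos (h3.2 ⟨ha, hb⟩)).trans (if_pos hb).symm
      · exact (if_neg fun h => hb (h3.1 h).2).trans (if_neg hb).symm
    · rw [if_neg ha]
      exact if_neg fun h => ha (h3.1 h).1
  have hprog : Program.oper A (extractor pre l K).prog
      = ext ε.toEmbedding (Program.oper A (extractorProgram pre l K)) := Program.oper_map _ _ _
  have hstate : (Program.oper A (extractor pre l K).prog).mulVec
      ((extractor pre l K).initState A Empty.elim) ∘ F
      = (Program.oper A (simulate l K.prog)).mulVec
          (handover ((pre.oper A).mulVec (startState N₂ X R A))) := by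
    rw [hprog]
    refine ((hfin _ _).trans (congrArg _ hinit)).trans ?_
    rw [extractorProgram, Program.oper_append, Program.oper_append, ← Matrix.mulVec_mulVec,
      ← Matrix.mulVec_mulVec, Program.oper_map, ext_mulVec_preHandover, Program.oper_ofCircuit,
      copies_mulVec_preHandover]
  rw [BlackBoxAlg.outputProb, Program.foldl_mulVec]
  refine (measureProb_comp_equiv F _ _).symm.trans (congrArg₂ measureProb hstate ?_)
  ext p
  have : (fun o => (F p).1 (.inr (.inr (.inl o)))) = Sum.elim (fun x => p.1 (.inr (.inr (.inl x))))
          (fun o => p.1 (.inl (.inr (.inr (.inl o))))) := by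
    funext o
    cases o <;> rfl
  exact iff_of_eq (congrArg (· ∈ S) this)

theorem mulVec_indicator {W E : Type} [Fintype W] [DecidableEq W] [Fintype E] [DecidableEq E]
    {V : Type} (f : V → W) {M : Oper W E} (hM : ∀ v, Keeps (f v) M) (x : Bits V)
    (ψ : Bits W × E → ℂ) :
    M.mulVec ({p : Bits W × E | p.1 ∘ f = x}.indicator ψ)
      = {p : Bits W × E | p.1 ∘ f = x}.indicator (M.mulVec ψ) := by
  classical
  funext p
  have h0 : ∀ q, p.1 ∘ f ≠ q.1 ∘ f → M p q = 0 := by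
    intro q h
    obtain ⟨v, hv⟩ := Function.ne_iff.1 h
    exact hM v p q hv
  simp only [Set.indicator, Set.mem_ofPred_eq, mulVec_eq]
  split_ifs with hp
  · refine Finset.sum_congr rfl fun q _ => ?_
    by_cases hq : q.1 ∘ f = x
    · rw [if_pos hq]
    · rw [if_neg hq, h0 q fun h => hq (h ▸ hp), mul_zero, zero_mul]
  · refine Finset.sum_eq_zero fun q _ => ?_
    by_cases hq : q.1 ∘ f = x
    · rw [h0 q fun h => hp (h ▸ hq), zero_mul]
    · rw [if_neg hq, mul_zero]

/-- The adaptive extractor succeeds with the average, over the instance `x` held by the prover, of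
the probability that the static extractor succeeds with `proverAt x`. -/
theorem outputProb_extractor (A : Adversary N₁ q) (pre : Program N₁ (N₂ ⊕ Inner N₁ X R) q)
    (l : CProgram N₁ (N₂ ⊕ Inner N₁ X R) q) (hl : Program.oper A l.off = 1)
    (hkeep : ∀ x : X, Keeps (.inr (.inr (.inl x))) (Program.oper A l.plain))
    (K : BlackBoxAlg N₂ X O 2) (S : Set (Bits X)) [DecidablePred (· ∈ S)]
    (rel : Bits X → Bits O → Prop) :
    (extractor pre l K).outputProb A Empty.elim
        {o | o ∘ Sum.inl ∈ S ∧ rel (o ∘ Sum.inl) (o ∘ Sum.inr)}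
      = ∑ x with x ∈ S, instProb A pre x *
          K.outputProb (proverAt A pre l x) x {w | rel x w} := by
  classical
  set Ψ := (pre.oper A).mulVec (startState N₂ X R A) with hΨ
  set M := Program.oper A (simulate l K.prog) with hM
  have hMk : ∀ x : X, Keeps (.inr (.inr (.inl x))) M := fun x => keeps_simulate A l hl _ (hkeep x) _
  -- each summand is the probability of the event, when `x` is held
  have hterm : ∀ x : Bits X, instProb A pre x *
      K.outputProb (proverAt A pre l x) x {w | rel x w}
      = measureProb ({p : Bits (KWires N₂ X O K.work ⊕ Inner N₁ X R) × A.E |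
          p.1 ∘ (fun x => .inr (.inr (.inl x))) = x}.indicator (M.mulVec (handover Ψ)))
          {p | rel x fun o => p.1 (.inl (.inr (.inr (.inl o))))} := by
    intro x
    rw [← mulVec_indicator _ hMk]
    set χ := normalise (someState N₂ X R A) (restrict x Ψ) with hχ
    have hstate : ({p : Bits (KWires N₂ X O K.work ⊕ Inner N₁ X R) × A.E |
          p.1 ∘ (fun x => .inr (.inr (.inl x))) = x}.indicator (handover Ψ))
          ∘ assocEquiv (KWires N₂ X O K.work) (Inner N₁ X R) A.E
        = ((Real.sqrt (instProb A pre x) : ℝ) : ℂ) • K.initState (proverAt A pre l x) x := by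
      funext p
      have e1 : ∀ (z : Bits (N₂ ⊕ Inner N₁ X R) × A.E),
          restrict x Ψ z = ((Real.sqrt (instProb A pre x) : ℝ) : ℂ) * χ z := by
        intro z
        conv_lhs => rw [← sqrt_smul_normalise (someState N₂ X R A) (restrict x Ψ)]
        rfl
      set z : Bits (N₂ ⊕ Inner N₁ X R) × A.E := (Sum.elim (p.1 ∘ Sum.inl) p.2.1, p.2.2) with hz
      have e2 : (proverAt A pre l x).init (p.1 ∘ Sum.inl, p.2) = χ z := rfl
      have e3 : handover Ψ (assocEquiv (KWires N₂ X O K.work) (Inner N₁ X R) A.E p)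
          = if (∀ x, p.1 (.inr (.inl x)) = p.2.1 (.inr (.inl x))) ∧
              ∀ v, p.1 (.inr (.inr v)) = false then Ψ z else 0 := by
        have : (assocEquiv (KWires N₂ X O K.work) (Inner N₁ X R) A.E p).1
            ∘ proverWires N₁ N₂ X O R K.work = z.1 := by
          funext v
          cases v <;> rfl
        unfold handover
        rw [this]
        rfl
      have h4 : p.1 ∘ Sum.inr = Sum.elim x (zeros (O ⊕ Fin K.work)) ↔
          (∀ y, p.1 (.inr (.inl y)) = x y) ∧ ∀ v, p.1 (.inr (.inr v)) = false := by
        constructor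
        · intro h
          exact ⟨fun y => congrFun h (.inl y), fun v => congrFun h (.inr v)⟩
        · rintro ⟨h, h'⟩
          funext v
          rcases v with v | v
          · exact h v
          · exact h' v
      have h5 : assocEquiv (KWires N₂ X O K.work) (Inner N₁ X R) A.E p ∈
          {p : Bits (KWires N₂ X O K.work ⊕ Inner N₁ X R) × A.E |
            p.1 ∘ (fun x => .inr (.inr (.inl x))) = x} ↔ ∀ y, p.2.1 (.inr (.inl y)) = x y :=
        funext_iff
      have h6 : restrict x Ψ z = if ∀ y, p.2.1 (.inr (.inl y)) = x y then Ψ z else 0 := by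
        unfold restrict
        rw [Set.indicator_apply]
        exact if_congr funext_iff rfl rfl
      have h7 : (((Real.sqrt (instProb A pre x) : ℝ) : ℂ) • K.initState (proverAt A pre l x) x) p
          = ((Real.sqrt (instProb A pre x) : ℝ) : ℂ) * K.initState (proverAt A pre l x) x p := rfl
      rw [Function.comp_apply, Set.indicator_apply, e3]
      refine Eq.trans ?_ h7.symm
      by_cases hx : ∀ y, p.2.1 (.inr (.inl y)) = x y
      · rw [if_pos (h5.2 hx)]
        rw [if_pos hx] at h6
        by_cases h8 : (∀ y, p.1 (.inr (.inl y)) = x y) ∧ ∀ v, p.1 (.inr (.inr v)) = false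
        · have : K.initState (proverAt A pre l x) x p = χ z := (if_pos (h4.2 h8)).trans e2
          rw [this, ← e1, h6]
          exact if_pos ⟨fun y => (h8.1 y).trans (hx y).symm, h8.2⟩
        · have : K.initState (proverAt A pre l x) x p = 0 := if_neg fun h => h8 (h4.1 h)
          rw [this, mul_zero]
          exact if_neg fun h => h8 ⟨fun y => (h.1 y).trans (hx y), h.2⟩
      · rw [if_neg fun h => hx (h5.1 h)]
        rw [if_neg hx, e1] at h6
        by_cases h8 : p.1 ∘ Sum.inr = Sum.elim x (zeros (O ⊕ Fin K.work))
        · have : K.initState (proverAt A pre l x) x p = χ z := (if_pos h8).trans e2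
          rw [this, h6]
        · have : K.initState (proverAt A pre l x) x p = 0 := if_neg h8
          rw [this, mul_zero]
    have hout : K.outputProb (proverAt A pre l x) x {w | rel x w}
        = measureProb ((absorb M).mulVec (K.initState (proverAt A pre l x) x :
            Bits (KWires N₂ X O K.work) × (Bits (Inner N₁ X R) × A.E) → ℂ))
          {p | rel x fun o => p.1 (.inr (.inr (.inl o)))} := by
      rw [hM, absorb_simulate A l hl χ (normSq_normalise _ _), BlackBoxAlg.outputProb,
        Program.foldl_mulVec]
      rfl
    rw [hout, ← measureProb_comp_equiv (assocEquiv (KWires N₂ X O K.work) (Inner N₁ X R) A.E),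
      ← absorb_mulVec, hstate]
    generalize (K.initState (proverAt A pre l x) x :
      Bits (KWires N₂ X O K.work) × (Bits (Inner N₁ X R) × A.E) → ℂ) = φ
    have hsmul : (absorb M).mulVec (((Real.sqrt (instProb A pre x) : ℝ) : ℂ) • φ)
        = ((Real.sqrt (instProb A pre x) : ℝ) : ℂ) • (absorb M).mulVec φ := Matrix.mulVec_smul _ _ _
    refine Eq.trans ?_ (congrArg (fun ψ => measureProb ψ _) hsmul).symm
    rw [measureProb_smul, Real.sq_sqrt (instProb_nonneg _ _ _)]
    rfl
  rw [outputProb_eq, Finset.sum_congr rfl fun x _ => hterm x]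
  unfold measureProb
  rw [Finset.sum_comm]
  refine Finset.sum_congr rfl fun p _ => ?_
  set x₀ : Bits X := p.1 ∘ (fun x => .inr (.inr (.inl x))) with hx₀
  have hzero : ∀ x, x ≠ x₀ → ({p : Bits (KWires N₂ X O K.work ⊕ Inner N₁ X R) × A.E |
      rel x fun o => p.1 (.inl (.inr (.inr (.inl o))))}.indicator (fun i =>
      ‖{p : Bits (KWires N₂ X O K.work ⊕ Inner N₁ X R) × A.E |
          p.1 ∘ (fun x => .inr (.inr (.inl x))) = x}.indicator (M.mulVec (handover Ψ)) i‖ ^ 2) p)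
        = 0 := by
    intro x hx
    refine Set.indicator_apply_eq_zero.2 fun _ => ?_
    rw [Set.indicator_of_notMem fun h => hx h.symm, norm_zero, zero_pow two_ne_zero]
  by_cases hS : x₀ ∈ S
  · rw [Finset.sum_eq_single_of_mem x₀ (by simpa using hS) fun x _ hx => hzero x hx]
    simp only [Set.indicator, Set.mem_ofPred_eq]
    rw [if_pos hx₀.symm]
    refine if_congr ?_ rfl rfl
    exact and_iff_right hS
  · rw [Finset.sum_eq_zero fun x hx => hzero x fun h => hS (h ▸ (Finset.mem_filter.1 hx).2)]
    exact Set.indicator_of_notMem (fun h => hS h.1) _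

end Extractor

/-! ### Controlled gates and the circuits of the derived prover -/

section ControlledGates

variable {W W₁ W₂ E E' : Type} [Fintype W] [DecidableEq W] [Fintype W₁] [DecidableEq W₁]
  [Fintype W₂] [DecidableEq W₂] [Fintype E] [DecidableEq E] [Fintype E'] [DecidableEq E']

/-- The matrix of the unitary `U`, controlled by an additional qubit. -/
def ctrlMatrix {k : ℕ} (U : Matrix (BitString k) (BitString k) ℂ) :
    Matrix (BitString (k + 1)) (BitString (k + 1)) ℂ :=
  (sel 0 (ext (Fin.succEmb k) (tensorOne U)) 1 : Oper (Fin (k + 1)) Unit).submatrix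
    (fun b => (b, ())) fun b => (b, ())

theorem zero_notMem_range_succEmb (k : ℕ) : (0 : Fin (k + 1)) ∉ Set.range (Fin.succEmb k) := by
  rintro ⟨i, hi⟩
  exact Fin.succ_ne_zero i hi

theorem ctrlMatrix_mem_unitary {k : ℕ} {U : Matrix (BitString k) (BitString k) ℂ}
    (hU : U ∈ Matrix.unitaryGroup _ ℂ) : ctrlMatrix U ∈ Matrix.unitaryGroup _ ℂ := by
  have h : (sel 0 (ext (Fin.succEmb k) (tensorOne U)) 1 : Oper (Fin (k + 1)) Unit)
      ∈ Matrix.unitaryGroup _ ℂ :=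
    sel_mem_unitary (Keeps.ext_of_notMem (zero_notMem_range_succEmb k) _) (Keeps.one _)
      (ext_mem_unitary _ (tensorOne_mem_unitary hU)) (one_mem _)
  refine Matrix.mem_unitaryGroup_iff.2 ?_
  change ctrlMatrix U * (ctrlMatrix U).conjTranspose = 1
  rw [ctrlMatrix, Matrix.conjTranspose_submatrix]
  have := Matrix.submatrix_mul_equiv (sel 0 (ext (Fin.succEmb k) (tensorOne U)) 1 :
    Oper (Fin (k + 1)) Unit) (sel 0 (ext (Fin.succEmb k) (tensorOne U)) 1).conjTranspose
    (fun b => (b, ())) (Equiv.prodPUnit (BitString (k + 1))).symm (fun b => (b, ()))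
  refine this.trans ?_
  rw [mul_conjTranspose_of_unitary h]
  exact Matrix.submatrix_one_equiv (Equiv.prodPUnit (BitString (k + 1))).symm

theorem tensorOne_ctrlMatrix {k : ℕ} (U : Matrix (BitString k) (BitString k) ℂ) :
    (tensorOne (ctrlMatrix U) : Oper (Fin (k + 1)) E)
      = sel 0 (ext (Fin.succEmb k) (tensorOne U)) 1 := by
  classical
  funext p p'
  have h1 : ctrlMatrix U p.1 p'.1 = if p.1 0 = true then
      (ext (Fin.succEmb k) (tensorOne U) : Oper (Fin (k + 1)) Unit) (p.1, ()) (p'.1, ())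
      else (1 : Oper (Fin (k + 1)) Unit) (p.1, ()) (p'.1, ()) := rfl
  rw [tensorOne, sel_apply, h1]
  by_cases h0 : p.1 0 = true
  · rw [if_pos h0, if_pos h0]
    by_cases hv : ∀ v, v ∉ Set.range (Fin.succEmb k) → p.1 v = p'.1 v
    · rw [ext_apply_of hv, ext_apply_of (p := (p.1, ())) (p' := (p'.1, ())) hv]
      simp [tensorOne]
    · rw [ext_apply_of_not hv, ext_apply_of_not (p := (p.1, ())) (p' := (p'.1, ())) hv, ite_self]
  · rw [if_neg h0, if_neg h0]
    simp only [Matrix.one_apply, Prod.ext_iff, and_true]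
    split_ifs <;> simp_all

/-- A controlled gate. -/
def Gate.ctrl (g : Gate W) (c : W) (hc : c ∉ Set.range g.wires) : Gate W :=
  ⟨g.arity + 1, ⟨Fin.cons c g.wires, Fin.cons_injective_iff.2 ⟨hc, g.wires.injective⟩⟩,
    ⟨ctrlMatrix g.unitary.1, ctrlMatrix_mem_unitary g.unitary.2⟩⟩

theorem Gate.ctrl_oper (g : Gate W) (c : W) (hc : c ∉ Set.range g.wires) :
    ((g.ctrl c hc).oper : Oper W E) = sel c g.oper 1 := by
  rw [Gate.oper]
  let ι : Fin (g.arity + 1) ↪ W := ⟨Fin.cons c g.wires, Fin.cons_injective_iff.2 ⟨hc, g.wires.injective⟩⟩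
  change ext ι (tensorOne (ctrlMatrix g.unitary.1)) = _
  rw [tensorOne_ctrlMatrix, ext_sel, ext_ext, ext_one]
  rfl

/-- A circuit on other wires, with an additional control wire. -/
def Circuit.ctrl (ι : W₁ ↪ W₂) (c : W₂) (hc : c ∉ Set.range ι) (C : Circuit W₁) : Circuit W₂ :=
  List.map (fun g => (g.map ι).ctrl c fun ⟨i, hi⟩ => hc ⟨g.wires i, hi⟩) C

theorem Circuit.ctrl_oper (ι : W₁ ↪ W₂) (c : W₂) (hc : c ∉ Set.range ι) (C : Circuit W₁) :
    ((C.ctrl ι c hc).oper : Oper W₂ E) = sel c (ext ι C.oper) 1 := by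
  induction C with
  | nil =>
    change seqProd [] = sel c (ext ι (seqProd [])) 1
    rw [seqProd_nil, seqProd_nil, ext_one, sel_self]
  | cons g C ih =>
    have h1 : (Circuit.oper (Circuit.ctrl ι c hc (g :: C)) : Oper W₂ E)
        = (Circuit.ctrl ι c hc C).oper * sel c (g.map ι).oper 1 := by
      rw [← Gate.ctrl_oper (g.map ι) c fun ⟨i, hi⟩ => hc ⟨g.wires i, hi⟩]
      simp [Circuit.oper, Circuit.ctrl]
    have h2 : (Circuit.oper (g :: C) : Oper W₁ E) = Circuit.oper C * g.oper := by
      simp [Circuit.oper]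
    rw [h1, ih, h2, ext_mul, Gate.map_oper, sel_mul (Keeps.ext_of_notMem hc _) (Keeps.one _),
      one_mul]

theorem Circuit.ctrl_cost (ι : W₁ ↪ W₂) (c : W₂) (hc : c ∉ Set.range ι) (C : Circuit W₁) :
    (C.ctrl ι c hc).cost = 4 * C.cost := by
  rw [Circuit.cost, Circuit.cost, Circuit.ctrl, List.map_map, ← List.sum_map_mul_left]
  congr 1
  refine List.map_congr_left fun g _ => ?_
  exact pow_succ' 4 _

/-- An operator, with the basis of the register renamed. -/
def renameReg (f : E ≃ E') (M : Oper W E') : Oper W E :=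
  M.submatrix (Prod.map id f) (Prod.map id f)

theorem renameReg_mul (f : E ≃ E') (M N : Oper W E') :
    renameReg f (M * N) = renameReg f M * renameReg f N :=
  (Matrix.submatrix_mul_equiv M N _ (Equiv.prodCongr (Equiv.refl _) f) _).symm

theorem renameReg_one (f : E ≃ E') : renameReg f (1 : Oper W E') = 1 :=
  Matrix.submatrix_one_equiv (Equiv.prodCongr (Equiv.refl _) f)

theorem renameReg_gate (f : E ≃ E') (g : Gate W) : renameReg f g.oper = g.oper := by
  funext p p'
  rw [Gate.oper_eq, Gate.oper_eq]
  simp [renameReg, tensorOne]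

end ControlledGates

section ProverCircuits

variable {N₁ N₂ V W : Type} [Fintype N₁] [DecidableEq N₁] [Fintype N₂] [DecidableEq N₂]
  [Fintype V] [DecidableEq V] [Fintype W] [DecidableEq W] {q : ℕ}

/-- The operator `M` on qubits, of which the last `n` encode a register with basis `E`. -/
def onRegister {E : Type} {n : ℕ} (e : E ≃ BitString n)
    (M : Matrix (Bits (W ⊕ Fin n)) (Bits (W ⊕ Fin n)) ℂ) : Oper W E := fun p p' =>
  M (Sum.elim p.1 (e p.2)) (Sum.elim p'.1 (e p'.2))

theorem onRegister_eq {E : Type} [Fintype E] [DecidableEq E] {n : ℕ} (e : E ≃ BitString n)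
    (M : Matrix (Bits (W ⊕ Fin n)) (Bits (W ⊕ Fin n)) ℂ) :
    onRegister e M = renameReg (e.trans (Equiv.prodPUnit _).symm)
      (absorb (tensorOne M : Oper (W ⊕ Fin n) Unit)) := by
  funext p p'
  exact (if_pos rfl : (if (() : Unit) = () then _ else (0 : ℂ)) = _).symm

/-- An instruction has a small circuit, if the adversary has: a gate on its own wires or a
controlled circuit for the adversary's unitary. -/
theorem exists_circuit_of_instr (A : Adversary N₁ q) {n b : ℕ} (e : A.E ≃ BitString n)
    (hA : ∀ j : Fin q, ∃ C : Circuit (N₁ ⊕ Fin n), C.cost ≤ b ∧ (A.step j).1 = onRegister e C.matrix)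
    (i : Instr N₁ W q) :
    ∃ C : Circuit (W ⊕ Fin n), C.cost ≤ i.cost * (4 * b + 1) ∧
      i.matrix A = onRegister e C.matrix := by
  cases i with
  | gate g =>
    refine ⟨[g.map Function.Embedding.inl], ?_, ?_⟩
    · have : Circuit.cost [g.map (Function.Embedding.inl : W ↪ W ⊕ Fin n)] = g.cost := by
        simp only [Circuit.cost, List.map_cons, List.map_nil, List.sum_cons, List.sum_nil, add_zero]
        rfl
      rw [this]
      exact Nat.le_mul_of_pos_right _ (Nat.succ_pos _)
    · rw [onRegister_eq, ← Circuit.oper_eq, Instr.matrix_gate]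
      simp only [Circuit.oper, List.map_cons, List.map_nil, seqProd_cons, seqProd_nil, one_mul]
      rw [absorb_gate, renameReg_gate]
  | call j inverse port c h =>
    obtain ⟨C, hC, hCA⟩ := hA j
    have hD : ∃ D : Circuit (N₁ ⊕ Fin n), D.cost ≤ b ∧
        A.callOper j inverse = onRegister e D.matrix := by
      cases inverse
      · exact ⟨C, hC, hCA⟩
      · refine ⟨C.inv, (Circuit.inv_cost C).trans_le hC, ?_⟩
        change (A.step j).1.conjTranspose = _
        rw [hCA, onRegister_eq, onRegister_eq, ← Circuit.oper_eq, ← Circuit.oper_eq,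
          Circuit.inv_oper]
        rfl
    obtain ⟨D, hDc, hDA⟩ := hD
    refine ⟨D.ctrl (withSpectators _ port) (Sum.inl c) (inl_notMem_withSpectators h), ?_, ?_⟩
    · rw [Circuit.ctrl_cost]
      simp only [Instr.cost]
      omega
    · rw [Instr.matrix_call, hDA, onRegister_eq, onRegister_eq, ← Circuit.oper_eq,
        ← Circuit.oper_eq, Circuit.ctrl_oper, absorb_sel, absorb_ext, absorb_one]
      nth_rewrite 1 [← renameReg_one (e.trans (Equiv.prodPUnit _).symm)]
      rfl

/-- In a program, the calls of an adversary with small circuits can be replaced by circuits. -/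
theorem exists_circuit_of_program (A : Adversary N₁ q) {n b : ℕ} (e : A.E ≃ BitString n)
    (hA : ∀ j : Fin q, ∃ C : Circuit (N₁ ⊕ Fin n), C.cost ≤ b ∧ (A.step j).1 = onRegister e C.matrix)
    (prog : Program N₁ W q) :
    ∃ C : Circuit (W ⊕ Fin n), C.cost ≤ prog.cost * (4 * b + 1) ∧
      prog.oper A = onRegister e C.matrix := by
  induction prog with
  | nil =>
    refine ⟨[], by simp [Circuit.cost], ?_⟩
    rw [onRegister_eq, Circuit.matrix_nil, tensorOne_one, absorb_one, renameReg_one]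
    rfl
  | cons i prog ih =>
    obtain ⟨C, hC, hCA⟩ := ih
    obtain ⟨D, hD, hDA⟩ := exists_circuit_of_instr A e hA i
    refine ⟨D ++ C, ?_, ?_⟩
    · have : Program.cost (i :: prog) = i.cost + Program.cost prog := by simp [Program.cost]
      rw [Circuit.append_cost, this, add_mul]
      exact add_le_add hD hC
    · rw [Program.oper_cons, hCA, hDA, onRegister_eq, onRegister_eq, onRegister_eq,
        ← Circuit.oper_eq, ← Circuit.oper_eq, ← Circuit.oper_eq, Circuit.append_oper, absorb_mul,
        renameReg_mul]

theorem onRegister_map_equiv {W' : Type} [Fintype W'] [DecidableEq W'] (φ : W ≃ W')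
    (C : Circuit W) (b b' : Bits W') :
    (C.map φ.toEmbedding).matrix b b' = C.matrix (b ∘ φ) (b' ∘ φ) := by
  classical
  have h : ∀ (W : Type) [Fintype W] [DecidableEq W] (C : Circuit W) (b b' : Bits W),
      C.matrix b b' = (C.oper : Oper W Unit) (b, ()) (b', ()) := by
    intro W _ _ C b b'
    rw [Circuit.oper_eq]
    exact (if_pos rfl).symm
  rw [h, h, Circuit.map_oper, ext_apply_of]
  · rfl
  · intro v hv
    exact absurd (φ.surjective v) hv

/-- The prover built from a program is efficient if the program and the adversary are. Its initial
state need not be, as initial states are arbitrary. -/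
theorem programAdversary_hasCircuits (A : Adversary N₁ q) (prog : Program N₁ (N₂ ⊕ V) q)
    (χ : Bits (N₂ ⊕ V) × A.E → ℂ) (hχ : normSq χ = 1) {b B : ℕ} (hA : A.HasCircuits b)
    (hB : Fintype.card V + b ≤ B) (hB' : prog.cost * (4 * b + 1) ≤ B) :
    (programAdversary A prog χ hχ).HasCircuits B := by
  obtain ⟨n, e, hn, hC⟩ := hA
  have hC' : ∀ j : Fin q, ∃ C : Circuit (N₁ ⊕ Fin n),
      C.cost ≤ b ∧ (A.step j).1 = onRegister e C.matrix := by
    intro j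
    obtain ⟨C, h1, h2⟩ := hC j
    exact ⟨C, h1, funext fun p => funext fun p' => h2 p p'⟩
  obtain ⟨D, hD, hDA⟩ := exists_circuit_of_program A e hC' prog
  let φ := Fintype.equivFin (V ⊕ Fin n)
  let f : Bits V × A.E ≃ BitString (Fintype.card (V ⊕ Fin n)) :=
    ((Equiv.prodCongr (Equiv.refl _) e).trans (Equiv.sumArrowEquivProdArrow _ _ _).symm).trans
      (Equiv.arrowCongr φ (Equiv.refl _))
  refine ⟨Fintype.card (V ⊕ Fin n), f, ?_, ?_⟩
  · rw [Fintype.card_sum, Fintype.card_fin]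
    exact (Nat.add_le_add_left hn _).trans hB
  · intro j
    by_cases hj : j = 0
    · subst hj
      refine ⟨[], by simp [Circuit.cost], fun p p' => ?_⟩
      have h1 : (((programAdversary A prog χ hχ).step 0).1 :
          Matrix (Bits N₂ × (programAdversary A prog χ hχ).E) _ ℂ) = 1 := rfl
      rw [h1, Circuit.matrix_nil, Matrix.one_apply, Matrix.one_apply]
      congr 1
      rw [eq_iff_iff]
      constructor
      · rintro rfl
        rfl
      · intro h
        refine Prod.ext (funext fun v => congrFun h (.inl v)) (f.injective ?_)
        exact funext fun v => congrFun h (.inr v)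
    · have hstep : ((programAdversary A prog χ hχ).step j).1 = absorb (prog.oper A) := by
        simp only [programAdversary, if_neg hj]
      refine ⟨D.map ((Equiv.sumAssoc N₂ V (Fin n)).trans
        (Equiv.sumCongr (Equiv.refl N₂) φ)).toEmbedding, ?_, fun p p' => ?_⟩
      · rw [Circuit.map_cost]
        exact hD.trans hB'
      · rw [hstep, onRegister_map_equiv]
        have h3 : ∀ r : Bits N₂ × (Bits V × A.E), (Sum.elim r.1 (f r.2)) ∘
            (Equiv.sumAssoc N₂ V (Fin n)).trans (Equiv.sumCongr (Equiv.refl N₂) φ)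
            = Sum.elim (assocEquiv N₂ V A.E r).1 (e (assocEquiv N₂ V A.E r).2) := by
          intro r
          funext v
          rcases v with ((v | v) | v)
          · rfl
          · simp [f, Equiv.arrowCongr, Equiv.sumArrowEquivProdArrow]
            rfl
          · simp [f, Equiv.arrowCongr, Equiv.sumArrowEquivProdArrow]
            rfl
        have h4 := congrFun (congrFun hDA (assocEquiv N₂ V A.E p)) (assocEquiv N₂ V A.E p')
        refine h4.trans ?_
        exact (congrArg₂ D.matrix (h3 p) (h3 p')).symm

end ProverCircuits

/-! ### Functions of a random function that depend on few of its values -/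

section Juntas

variable {V Y : Type}

/-- Functions of `H : V → Y` that are linear combinations of functions depending on at most `d`
values of `H`. -/
def juntas (V Y : Type) (d : ℕ) : Submodule ℂ ((V → Y) → ℂ) :=
  Submodule.span ℂ {Q | ∃ S : Finset V, S.card ≤ d ∧
    ∀ H H' : V → Y, (∀ v ∈ S, H v = H' v) → Q H = Q H'}

theorem const_mem_juntas (z : ℂ) (d : ℕ) : (fun _ => z) ∈ juntas V Y d :=
  Submodule.subset_span ⟨∅, by simp, fun _ _ _ => rfl⟩

theorem juntas_mono {d d' : ℕ} (h : d ≤ d') : juntas V Y d ≤ juntas V Y d' :=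
  Submodule.span_mono fun _ ⟨S, hS, hQ⟩ => ⟨S, hS.trans h, hQ⟩

theorem mul_mem_juntas {d d' : ℕ} {Q Q' : (V → Y) → ℂ} (hQ : Q ∈ juntas V Y d)
    (hQ' : Q' ∈ juntas V Y d') : (fun H => Q H * Q' H) ∈ juntas V Y (d + d') := by
  classical
  have h := Submodule.mul_mem_mul hQ hQ'
  rw [juntas, juntas, Submodule.span_mul_span] at h
  refine Submodule.span_mono ?_ h
  rintro _ ⟨R, ⟨S, hS, hR⟩, R', ⟨S', hS', hR'⟩, rfl⟩
  refine ⟨S ∪ S', (Finset.card_union_le _ _).trans (add_le_add hS hS'), fun H H' h => ?_⟩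
  exact congrArg₂ (· * ·) (hR H H' fun v hv => h v (Finset.mem_union_left _ hv))
    (hR' H H' fun v hv => h v (Finset.mem_union_right _ hv))

theorem conj_mem_juntas {d : ℕ} {Q : (V → Y) → ℂ} (hQ : Q ∈ juntas V Y d) :
    (fun H => star (Q H)) ∈ juntas V Y d := by
  induction hQ using Submodule.span_induction with
  | mem Q h =>
    obtain ⟨S, hS, hQ⟩ := h
    exact Submodule.subset_span ⟨S, hS, fun H H' h => congrArg star (hQ H H' h)⟩
  | zero =>
    simp only [Pi.zero_apply, star_zero]
    exact Submodule.zero_mem _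
  | add Q Q' _ _ h h' =>
    simp only [Pi.add_apply, star_add]
    exact Submodule.add_mem _ h h'
  | smul z Q _ h =>
    simp only [Pi.smul_apply, smul_eq_mul, star_mul']
    exact Submodule.smul_mem _ (star z) h

theorem normSq_mem_juntas {d : ℕ} {Q : (V → Y) → ℂ} (hQ : Q ∈ juntas V Y d) :
    (fun H => ((‖Q H‖ ^ 2 : ℝ) : ℂ)) ∈ juntas V Y (2 * d) := by
  have h := mul_mem_juntas (conj_mem_juntas hQ) hQ
  rw [← two_mul] at h
  convert h using 2 with H
  rw [Complex.star_def, Complex.conj_mul', Complex.ofReal_pow]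

theorem sum_mem_juntas {d : ℕ} {ι : Type*} (s : Finset ι) {Q : ι → (V → Y) → ℂ}
    (hQ : ∀ i ∈ s, Q i ∈ juntas V Y d) : (fun H => ∑ i ∈ s, Q i H) ∈ juntas V Y d := by
  have h := Submodule.sum_mem _ hQ
  convert h using 1
  funext H
  rw [Finset.sum_apply]

theorem eval_mem_juntas (v : V) (f : Y → ℂ) : (fun H => f (H v)) ∈ juntas V Y 1 :=
  Submodule.subset_span ⟨{v}, by simp, fun _ _ h => congrArg f (h v (Finset.mem_singleton_self v))⟩

end Juntas

/-! ### A `t`-wise independent family of functions -/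

section Independence

/-- A surjective homomorphism of finite groups maps uniform elements to uniform elements. -/
theorem sum_comp_surjective {G H : Type*} [AddCommGroup G] [AddCommGroup H] [Fintype G] [Fintype H]
    (φ : G →+ H) (hφ : Function.Surjective φ) (Q : H → ℂ) :
    (Fintype.card H : ℂ) * ∑ g, Q (φ g) = Fintype.card G * ∑ h, Q h := by
  obtain ⟨s, hs⟩ := hφ.hasRightInverse
  calc (Fintype.card H : ℂ) * ∑ g, Q (φ g)
      = ∑ _h : H, ∑ g, Q (φ g) := by simp
    _ = ∑ h : H, ∑ g, Q (φ g + h) := by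
        refine Finset.sum_congr rfl fun h _ => ?_
        rw [← Equiv.sum_comp (Equiv.addRight (s h))]
        simp [hs h]
    _ = ∑ g, ∑ h : H, Q (φ g + h) := Finset.sum_comm
    _ = ∑ _g : G, ∑ h, Q h := by
        refine Finset.sum_congr rfl fun g _ => ?_
        exact Equiv.sum_comp (Equiv.addLeft (φ g)) Q
    _ = Fintype.card G * ∑ h, Q h := by simp

variable {F : Type} [Field F]

/-- Horner's scheme for evaluation at `x` of the polynomial with coefficients `k`, after `s`
steps. -/
def horner (k : ℕ → F) (x : F) : ℕ → F
  | 0 => 0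
  | s + 1 => horner k x s * x + k s

theorem horner_eq (k : ℕ → F) (x : F) (s : ℕ) :
    horner k x s = ∑ i ∈ Finset.range s, k i * x ^ (s - 1 - i) := by
  induction s with
  | zero => rfl
  | succ s ih =>
    rw [horner, ih, Finset.sum_range_succ, Finset.sum_mul, Nat.add_sub_cancel, Nat.sub_self, pow_zero,
      mul_one]
    congr 1
    refine Finset.sum_congr rfl fun i hi => ?_
    rw [mul_assoc, ← pow_succ]
    congr 2
    have := Finset.mem_range.1 hi
    omega

/-- A finite sequence, continued by zeros. -/
def padZero {t : ℕ} (k : Fin t → F) (i : ℕ) : F := if h : i < t then k ⟨i, h⟩ else 0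

/-- The function of the family with key `k`: evaluation of a polynomial of degree less than `t`. -/
def polyHash {t : ℕ} (k : Fin t → F) (x : F) : F := horner (padZero k) x t

variable {V Y : Type} [Fintype V] [DecidableEq V]

/-- The values at the points of `S`, as a function of the key. -/
def polyHashHom (t : ℕ) (emb : V → F) (S : Finset V) : (Fin t → F) →+ (S → F) where
  toFun k v := polyHash k (emb v)
  map_zero' := by
    funext v
    simp [polyHash, horner_eq, padZero]
  map_add' k k' := by
    funext v
    simp only [polyHash, horner_eq, Pi.add_apply, ← Finset.sum_add_distrib, ← add_mul]
    refine Finset.sum_congr rfl fun i _ => ?_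
    congr 1
    unfold padZero
    split_ifs <;> simp

/-- Interpolation: a polynomial of degree less than `t` takes prescribed values at `t` points. -/
theorem polyHashHom_surjective {t : ℕ} {emb : V → F} (hemb : Function.Injective emb) {S : Finset V}
    (hS : S.card ≤ t) : Function.Surjective (polyHashHom t emb S) := by
  intro y
  let p := Lagrange.interpolate S emb fun v => if h : v ∈ S then y ⟨v, h⟩ else 0
  have hdeg : p.degree < t := lt_of_lt_of_le (Lagrange.degree_interpolate_lt _ hemb.injOn)
    (by exact_mod_cast hS)
  refine ⟨fun i => p.coeff (t - 1 - i), funext fun v => ?_⟩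
  have hv : p.eval (emb v) = y v := by
    rw [Lagrange.eval_interpolate_at_node _ hemb.injOn v.2]
    simp
  change polyHash _ (emb v) = y v
  rw [polyHash, horner_eq, ← hv]
  have h1 : ∀ i ∈ Finset.range t, padZero (fun i : Fin t => p.coeff (t - 1 - i)) i
      * emb v ^ (t - 1 - i) = p.coeff (t - 1 - i) * emb v ^ (t - 1 - i) := by
    intro i hi
    rw [padZero, dif_pos (Finset.mem_range.1 hi)]
  rw [Finset.sum_congr rfl h1, Finset.sum_range_reflect (fun i => p.coeff i * emb v ^ i) t]
  by_cases ht : t = 0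
  · subst ht
    have : p = 0 := by
      rw [← Polynomial.degree_eq_bot]
      simpa using hdeg
    simp [this]
  · rw [Polynomial.eval_eq_sum_range' (n := t)]
    by_cases hp : p = 0
    · rw [hp, Polynomial.natDegree_zero]
      exact Nat.pos_of_ne_zero ht
    · exact (Polynomial.natDegree_lt_iff_degree_lt hp).2 hdeg

/-- Restriction of functions to `S`. -/
def restrictHom (F : Type) [Field F] (S : Finset V) : (V → F) →+ (S → F) where
  toFun r v := r v
  map_zero' := rfl
  map_add' _ _ := rfl

theorem restrictHom_surjective (S : Finset V) : Function.Surjective (restrictHom F S) := by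
  intro y
  refine ⟨fun v => if h : v ∈ S then y ⟨v, h⟩ else 0, funext fun v => ?_⟩
  simp [restrictHom]

/-- The family `polyHash` cannot be distinguished from a random function by means of at most `t`
values. -/
theorem sum_polyHash [Fintype F] {t : ℕ} {emb : V → F} (hemb : Function.Injective emb) (G : F → Y)
    {Q : (V → Y) → ℂ} (hQ : Q ∈ juntas V Y t) :
    (Fintype.card (V → F) : ℂ) * ∑ k : Fin t → F, Q (fun v => G (polyHash k (emb v)))
      = Fintype.card (Fin t → F) * ∑ r : V → F, Q (fun v => G (r v)) := by
  induction hQ using Submodule.span_induction with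
  | mem Q h =>
    obtain ⟨S, hS, hQ⟩ := h
    by_cases hne : IsEmpty (V → Y)
    · have h1 : IsEmpty (V → F) := ⟨fun r => hne.elim fun v => G (r v)⟩
      have h2 : IsEmpty (Fin t → F) := ⟨fun k => hne.elim fun v => G (polyHash k (emb v))⟩
      simp
    · obtain ⟨H₀⟩ := not_isEmpty_iff.1 hne
      let Q' : (S → F) → ℂ := fun y => Q fun v => if h : v ∈ S then G (y ⟨v, h⟩) else H₀ v
      have h1 : ∀ k : Fin t → F, Q (fun v => G (polyHash k (emb v))) = Q' (polyHashHom t emb S k) := by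
        intro k
        refine hQ _ _ fun v hv => ?_
        simp [hv, polyHashHom]
      have h2 : ∀ r : V → F, Q (fun v => G (r v)) = Q' (restrictHom F S r) := by
        intro r
        refine hQ _ _ fun v hv => ?_
        simp [hv, restrictHom]
      simp only [h1, h2]
      have e1 := sum_comp_surjective (polyHashHom t emb S) (polyHashHom_surjective hemb hS) Q'
      have e2 := sum_comp_surjective (restrictHom F S) (restrictHom_surjective S) Q'
      have h0 : (Fintype.card (S → F) : ℂ) ≠ 0 := by
        exact_mod_cast Fintype.card_ne_zero
      refine mul_left_cancel₀ h0 ?_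
      calc (Fintype.card (S → F) : ℂ) * (Fintype.card (V → F) * ∑ k, Q' (polyHashHom t emb S k))
          = Fintype.card (V → F) * (Fintype.card (S → F) * ∑ k, Q' (polyHashHom t emb S k)) := by ring
        _ = Fintype.card (Fin t → F) * (Fintype.card (V → F) * ∑ h, Q' h) := by rw [e1]; ring
        _ = _ := by rw [← e2]; ring
  | zero => simp
  | add Q Q' _ _ h h' => simp only [Pi.add_apply, Finset.sum_add_distrib, mul_add, h, h']
  | smul z Q _ h =>
    simp only [Pi.smul_apply, smul_eq_mul, ← Finset.mul_sum]
    linear_combination z * h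

end Independence

/-! ### Nearly uniform values -/

section NearlyUniform

variable {V Y F : Type} [Fintype V] [DecidableEq V] [Fintype Y] [DecidableEq Y] [Fintype F]
  [DecidableEq F]

/-- If `G` maps a uniform element of `F` to each element of `Y` with probability at least
`(1 - δ) / |Y|`, then it maps a random function to each function with at least half of the uniform
probability, if `δ * |V| ≤ 1 / 2`: the failures at the `|V|` points add up. -/
theorem half_sum_le_sum (G : F → Y) (δ : ℝ) (hδ : δ * Fintype.card V ≤ 1 / 2) (hδ0 : δ ≤ 1)
    (hG : ∀ y, (1 - δ) * Fintype.card F ≤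
      Fintype.card Y * ((Finset.univ.filter fun z => G z = y).card : ℝ))
    (Q : (V → Y) → ℝ) (hQ : ∀ H, 0 ≤ Q H) :
    1 / 2 * (Fintype.card (V → F) : ℝ) * ∑ H, Q H
      ≤ Fintype.card (V → Y) * ∑ r : V → F, Q (fun v => G (r v)) := by
  have hfib : ∀ H : V → Y, ((Finset.univ.filter fun r : V → F => (fun v => G (r v)) = H).card : ℝ)
      = ∏ v, ((Finset.univ.filter fun z => G z = H v).card : ℝ) := by
    intro H
    rw [← Nat.cast_prod, ← Fintype.card_piFinset]
    congr 2
    ext r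
    simp [Fintype.mem_piFinset, funext_iff]
  have hsum : ∑ r : V → F, Q (fun v => G (r v))
      = ∑ H, (∏ v, ((Finset.univ.filter fun z => G z = H v).card : ℝ)) * Q H := by
    rw [← Finset.sum_fiberwise_of_maps_to (g := fun r : V → F => fun v => G (r v))
      (t := Finset.univ) fun _ _ => Finset.mem_univ _]
    refine Finset.sum_congr rfl fun H _ => ?_
    rw [← hfib, Finset.sum_congr rfl fun r hr => by rw [(Finset.mem_filter.1 hr).2],
      Finset.sum_const, nsmul_eq_mul]
  rw [hsum, Finset.mul_sum, Finset.mul_sum]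
  refine Finset.sum_le_sum fun H _ => ?_
  rw [← mul_assoc]
  refine mul_le_mul_of_nonneg_right ?_ (hQ H)
  have h1 : (Fintype.card (V → Y) : ℝ) * ∏ v, ((Finset.univ.filter fun z => G z = H v).card : ℝ)
      = ∏ v, (Fintype.card Y * ((Finset.univ.filter fun z => G z = H v).card : ℝ)) := by
    rw [Finset.prod_mul_distrib]
    simp
  have h2 : ∏ _v : V, ((1 - δ) * Fintype.card F) ≤ ∏ v, (Fintype.card Y *
      ((Finset.univ.filter fun z => G z = H v).card : ℝ)) :=
    Finset.prod_le_prod (fun _ _ => mul_nonneg (by linarith) (Nat.cast_nonneg _))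
      fun v _ => hG (H v)
  rw [h1]
  refine le_trans ?_ h2
  rw [Finset.prod_const, mul_pow, Finset.card_univ]
  -- Bernoulli's inequality
  have h3 : (1 : ℝ) / 2 ≤ (1 - δ) ^ Fintype.card V := by
    have := one_add_mul_le_pow (a := -δ) (by linarith) (Fintype.card V)
    rw [← sub_eq_add_neg] at this
    linarith
  have h4 : (Fintype.card (V → F) : ℝ) = (Fintype.card F : ℝ) ^ Fintype.card V := by simp
  rw [h4]
  exact mul_le_mul_of_nonneg_right h3 (by positivity)

end NearlyUniform

/-! ### Reversible classical circuits -/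

section Reversible

variable {W E : Type} [Fintype W] [DecidableEq W] [Fintype E] [DecidableEq E]

/-- Concatenation of the first `s` of `t` lists. -/
def upTo {α : Type*} {t : ℕ} (step : Fin t → List α) : (s : ℕ) → s ≤ t → List α
  | 0, _ => []
  | s + 1, h => upTo step s (Nat.le_of_succ_le h) ++ step ⟨s, h⟩

theorem mem_upTo {α : Type*} {t : ℕ} {step : Fin t → List α} {s : ℕ} {h : s ≤ t} {x : α}
    (hx : x ∈ upTo step s h) : ∃ i, x ∈ step i := by
  induction s with
  | zero => simp [upTo] at hx
  | succ s ih =>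
    rcases List.mem_append.1 hx with hx | hx
    · exact ih hx
    · exact ⟨_, hx⟩

theorem sum_map_upTo_le {α : Type*} {t : ℕ} (step : Fin t → List α) (f : α → ℕ) (B : ℕ)
    (hB : ∀ i, ((step i).map f).sum ≤ B) (s : ℕ) (h : s ≤ t) :
    ((upTo step s h).map f).sum ≤ s * B := by
  induction s with
  | zero => simp [upTo]
  | succ s ih =>
    rw [upTo, List.map_append, List.sum_append, add_mul, one_mul]
    exact add_le_add (ih _) (hB _)

/-- The permutation of basis states performed by a list of toggles. -/
def runToggles (l : List (Toggle W)) (b : Bits W) : Bits W := l.foldl (fun b t => t.flip b) b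

theorem runToggles_append (l l' : List (Toggle W)) (b : Bits W) :
    runToggles (l ++ l') b = runToggles l' (runToggles l b) := List.foldl_append

/-- The circuit that performs a list of toggles. -/
def toggleCircuit (l : List (Toggle W)) : Circuit W := List.map Toggle.gate l

theorem maps_toggleCircuit (l : List (Toggle W)) (b : Bits W) :
    Maps ((toggleCircuit l).oper : Oper W E) b (runToggles l b) := by
  induction l generalizing b with
  | nil => exact Maps.one b
  | cons t l ih =>
    have : ((toggleCircuit (t :: l)).oper : Oper W E) = (toggleCircuit l).oper * t.gate.oper := by
      simp [toggleCircuit, Circuit.oper]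
    rw [this]
    exact (ih (t.flip b)).mul (t.maps_gate b)

theorem toggleCircuit_cost_le (l : List (Toggle W)) (k : ℕ) (h : ∀ t ∈ l, t.supp.card ≤ k) :
    (toggleCircuit l).cost ≤ l.length * 4 ^ (k + 1) := by
  have : (toggleCircuit l).cost = (l.map fun t => t.gate.cost).sum := by
    rw [Circuit.cost, toggleCircuit, List.map_map]
    rfl
  rw [this, ← smul_eq_mul]
  refine (List.sum_le_card_nsmul _ (4 ^ (k + 1)) ?_).trans (by rw [List.length_map])
  intro x hx
  obtain ⟨t, ht, rfl⟩ := List.mem_map.1 hx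
  exact t.gate_cost.trans (Nat.pow_le_pow_right (by norm_num) (Nat.succ_le_succ (h t ht)))

/-- A bit, as an element of the field with two elements. -/
def toZ (b : Bool) : ZMod 2 := if b = true then 1 else 0

theorem toZ_xor (a b : Bool) : toZ (xor a b) = toZ a + toZ b := by
  cases a <;> cases b <;> decide

theorem toZ_and (a b : Bool) : toZ (a && b) = toZ a * toZ b := by
  cases a <;> cases b <;> decide

theorem toZ_injective : Function.Injective toZ := by decide

theorem toZ_decide (z : ZMod 2) : toZ (decide (z = 1)) = z := by
  revert z
  decide

/-- Toggles whose targets are not among their inputs can be performed in any order: each target is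
flipped according to the sum of the functions. -/
theorem toZ_runToggles (T : Set W) (l : List (Toggle W))
    (hl : ∀ t ∈ l, t.tgt ∈ T ∧ ∀ v ∈ t.supp, v ∉ T) (b : Bits W) (v : W) :
    toZ (runToggles l b v)
      = toZ (b v) + (l.map fun t => if t.tgt = v then toZ (t.fn b) else 0).sum := by
  induction l generalizing b with
  | nil => simp [runToggles]
  | cons t l ih =>
    have hl' : ∀ t ∈ l, t.tgt ∈ T ∧ ∀ v ∈ t.supp, v ∉ T :=
      fun t ht => hl t (List.mem_cons_of_mem _ ht)
    have hfn : ∀ t' ∈ l, t'.fn (t.flip b) = t'.fn b := by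
      intro t' ht'
      refine t'.fn_congr _ _ fun w hw => t.flip_of_ne b ?_
      rintro rfl
      exact (hl' t' ht').2 _ hw (hl t List.mem_cons_self).1
    have h1 : runToggles (t :: l) b = runToggles l (t.flip b) := rfl
    rw [h1, ih hl', List.map_cons, List.sum_cons, ← add_assoc]
    congr 1
    · by_cases hv : t.tgt = v
      · rw [if_pos hv, ← hv, t.flip_tgt, toZ_xor]
      · rw [if_neg hv, t.flip_of_ne b (Ne.symm hv), add_zero]
    · congr 1
      refine List.map_congr_left fun t' ht' => ?_
      rw [hfn t' ht']

theorem runToggles_of_notMem (T : Set W) (l : List (Toggle W)) (hl : ∀ t ∈ l, t.tgt ∈ T)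
    (b : Bits W) {v : W} (hv : v ∉ T) : runToggles l b v = b v := by
  induction l generalizing b with
  | nil => rfl
  | cons t l ih =>
    have h1 : runToggles (t :: l) b = runToggles l (t.flip b) := rfl
    rw [h1, ih (fun t ht => hl t (List.mem_cons_of_mem _ ht)), t.flip_of_ne]
    rintro rfl
    exact hv (hl t List.mem_cons_self)

end Reversible

/-! ### A circuit for the hash function -/

section HashCircuit

/-- A circuit that samples from the finite set `chal`, from uniformly random bits. -/
structure Sampler (m : ℕ) (chal : Finset (BitString m)) where
  bits : ℕ
  anc : ℕ
  fn : BitString bits → BitString m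
  circuit : Circuit (Fin bits ⊕ Fin m ⊕ Fin anc)
  fn_mem : ∀ r, fn r ∈ chal
  maps : ∀ (E : Type) [Fintype E] [DecidableEq E] (r : BitString bits),
    Maps (circuit.oper : Oper _ E) (Sum.elim r (Sum.elim (zeros _) (zeros _)))
      (Sum.elim r (Sum.elim (fn r) (zeros _)))

variable {n t m : ℕ} {chal : Finset (BitString m)} {Q : Type} [Fintype Q] [DecidableEq Q]
  {F : Type} [Field F] [Algebra (ZMod 2) F]

/-- The wires of the ancillas of the hash circuit: the intermediate results of Horner's scheme, the
hash value, and the ancillas of the sampler. -/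
abbrev HashAnc (n t m a : ℕ) : Type := (Fin (t + 1) × Fin n) ⊕ Fin m ⊕ Fin a

/-- The wires of the hash circuit: input, key, and ancillas. -/
abbrev HashWires (Q : Type) (n t m a : ℕ) : Type := Q ⊕ (Fin t × Fin n) ⊕ HashAnc n t m a

/-- The field element with given coordinates. -/
def elt (β : Module.Basis (Fin n) (ZMod 2) F) (c : BitString n) : F := ∑ i, toZ (c i) • β i

theorem repr_elt (β : Module.Basis (Fin n) (ZMod 2) F) (c : BitString n) (i : Fin n) :
    β.repr (elt β c) i = toZ (c i) := by
  rw [elt, β.repr_sum_self]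

/-- The field element that encodes an input of the hash function. -/
def encode (β : Module.Basis (Fin n) (ZMod 2) F) (γ : Q ↪ Fin n) (v : Bits Q) : F :=
  ∑ j, toZ (v j) • β (γ j)

theorem encode_injective (β : Module.Basis (Fin n) (ZMod 2) F) (γ : Q ↪ Fin n) :
    Function.Injective (encode β γ) := by
  intro v v' h
  have hli := β.linearIndependent.comp γ γ.injective
  have := Fintype.linearIndependent_iff.1 hli (fun j => toZ (v j) - toZ (v' j)) (by
    simp only [sub_smul, Finset.sum_sub_distrib, Function.comp_apply]
    exact sub_eq_zero.2 h)
  exact funext fun j => toZ_injective (sub_eq_zero.1 (this j))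

/-- Bit strings as field elements. -/
def eltEquiv (β : Module.Basis (Fin n) (ZMod 2) F) : BitString n ≃ F where
  toFun := elt β
  invFun x i := decide (β.repr x i = 1)
  left_inv c := by
    funext i
    apply toZ_injective
    rw [toZ_decide, repr_elt]
  right_inv x := by
    refine β.repr.injective (Finsupp.ext fun i => ?_)
    rw [repr_elt, toZ_decide]

variable (β : Module.Basis (Fin n) (ZMod 2) F) (γ : Q ↪ Fin n)

/-- Addition of a coefficient, in Horner's scheme. -/
def keyToggle (Q : Type) [DecidableEq Q] (m a : ℕ) (s : Fin t) (k : Fin n) :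
    Toggle (HashWires Q n t m a) where
  supp := {.inr (.inl (s, k))}
  tgt := .inr (.inr (.inl (s.succ, k)))
  fn b := b (.inr (.inl (s, k)))
  tgt_notMem := by simp
  fn_congr b b' h := h _ (Finset.mem_singleton_self _)

/-- Multiplication by the input, in Horner's scheme. -/
def mulToggle (m a : ℕ) (s : Fin t) (p : Fin n × Fin n × Q) : Toggle (HashWires Q n t m a) where
  supp := {.inr (.inr (.inl (s.castSucc, p.2.1))), .inl p.2.2}
  tgt := .inr (.inr (.inl (s.succ, p.1)))
  fn b := decide (β.repr (β p.2.1 * β (γ p.2.2)) p.1 = 1) &&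
    (b (.inr (.inr (.inl (s.castSucc, p.2.1)))) && b (.inl p.2.2))
  tgt_notMem := by
    simp only [Finset.mem_insert, Finset.mem_singleton, Sum.inr.injEq, Sum.inl.injEq, Prod.mk.injEq,
      reduceCtorEq, or_false, not_and]
    intro h
    exact absurd h (Fin.castSucc_lt_succ).ne'
  fn_congr b b' h := by
    rw [h _ (Finset.mem_insert_self _ _),
      h _ (Finset.mem_insert_of_mem (Finset.mem_singleton_self _))]

/-- One step of Horner's scheme. -/
def hornerStep (m a : ℕ) (s : Fin t) : List (Toggle (HashWires Q n t m a)) :=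
  (Finset.univ : Finset (Fin n)).toList.map (keyToggle Q m a s) ++
    (Finset.univ : Finset (Fin n × Fin n × Q)).toList.map (mulToggle β γ m a s)

/-- The coefficients encoded by the key. -/
def keyElts (κ : Bits (Fin t × Fin n)) (s : Fin t) : F := elt β fun k => κ (s, k)

theorem tgt_of_mem_hornerStep {a : ℕ} {s : Fin t} {τ : Toggle (HashWires Q n t m a)}
    (h : τ ∈ hornerStep β γ m a s) :
    τ.tgt ∈ Set.range (fun k : Fin n => (.inr (.inr (.inl (s.succ, k))) : HashWires Q n t m a)) ∧
      (∀ v ∈ τ.supp, v ∉ Set.range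
        (fun k : Fin n => (.inr (.inr (.inl (s.succ, k))) : HashWires Q n t m a))) ∧
      τ.supp.card ≤ 2 := by
  rcases List.mem_append.1 h with h | h
  · obtain ⟨k, -, rfl⟩ := List.mem_map.1 h
    refine ⟨⟨k, rfl⟩, ?_, by simp [keyToggle]⟩
    rintro v hv ⟨k', rfl⟩
    simp [keyToggle] at hv
  · obtain ⟨p, -, rfl⟩ := List.mem_map.1 h
    refine ⟨⟨p.1, rfl⟩, ?_, Finset.card_le_two⟩
    rintro v hv ⟨k', rfl⟩
    simp only [mulToggle, Finset.mem_insert, Finset.mem_singleton, Sum.inr.injEq, Sum.inl.injEq,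
      Prod.mk.injEq, reduceCtorEq, or_false] at hv
    exact absurd hv.1 (Fin.castSucc_lt_succ).ne'

theorem toZ_hornerStep {a : ℕ} (s : Fin t) (b : Bits (HashWires Q n t m a)) (k : Fin n)
    (hb : b (.inr (.inr (.inl (s.succ, k)))) = false) :
    toZ (runToggles (hornerStep β γ m a s) b (.inr (.inr (.inl (s.succ, k)))))
      = β.repr (elt β (fun i => b (.inr (.inr (.inl (s.castSucc, i)))))
          * encode β γ (fun j => b (.inl j))
          + elt β (fun i => b (.inr (.inl (s, i))))) k := by
  have hmul : β.repr (elt β (fun i => b (.inr (.inr (.inl (s.castSucc, i)))))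
        * encode β γ (fun j => b (.inl j))) k
      = ∑ i, ∑ j, β.repr (β i * β (γ j)) k *
        (toZ (b (.inr (.inr (.inl (s.castSucc, i))))) * toZ (b (.inl j))) := by
    rw [elt, encode, Finset.sum_mul_sum, map_sum, Finsupp.finsetSum_apply]
    refine Finset.sum_congr rfl fun i _ => ?_
    rw [map_sum, Finsupp.finsetSum_apply]
    refine Finset.sum_congr rfl fun j _ => ?_
    rw [smul_mul_smul_comm, map_smul, Finsupp.smul_apply, smul_eq_mul, mul_comm]
  rw [toZ_runToggles _ _ (fun τ hτ => ⟨(tgt_of_mem_hornerStep β γ hτ).1,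
    (tgt_of_mem_hornerStep β γ hτ).2.1⟩), hb, map_add, Finsupp.add_apply, repr_elt, hmul]
  rw [hornerStep, List.map_append, List.sum_append, List.map_map, List.map_map,
    Finset.sum_map_toList, Finset.sum_map_toList]
  have e1 : ∑ k', ((fun τ : Toggle (HashWires Q n t m a) =>
      if τ.tgt = .inr (.inr (.inl (s.succ, k))) then toZ (τ.fn b) else 0) ∘ keyToggle Q m a s) k'
      = toZ (b (.inr (.inl (s, k)))) := by
    rw [Finset.sum_eq_single k]
    · simp [keyToggle]
    · intro k' _ hk'
      simp [keyToggle, hk']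
    · simp
  have e2 : ∑ p, ((fun τ : Toggle (HashWires Q n t m a) =>
      if τ.tgt = .inr (.inr (.inl (s.succ, k))) then toZ (τ.fn b) else 0) ∘ mulToggle β γ m a s) p
      = ∑ i, ∑ j, β.repr (β i * β (γ j)) k *
        (toZ (b (.inr (.inr (.inl (s.castSucc, i))))) * toZ (b (.inl j))) := by
    rw [Fintype.sum_prod_type, Finset.sum_eq_single k]
    · rw [Fintype.sum_prod_type]
      refine Finset.sum_congr rfl fun i _ => Finset.sum_congr rfl fun j _ => ?_
      simp only [Function.comp_apply, mulToggle, if_true, toZ_and, toZ_decide]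
    · intro k' _ hk'
      refine Finset.sum_eq_zero fun p _ => ?_
      simp [mulToggle, hk']
    · simp
  rw [e1, e2]
  simp [toZ, add_comm]

/-- After `s` steps, the wires of the `s`-th intermediate result hold the value of Horner's scheme.
-/
theorem runToggles_horner {a : ℕ} (b : Bits (HashWires Q n t m a))
    (hb : ∀ v, b (.inr (.inr (.inl v))) = false) (s : ℕ) (hs : s ≤ t) :
    (∀ v, (∀ i k, i.1 ≤ s → v ≠ .inr (.inr (.inl (i, k)))) →
        runToggles (upTo (hornerStep β γ m a) s hs) b v = b v) ∧
      ∀ k, toZ (runToggles (upTo (hornerStep β γ m a) s hs) b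
          (.inr (.inr (.inl (⟨s, Nat.lt_succ_of_le hs⟩, k)))))
        = β.repr (horner (padZero (keyElts β fun i => b (.inr (.inl i))))
            (encode β γ fun j => b (.inl j)) s) k := by
  induction s with
  | zero =>
    refine ⟨fun _ _ => rfl, fun k => ?_⟩
    change toZ (b _) = _
    rw [hb, horner, map_zero]
    rfl
  | succ s ih =>
    obtain ⟨ih1, ih2⟩ := ih (Nat.le_of_succ_le hs)
    rw [upTo, runToggles_append]
    set b' := runToggles (upTo (hornerStep β γ m a) s (Nat.le_of_succ_le hs)) b with hb'
    refine ⟨fun v hv => ?_, fun k => ?_⟩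
    · rw [runToggles_of_notMem _ _ (fun τ hτ => (tgt_of_mem_hornerStep β γ hτ).1), ih1]
      · exact fun i k hi => hv i k (hi.trans (Nat.le_succ s))
      · rintro ⟨k, rfl⟩
        exact hv _ k le_rfl rfl
    · have h1 := toZ_hornerStep β γ (⟨s, hs⟩ : Fin t) b' k (by
        rw [ih1, hb]
        rintro i k hi h
        have : i = (⟨s, hs⟩ : Fin t).succ := by
          simpa using congrArg (fun v : HashWires Q n t m a => match v with
            | .inr (.inr (.inl p)) => p.1
            | _ => 0) h.symm
        rw [this] at hi
        simp at hi)
      refine h1.trans ?_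
      have e1 : elt β (fun i => b' (.inr (.inr (.inl ((⟨s, hs⟩ : Fin t).castSucc, i)))))
          = horner (padZero (keyElts β fun i => b (.inr (.inl i))))
            (encode β γ fun j => b (.inl j)) s := by
        refine β.repr.injective (Finsupp.ext fun i => ?_)
        rw [repr_elt]
        exact ih2 i
      have e2 : (fun j => b' (.inl j)) = fun j => b (.inl j) :=
        funext fun j => ih1 _ (by simp)
      have e3 : (fun i => b' (.inr (.inl ((⟨s, hs⟩ : Fin t), i))))
          = fun i => b (.inr (.inl ((⟨s, hs⟩ : Fin t), i))) := funext fun i => ih1 _ (by simp)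
      rw [e1, e2, e3, horner, padZero, dif_pos (show s < t from hs)]
      rfl

variable (S : Sampler m chal) (hS : S.bits ≤ n)

/-- The wires of the sampler among those of the hash circuit. -/
def samplerWires (Q : Type) (t : ℕ) (S : Sampler m chal) (hS : S.bits ≤ n) :
    Fin S.bits ⊕ Fin m ⊕ Fin S.anc ↪ HashWires Q n t m S.anc where
  toFun
    | .inl i => .inr (.inr (.inl (Fin.last t, Fin.castLE hS i)))
    | .inr v => .inr (.inr (.inr v))
  inj' v v' h := by
    rcases v with v | v <;> rcases v' with v' | v'
    · simpa using h
    · simp at h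
    · simp at h
    · simpa using h

/-- The circuit that computes the hash function: Horner's scheme, followed by the sampler. -/
def hashCircuit : Circuit (HashWires Q n t m S.anc) :=
  toggleCircuit (upTo (hornerStep β γ m S.anc) t le_rfl) ++ S.circuit.map (samplerWires Q t S hS)

/-- The hash value obtained from a field element. -/
def sampleElt (x : F) : BitString m := S.fn fun i => (eltEquiv β).symm x (Fin.castLE hS i)

/-- The hash function with a given key. -/
def hashFn (κ : Bits (Fin t × Fin n)) (v : Bits Q) : BitString m :=
  sampleElt β S hS (polyHash (keyElts β κ) (encode β γ v))

theorem maps_hashCircuit {E : Type} [Fintype E] [DecidableEq E]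
    (b : Bits (HashWires Q n t m S.anc)) (hb : ∀ v, b (.inr (.inr v)) = false) :
    ∃ b' : Bits (HashWires Q n t m S.anc), Maps ((hashCircuit β γ S hS).oper : Oper _ E) b b' ∧
      (∀ v, b' (.inl v) = b (.inl v)) ∧ (∀ v, b' (.inr (.inl v)) = b (.inr (.inl v))) ∧
      ∀ i, b' (.inr (.inr (.inr (.inl i))))
        = hashFn β γ S hS (fun v => b (.inr (.inl v))) (fun v => b (.inl v)) i := by
  obtain ⟨h1, h2⟩ := runToggles_horner (m := m) (a := S.anc) β γ b (fun v => hb _) t le_rfl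
  set b₁ := runToggles (upTo (hornerStep β γ m S.anc) t le_rfl) b with hb₁
  set r : BitString S.bits := fun i => b₁ (.inr (.inr (.inl (Fin.last t, Fin.castLE hS i)))) with hr
  have hin : b₁ ∘ samplerWires Q t S hS = Sum.elim r (Sum.elim (zeros _) (zeros _)) := by
    funext v
    rcases v with v | v
    · rfl
    · have : b₁ (.inr (.inr (.inr v))) = false := (h1 _ (by simp)).trans (hb _)
      refine this.trans ?_
      cases v <;> rfl
  have hrv : S.fn r = hashFn β γ S hS (fun v => b (.inr (.inl v))) (fun v => b (.inl v)) := by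
    unfold hashFn sampleElt
    congr 1
    funext i
    apply toZ_injective
    have := h2 (Fin.castLE hS i)
    refine this.trans ?_
    exact (toZ_decide _).symm
  have hmaps := S.maps E r
  rw [← hin] at hmaps
  refine ⟨Function.extend (samplerWires Q t S hS) (Sum.elim r (Sum.elim (S.fn r) (zeros _))) b₁,
    ?_, ?_, ?_, ?_⟩
  · rw [hashCircuit, Circuit.append_oper, Circuit.map_oper]
    exact (Maps.lift hmaps).mul (maps_toggleCircuit _ b)
  · intro v
    rw [extend_off]
    · exact h1 _ (by simp)
    · rintro ⟨w | w, hw⟩ <;> simp [samplerWires] at hw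
  · intro v
    rw [extend_off]
    · exact h1 _ (by simp)
    · rintro ⟨w | w, hw⟩ <;> exact absurd (Sum.inr.inj hw) Sum.inr_ne_inl
  · intro i
    have : (.inr (.inr (.inr (.inl i))) : HashWires Q n t m S.anc)
        = samplerWires Q t S hS (.inr (.inl i)) := rfl
    rw [this, (samplerWires Q t S hS).injective.extend_apply, ← hrv]
    rfl

theorem hashCircuit_cost :
    (hashCircuit (t := t) β γ S hS).cost ≤ t * (n + n * (n * Fintype.card Q)) * 64 + S.circuit.cost := by
  rw [hashCircuit, Circuit.append_cost, Circuit.map_cost]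
  refine Nat.add_le_add_right ?_ _
  refine (toggleCircuit_cost_le _ 2 ?_).trans (Nat.mul_le_mul ?_ (by norm_num))
  · intro τ hτ
    obtain ⟨s, hs⟩ := mem_upTo hτ
    exact (tgt_of_mem_hornerStep β γ hs).2.2
  · have := sum_map_upTo_le (hornerStep β γ m S.anc) (fun _ => 1) (n + n * (n * Fintype.card Q))
      (fun s => by simp [hornerStep]) t le_rfl
    simpa using this

end HashCircuit

/-! ### A circuit for the comparison of two strings -/

section EqualityCircuit

variable {Q : Type} [Fintype Q] [DecidableEq Q]

/-- The wires of the comparison circuit: two strings and ancillas, the last of which receives the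
result. -/
abbrev EqWires (Q : Type) [Fintype Q] : Type := Q ⊕ Q ⊕ Fin (Fintype.card Q + 1)

/-- The initial value of the comparison: nothing differs so far. -/
def eqInit (Q : Type) [Fintype Q] [DecidableEq Q] : Toggle (EqWires Q) where
  supp := ∅
  tgt := .inr (.inr 0)
  fn _ := true
  tgt_notMem := by simp
  fn_congr _ _ _ := rfl

/-- Comparison of one bit. -/
def eqToggle (s : Fin (Fintype.card Q)) : Toggle (EqWires Q) where
  supp := {.inl ((Fintype.equivFin Q).symm s), .inr (.inl ((Fintype.equivFin Q).symm s)),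
    .inr (.inr s.castSucc)}
  tgt := .inr (.inr s.succ)
  fn b := b (.inr (.inr s.castSucc)) && decide (b (.inl ((Fintype.equivFin Q).symm s)) =
    b (.inr (.inl ((Fintype.equivFin Q).symm s))))
  tgt_notMem := by
    simp only [Finset.mem_insert, Finset.mem_singleton, Sum.inr.injEq, reduceCtorEq, false_or]
    exact (Fin.castSucc_lt_succ).ne'
  fn_congr b b' h := by
    rw [h (.inl ((Fintype.equivFin Q).symm s)) (by simp),
      h (.inr (.inl ((Fintype.equivFin Q).symm s))) (by simp), h (.inr (.inr s.castSucc)) (by simp)]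

/-- The comparison circuit, as a list of toggles. -/
def eqToggles (Q : Type) [Fintype Q] [DecidableEq Q] : List (Toggle (EqWires Q)) :=
  eqInit Q :: upTo (fun s => [eqToggle s]) (Fintype.card Q) le_rfl

theorem runToggles_eq (b : Bits (EqWires Q)) (hb : ∀ v, b (.inr (.inr v)) = false) (s : ℕ)
    (hs : s ≤ Fintype.card Q) :
    (∀ v, (∀ i, i.1 ≤ s → v ≠ .inr (.inr i)) →
        runToggles (eqInit Q :: upTo (fun s => [eqToggle s]) s hs) b v = b v) ∧
      runToggles (eqInit Q :: upTo (fun s => [eqToggle s]) s hs) b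
          (.inr (.inr ⟨s, Nat.lt_succ_of_le hs⟩))
        = decide (∀ i : Fin (Fintype.card Q), i.1 < s → b (.inl ((Fintype.equivFin Q).symm i))
            = b (.inr (.inl ((Fintype.equivFin Q).symm i)))) := by
  induction s with
  | zero =>
    refine ⟨fun v hv => ?_, ?_⟩
    · exact (eqInit Q).flip_of_ne b (hv 0 le_rfl)
    · have : (eqInit Q).flip b (.inr (.inr 0)) = xor (b (.inr (.inr 0))) true :=
        (eqInit Q).flip_tgt b
      refine this.trans ?_
      rw [hb]
      simp
  | succ s ih =>
    obtain ⟨ih1, ih2⟩ := ih (Nat.le_of_succ_le hs)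
    rw [upTo, ← List.cons_append, runToggles_append]
    set b' := runToggles (eqInit Q :: upTo (fun s => [eqToggle s]) s (Nat.le_of_succ_le hs)) b
    have h1 : runToggles [eqToggle (⟨s, hs⟩ : Fin (Fintype.card Q))] b'
      = (eqToggle (⟨s, hs⟩ : Fin (Fintype.card Q))).flip b' := rfl
    rw [h1]
    refine ⟨fun v hv => ?_, ?_⟩
    · rw [Toggle.flip_of_ne _ _ (hv _ le_rfl), ih1]
      exact fun i hi => hv i (hi.trans (Nat.le_succ s))
    · refine ((eqToggle (⟨s, hs⟩ : Fin (Fintype.card Q))).flip_tgt b').trans ?_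
      have h2 : b' (eqToggle (⟨s, hs⟩ : Fin (Fintype.card Q))).tgt = false := by
        refine (ih1 _ ?_).trans (hb _)
        rintro i hi h
        have : i = (⟨s, hs⟩ : Fin (Fintype.card Q)).succ := by
          simpa [eqToggle] using h.symm
        rw [this] at hi
        simp at hi
      have h3 : b' (.inr (.inr (⟨s, hs⟩ : Fin (Fintype.card Q)).castSucc)) = _ := ih2
      rw [h2, Bool.false_xor]
      simp only [eqToggle]
      rw [h3, ih1 _ (by simp), ih1 _ (by simp), ← Bool.decide_and, decide_eq_decide]
      constructor
      · rintro ⟨h, h'⟩ i hi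
        rcases Nat.lt_succ_iff_lt_or_eq.1 hi with hi | hi
        · exact h i hi
        · have : i = ⟨s, hs⟩ := Fin.ext hi
          rw [this]
          exact h'
      · exact fun h => ⟨fun i hi => h i (hi.trans (Nat.lt_succ_self s)), h ⟨s, hs⟩ (Nat.lt_succ_self s)⟩

theorem maps_eqCircuit {E : Type} [Fintype E] [DecidableEq E] (b : Bits (EqWires Q))
    (hb : ∀ v, b (.inr (.inr v)) = false) :
    ∃ b' : Bits (EqWires Q), Maps ((toggleCircuit (eqToggles Q)).oper : Oper _ E) b b' ∧
      (∀ v, b' (.inl v) = b (.inl v)) ∧ (∀ v, b' (.inr (.inl v)) = b (.inr (.inl v))) ∧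
      b' (.inr (.inr (Fin.last _)))
        = decide ((fun v => b (.inl v)) = fun v => b (.inr (.inl v))) := by
  obtain ⟨h1, h2⟩ := runToggles_eq b hb (Fintype.card Q) le_rfl
  refine ⟨_, maps_toggleCircuit _ b, fun v => h1 _ (by simp), fun v => h1 _ (by simp), ?_⟩
  refine h2.trans ?_
  rw [decide_eq_decide, funext_iff]
  constructor
  · intro h v
    have := h (Fintype.equivFin Q v) (Fin.is_lt _)
    simpa using this
  · exact fun h i _ => h _

theorem eqCircuit_cost : (toggleCircuit (eqToggles Q)).cost ≤ (Fintype.card Q + 1) * 256 := by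
  refine (toggleCircuit_cost_le _ 3 ?_).trans (Nat.mul_le_mul ?_ (by norm_num))
  · intro τ hτ
    rcases List.mem_cons.1 hτ with rfl | hτ
    · simp [eqInit]
    · obtain ⟨s, hs⟩ := mem_upTo hτ
      rw [List.mem_singleton] at hs
      subst hs
      exact Finset.card_le_three
  · have := sum_map_upTo_le (fun s : Fin (Fintype.card Q) => [eqToggle s]) (fun _ => 1) 1
      (fun s => by simp) (Fintype.card Q) le_rfl
    simpa [eqToggles] using this

end EqualityCircuit

/-! ### Computing, using and uncomputing intermediate results -/

section Uncompute

variable {W W₁ E ι : Type} [Fintype W] [DecidableEq W] [Fintype W₁] [DecidableEq W₁]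
  [Fintype E] [DecidableEq E]

/-- The toggles of a family, one after the other. -/
def familyToggles [Fintype ι] (τ : ι → Toggle W) : List (Toggle W) :=
  (Finset.univ : Finset ι).toList.map τ

/-- If no target of a family of toggles is an input of one of them, then each of them acts as it
would act alone. -/
theorem runToggles_family [Fintype ι] (τ : ι → Toggle W)
    (hinj : Function.Injective fun i => (τ i).tgt) (hsupp : ∀ i j, (τ i).tgt ∉ (τ j).supp)
    (b : Bits W) :
    (∀ i, runToggles (familyToggles τ) b (τ i).tgt = xor (b (τ i).tgt) ((τ i).fn b)) ∧
      ∀ v, (∀ i, (τ i).tgt ≠ v) → runToggles (familyToggles τ) b v = b v := by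
  constructor
  · intro i
    apply toZ_injective
    rw [toZ_runToggles (Set.range fun i => (τ i).tgt), toZ_xor, familyToggles, List.map_map,
      Finset.sum_map_toList, Finset.sum_eq_single i]
    · simp
    · intro j _ hj
      exact if_neg fun h => hj (hinj h)
    · simp
    · intro t ht
      obtain ⟨j, -, rfl⟩ := List.mem_map.1 ht
      refine ⟨⟨j, rfl⟩, ?_⟩
      rintro v hv ⟨k, rfl⟩
      exact hsupp k j hv
  · intro v hv
    refine runToggles_of_notMem (Set.range fun i => (τ i).tgt) _ ?_ b ?_
    · intro t ht
      obtain ⟨j, -, rfl⟩ := List.mem_map.1 ht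
      exact ⟨j, rfl⟩
    · rintro ⟨i, hi⟩
      exact hv i hi

/-- Computing intermediate results, using them and uncomputing them acts as their use alone, in
which the wires of the intermediate results are the ones before the computation. -/
theorem maps_compute_uncompute (C : Circuit W₁) (f : W₁ ↪ W) (l : List (Toggle W))
    (hl : ∀ t ∈ l, t.tgt ∉ Set.range f) (b : Bits W) (c : Bits W₁)
    (hc : Maps (C.oper : Oper W₁ E) (b ∘ f) c) :
    Maps ((C.map f).oper.conjTranspose * ((toggleCircuit l).oper * (C.map f).oper) : Oper W E) b
      (Function.extend f (b ∘ f) (runToggles l (Function.extend f c b))) := by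
  have h1 : Maps ((C.map f).oper : Oper W E) b (Function.extend f c b) := by
    rw [Circuit.map_oper]
    exact hc.lift
  have h2 := (maps_toggleCircuit (E := E) l (Function.extend f c b)).mul h1
  have h3 : runToggles l (Function.extend f c b) ∘ f = c := by
    funext v
    rw [Function.comp_apply, runToggles_of_notMem (Set.range f)ᶜ l hl _ fun h => h ⟨v, rfl⟩,
      f.injective.extend_apply]
  refine Maps.mul ?_ h2
  rw [Circuit.map_oper, ← ext_conjTranspose]
  refine Maps.lift ?_
  rw [h3]
  exact hc.conjTranspose C.oper_mem_unitary

end Uncompute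

/-! ### Queries with a simulated, reprogrammed hash function -/

/-- A circuit for a keyed hash function, which leaves the values at the ancillas `out`. -/
structure HashScheme (Q Key Anc : Type) [Fintype Q] [DecidableEq Q] [Fintype Key] [DecidableEq Key]
    [Fintype Anc] [DecidableEq Anc] (m : ℕ) where
  circuit : Circuit (Q ⊕ Key ⊕ Anc)
  fn : Bits Key → Bits Q → BitString m
  out : Fin m → Anc
  maps : ∀ (E : Type) [Fintype E] [DecidableEq E] (b : Bits (Q ⊕ Key ⊕ Anc)),
    (∀ v, b (.inr (.inr v)) = false) →
      ∃ b', Maps (circuit.oper : Oper _ E) b b' ∧ (∀ v, b' (.inl v) = b (.inl v)) ∧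
        ∀ i, b' (.inr (.inr (out i))) = fn (fun k => b (.inr (.inl k))) (fun v => b (.inl v)) i

section Compare

variable {Q Key Anc : Type} [Fintype Q] [DecidableEq Q] [Fintype Key] [DecidableEq Key]
    [Fintype Anc] [DecidableEq Anc] {m : ℕ}

/-- The wires of the circuit that computes a hash value and compares the input with a given one:
the input, the given value, the key, and ancillas. -/
abbrev LookupWires (Q Key Anc : Type) [Fintype Q] : Type :=
  Q ⊕ Q ⊕ Key ⊕ (Anc ⊕ Fin (Fintype.card Q + 1))

/-- The wires of the hash circuit among those of the lookup circuit. -/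
def lookupHashWires (Q Key Anc : Type) [Fintype Q] : Q ⊕ Key ⊕ Anc ↪ LookupWires Q Key Anc where
  toFun
    | .inl v => .inl v
    | .inr (.inl k) => .inr (.inr (.inl k))
    | .inr (.inr a) => .inr (.inr (.inr (.inl a)))
  inj' v v' h := by
    rcases v with v | v | v <;> rcases v' with v' | v' | v' <;> simp_all

/-- The wires of the comparison circuit among those of the lookup circuit. -/
def lookupEqWires (Q Key Anc : Type) [Fintype Q] : EqWires Q ↪ LookupWires Q Key Anc where
  toFun
    | .inl v => .inl v
    | .inr (.inl v) => .inr (.inl v)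
    | .inr (.inr i) => .inr (.inr (.inr (.inr i)))
  inj' v v' h := by
    rcases v with v | v | v <;> rcases v' with v' | v' | v' <;> simp_all

/-- The circuit that computes a hash value and compares the input with a given one. -/
def lookupCircuit (h : HashScheme Q Key Anc m) : Circuit (LookupWires Q Key Anc) :=
  h.circuit.map (lookupHashWires Q Key Anc) ++
    Circuit.map (lookupEqWires Q Key Anc) (toggleCircuit (eqToggles Q))

theorem maps_lookupCircuit (h : HashScheme Q Key Anc m) {E : Type} [Fintype E] [DecidableEq E]
    (b : Bits (LookupWires Q Key Anc)) (hb : ∀ v, b (.inr (.inr (.inr v))) = false) :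
    ∃ b', Maps ((lookupCircuit h).oper : Oper _ E) b b' ∧
      (∀ i, b' (.inr (.inr (.inr (.inl (h.out i)))))
        = h.fn (fun k => b (.inr (.inr (.inl k)))) (fun v => b (.inl v)) i) ∧
      b' (.inr (.inr (.inr (.inr (Fin.last _)))))
        = decide ((fun v => b (.inl v)) = fun v => b (.inr (.inl v))) := by
  obtain ⟨c, hc, hc1, hc2⟩ := h.maps E (b ∘ lookupHashWires Q Key Anc) fun v => hb _
  set b₁ := Function.extend (lookupHashWires Q Key Anc) c b with hb₁
  have e1 : ∀ v, b₁ (.inl v) = b (.inl v) := fun v =>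
    ((lookupHashWires Q Key Anc).injective.extend_apply c b (.inl v)).trans (hc1 v)
  have e2 : ∀ v, b₁ (.inr (.inl v)) = b (.inr (.inl v)) := by
    intro v
    refine extend_off ?_
    rintro ⟨w | w | w, hw⟩
    · exact Sum.inl_ne_inr hw
    · exact Sum.inr_ne_inl (Sum.inr.inj hw)
    · exact Sum.inr_ne_inl (Sum.inr.inj hw)
  have e3 : ∀ i, b₁ (.inr (.inr (.inr (.inr i)))) = false := by
    intro i
    refine (extend_off ?_).trans (hb _)
    rintro ⟨w | w | w, hw⟩
    · exact Sum.inl_ne_inr hw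
    · exact Sum.inl_ne_inr (Sum.inr.inj (Sum.inr.inj hw))
    · exact Sum.inl_ne_inr (Sum.inr.inj (Sum.inr.inj (Sum.inr.inj hw)))
  have e4 : ∀ i, b₁ (.inr (.inr (.inr (.inl (h.out i)))))
      = h.fn (fun k => b (.inr (.inr (.inl k)))) (fun v => b (.inl v)) i := fun i =>
    ((lookupHashWires Q Key Anc).injective.extend_apply c b (.inr (.inr (h.out i)))).trans (hc2 i)
  obtain ⟨d, hd, -, -, hd3⟩ := maps_eqCircuit (E := E) (b₁ ∘ lookupEqWires Q Key Anc) fun v => e3 v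
  refine ⟨Function.extend (lookupEqWires Q Key Anc) d b₁, ?_, fun i => ?_, ?_⟩
  · rw [lookupCircuit, Circuit.append_oper, Circuit.map_oper, Circuit.map_oper]
    exact hd.lift.mul hc.lift
  · rw [extend_off, e4]
    rintro ⟨w | w | w, hw⟩
    · exact Sum.inl_ne_inr hw
    · exact Sum.inl_ne_inr (Sum.inr.inj hw)
    · exact Sum.inr_ne_inl (Sum.inr.inj (Sum.inr.inj (Sum.inr.inj hw)))
  · refine ((lookupEqWires Q Key Anc).injective.extend_apply d b₁
      (.inr (.inr (Fin.last _)))).trans (hd3.trans ?_)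
    have e5 : (fun v => (b₁ ∘ lookupEqWires Q Key Anc) (.inl v)) = fun v => b (.inl v) :=
      funext e1
    have e6 : (fun v => (b₁ ∘ lookupEqWires Q Key Anc) (.inr (.inl v))) = fun v => b (.inr (.inl v)) :=
      funext e2
    rw [e5, e6]

end Compare

section ProverWires

/-- The communication wires of an adversary against the Fiat-Shamir transform, with queries in
`X ⊕ M`, answers of length `m` and responses in `Z`. -/
abbrev QueryComm (X M : Type) (m : ℕ) (Z : Type) : Type := (X ⊕ M) ⊕ Fin m ⊕ Z

/-- The communication wires of a prover, with messages in `M`, challenges of length `m` and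
responses in `Z`. -/
abbrev ProverComm (M : Type) (m : ℕ) (Z : Type) : Type := M ⊕ Fin m ⊕ Z

/-- The ancillas of the derived prover: those of the hash circuit, those of the comparison, and a
control wire for the calls. -/
abbrev ProverAnc (X M Anc : Type) [Fintype X] [Fintype M] : Type :=
  Anc ⊕ Fin (Fintype.card (X ⊕ M) + 1) ⊕ Unit

/-- The wires of the derived prover: its communication wires, those of the adversary, a copy of
the instance, the key of the hash function, the selector of the query that is measured, and
ancillas. -/
abbrev DerivedWires (X M : Type) (m : ℕ) (Z Key Sel Anc : Type) [Fintype X] [Fintype M] : Type :=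
  ProverComm M m Z ⊕ Inner (QueryComm X M m Z) X (Key ⊕ Sel ⊕ ProverAnc X M Anc)

variable {X M Z Key Sel Anc E : Type} [Fintype X] [DecidableEq X] [Fintype M] [DecidableEq M]
  [Fintype Z] [DecidableEq Z] [Fintype Key] [DecidableEq Key] [Fintype Sel] [DecidableEq Sel]
  [Fintype Anc] [DecidableEq Anc] [Fintype E] [DecidableEq E] {m q : ℕ}

local notation "DW" => DerivedWires X M m Z Key Sel Anc

/-- The state of the derived prover with clean ancillas that is described by the family `Φ` of
states of the adversary. -/
def clean (Φ : Bits (ProverComm M m Z) → Bits X → Bits Key → Bits Sel →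
    Bits (QueryComm X M m Z) × E → ℂ) : Bits DW × E → ℂ := fun p =>
  open Classical in
  if ∀ v, p.1 (.inr (.inr (.inr (.inr (.inr v))))) = false then
    Φ (fun v => p.1 (.inl v)) (fun v => p.1 (.inr (.inr (.inl v))))
      (fun v => p.1 (.inr (.inr (.inr (.inl v))))) (fun v => p.1 (.inr (.inr (.inr (.inr (.inl v))))))
      (fun v => p.1 (.inr (.inl v)), p.2)
  else 0

/-- A query to the function `H`. -/
def queryFn (H : Bits (X ⊕ M) → BitString m) (ψ : Bits (QueryComm X M m Z) × E → ℂ) :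
    Bits (QueryComm X M m Z) × E → ℂ := fun p =>
  ψ (fun v => xor (p.1 v) (Sum.elim (zeros _) (Sum.elim (H fun u => p.1 (.inl u)) (zeros _)) v), p.2)

/-- The wires of the lookup circuit: the query register is compared with the instance held by the
prover and its first message. -/
def lookupWires (X M : Type) (m : ℕ) (Z Key Sel Anc : Type) [Fintype X] [Fintype M] :
    LookupWires (X ⊕ M) Key Anc ↪ DerivedWires X M m Z Key Sel Anc where
  toFun
    | .inl v => .inr (.inl (.inl v))
    | .inr (.inl (.inl x)) => .inr (.inr (.inl x))
    | .inr (.inl (.inr a)) => .inl (.inl a)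
    | .inr (.inr (.inl k)) => .inr (.inr (.inr (.inl k)))
    | .inr (.inr (.inr (.inl a))) => .inr (.inr (.inr (.inr (.inr (.inl a)))))
    | .inr (.inr (.inr (.inr i))) => .inr (.inr (.inr (.inr (.inr (.inr (.inl i))))))
  inj' v v' h := by
    rcases v with v | (v | v) | v | v | v <;> rcases v' with v' | (v' | v') | v' | v' | v' <;>
      simp_all

/-- Addition of one bit of the answer of the (reprogrammed) hash function to the answer register of
the adversary. The selector decides with `cond` whether the query is made and with `mode` whether
the hash function is reprogrammed. -/
def answerToggle (h : HashScheme (X ⊕ M) Key Anc m) (cond mode : Bits Sel → Bool) (i : Fin m) :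
    Toggle DW where
  supp := Finset.univ.image (fun s : Sel => .inr (.inr (.inr (.inr (.inl s))))) ∪
    {.inr (.inr (.inr (.inr (.inr (.inl (h.out i)))))),
      .inr (.inr (.inr (.inr (.inr (.inr (.inl (Fin.last _))))))), .inl (.inr (.inl i))}
  tgt := .inr (.inl (.inr (.inl i)))
  fn b := cond (fun s => b (.inr (.inr (.inr (.inr (.inl s)))))) &&
    bif mode (fun s => b (.inr (.inr (.inr (.inr (.inl s)))))) &&
      b (.inr (.inr (.inr (.inr (.inr (.inr (.inl (Fin.last _)))))))) then b (.inl (.inr (.inl i)))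
    else b (.inr (.inr (.inr (.inr (.inr (.inl (h.out i)))))))
  tgt_notMem := by simp
  fn_congr b b' hb := by
    have h1 : (fun s => b (.inr (.inr (.inr (.inr (.inl s))))))
        = fun s => b' (.inr (.inr (.inr (.inr (.inl s))))) := funext fun s => hb _ (by simp)
    rw [h1, hb (.inl (.inr (.inl i))) (by simp),
      hb (.inr (.inr (.inr (.inr (.inr (.inl (h.out i))))))) (by simp),
      hb (.inr (.inr (.inr (.inr (.inr (.inr (.inl (Fin.last _)))))))) (by simp)]

theorem answerToggle_supp_card (h : HashScheme (X ⊕ M) Key Anc m) (cond mode : Bits Sel → Bool)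
    (i : Fin m) :
    (answerToggle h cond mode i : Toggle DW).supp.card ≤ Fintype.card Sel + 3 :=
  (Finset.card_union_le _ _).trans (add_le_add Finset.card_image_le Finset.card_le_three)

open Classical in
/-- The hash function of the derived prover: it is reprogrammed at the held instance and message, to
the challenge, if `r` holds. -/
def reprogrammed (H : Bits (X ⊕ M) → BitString m) (r : Bool) (n : Bits (ProverComm M m Z))
    (x : Bits X) : Bits (X ⊕ M) → BitString m := fun u =>
  if r = true ∧ u = Sum.elim x (fun a => n (.inl a)) then fun i => n (.inr (.inl i)) else H u

/-- A conditional query of the adversary: the hash value is computed, used and uncomputed. Only its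
use needs to be controlled. -/
def queryBlock (h : HashScheme (X ⊕ M) Key Anc m) (cond mode : Bits Sel → Bool) :
    CProgram (QueryComm X M m Z) DW q :=
  CProgram.ofProgram (Program.ofCircuit
      ((lookupCircuit h).map (lookupWires X M m Z Key Sel Anc))) ++
    CProgram.ofToggles (familyToggles (answerToggle h cond mode)) ++
    CProgram.ofProgram (Program.ofCircuit
      (Circuit.inv ((lookupCircuit h).map (lookupWires X M m Z Key Sel Anc))))

theorem off_queryBlock (A : Adversary (QueryComm X M m Z) q) (h : HashScheme (X ⊕ M) Key Anc m)
    (cond mode : Bits Sel → Bool) :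
    Program.oper A (CProgram.off (queryBlock h cond mode : CProgram _ DW q)) = 1 := by
  rw [queryBlock, CProgram.off_append, CProgram.off_append, CProgram.off_ofProgram,
    CProgram.off_ofProgram, CProgram.off_ofToggles, List.append_nil, Program.oper_append,
    Program.oper_ofCircuit, Program.oper_ofCircuit, Circuit.inv_oper]
  exact conjTranspose_mul_of_unitary (Circuit.oper_mem_unitary _)

theorem oper_ofToggles {N W : Type} [Fintype N] [DecidableEq N] [Fintype W] [DecidableEq W]
    (A : Adversary N q) (l : List (Toggle W)) :
    Program.oper A (CProgram.plain (CProgram.ofToggles l : CProgram N W q))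
      = (toggleCircuit l).oper := by
  rw [← Program.oper_ofCircuit]
  congr 1
  rw [CProgram.plain, CProgram.ofToggles, Program.ofCircuit, toggleCircuit, List.map_map,
    List.map_map]
  rfl

theorem oper_queryBlock (A : Adversary (QueryComm X M m Z) q) (h : HashScheme (X ⊕ M) Key Anc m)
    (cond mode : Bits Sel → Bool) :
    Program.oper A (CProgram.plain (queryBlock h cond mode : CProgram _ DW q))
      = ((lookupCircuit h).map (lookupWires X M m Z Key Sel Anc)).oper.conjTranspose *
        ((toggleCircuit (familyToggles (answerToggle h cond mode))).oper *
          ((lookupCircuit h).map (lookupWires X M m Z Key Sel Anc)).oper) := by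
  rw [queryBlock, CProgram.plain_append, CProgram.plain_append, CProgram.plain_ofProgram,
    CProgram.plain_ofProgram, Program.oper_append, Program.oper_append,
    Program.oper_ofCircuit, Program.oper_ofCircuit, Circuit.inv_oper, oper_ofToggles]

/-- What a conditional query adds to the communication register of the adversary. -/
def answerBits (h : HashScheme (X ⊕ M) Key Anc m) (cond mode : Bits Sel → Bool) (b : Bits DW) :
    Bits (QueryComm X M m Z) := fun v =>
  cond (fun s => b (.inr (.inr (.inr (.inr (.inl s)))))) &&
    Sum.elim (zeros _) (Sum.elim (reprogrammed (Z := Z)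
      (h.fn fun k => b (.inr (.inr (.inr (.inl k)))))
      (mode fun s => b (.inr (.inr (.inr (.inr (.inl s))))))
      (fun v => b (.inl v)) (fun v => b (.inr (.inr (.inl v))))
      fun u => b (.inr (.inl (.inl u)))) (zeros _)) v

/-- The permutation of the basis states with clean ancillas performed by a conditional query. -/
def answerPerm (h : HashScheme (X ⊕ M) Key Anc m) (cond mode : Bits Sel → Bool) (b : Bits DW) :
    Bits DW := fun v =>
  xor (b v) (match v with
    | .inr (.inl v) => answerBits h cond mode b v
    | _ => false)

theorem maps_queryBlock (A : Adversary (QueryComm X M m Z) q) (h : HashScheme (X ⊕ M) Key Anc m)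
    (cond mode : Bits Sel → Bool) (b : Bits DW)
    (hb : ∀ v, b (.inr (.inr (.inr (.inr (.inr v))))) = false) :
    Maps (Program.oper A (CProgram.plain (queryBlock h cond mode : CProgram _ DW q))) b
      (answerPerm h cond mode b) := by
  classical
  obtain ⟨c, hc, hc1, hc2⟩ := maps_lookupCircuit h (E := A.E)
    (b ∘ lookupWires X M m Z Key Sel Anc) (by rintro (v | v) <;> exact hb _)
  have hl : ∀ t ∈ familyToggles (answerToggle h cond mode : Fin m → Toggle DW),
      t.tgt ∉ Set.range (lookupWires X M m Z Key Sel Anc) := by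
    intro t ht
    obtain ⟨i, -, rfl⟩ := List.mem_map.1 ht
    rintro ⟨v | (v | v) | v | v | v, hv⟩
    · exact Sum.inl_ne_inr (Sum.inl.inj (Sum.inr.inj hv))
    · exact Sum.inr_ne_inl (Sum.inr.inj hv)
    · exact Sum.inl_ne_inr hv
    · exact Sum.inr_ne_inl (Sum.inr.inj hv)
    · exact Sum.inr_ne_inl (Sum.inr.inj hv)
    · exact Sum.inr_ne_inl (Sum.inr.inj hv)
  have h1 := maps_compute_uncompute (E := A.E) _ _ _ hl b c hc
  rw [oper_queryBlock]
  convert h1 using 1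
  obtain ⟨r1, r2⟩ := runToggles_family (answerToggle h cond mode : Fin m → Toggle DW)
    (fun i j hij => by simpa [answerToggle] using hij) (fun i j => by simp [answerToggle])
    (Function.extend (lookupWires X M m Z Key Sel Anc) c b)
  funext v
  by_cases hv : v ∈ Set.range (lookupWires X M m Z Key Sel Anc)
  · obtain ⟨w, rfl⟩ := hv
    rw [(lookupWires X M m Z Key Sel Anc).injective.extend_apply]
    rcases w with w | (w | w) | w | w | w
    · change xor (b _) (_ && false) = b _
      rw [Bool.and_false, Bool.xor_false]
    all_goals exact Bool.xor_false _
  · rw [extend_off hv]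
    by_cases hv' : ∃ i, (answerToggle h cond mode i : Toggle DW).tgt = v
    · obtain ⟨i, rfl⟩ := hv'
      have e1 : ∀ s : Sel, (Function.extend (lookupWires X M m Z Key Sel Anc) c b)
          (.inr (.inr (.inr (.inr (.inl s))))) = b (.inr (.inr (.inr (.inr (.inl s))))) := by
        intro s
        refine extend_off ?_
        rintro ⟨w | (w | w) | w | w | w, hw⟩
        · exact Sum.inl_ne_inr (Sum.inr.inj hw)
        · exact Sum.inl_ne_inr (Sum.inr.inj (Sum.inr.inj hw))
        · exact Sum.inl_ne_inr hw
        · exact Sum.inl_ne_inr (Sum.inr.inj (Sum.inr.inj (Sum.inr.inj hw)))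
        · exact Sum.inr_ne_inl (Sum.inr.inj (Sum.inr.inj (Sum.inr.inj (Sum.inr.inj hw))))
        · exact Sum.inr_ne_inl (Sum.inr.inj (Sum.inr.inj (Sum.inr.inj (Sum.inr.inj hw))))
      have e2 : (Function.extend (lookupWires X M m Z Key Sel Anc) c b) (.inl (.inr (.inl i)))
          = b (.inl (.inr (.inl i))) := by
        refine extend_off ?_
        rintro ⟨w | (w | w) | w | w | w, hw⟩
        · exact Sum.inr_ne_inl hw
        · exact Sum.inr_ne_inl hw
        · exact Sum.inl_ne_inr (Sum.inl.inj hw)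
        · exact Sum.inr_ne_inl hw
        · exact Sum.inr_ne_inl hw
        · exact Sum.inr_ne_inl hw
      have e3 : (Function.extend (lookupWires X M m Z Key Sel Anc) c b)
          (.inr (.inr (.inr (.inr (.inr (.inl (h.out i)))))))
          = h.fn (fun k => b (.inr (.inr (.inr (.inl k))))) (fun u => b (.inr (.inl (.inl u)))) i :=
        ((lookupWires X M m Z Key Sel Anc).injective.extend_apply c b
          (.inr (.inr (.inr (.inl (h.out i)))))).trans (hc1 i)
      have e4 : (Function.extend (lookupWires X M m Z Key Sel Anc) c b)
          (.inr (.inr (.inr (.inr (.inr (.inr (.inl (Fin.last _))))))))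
          = decide ((fun u => b (.inr (.inl (.inl u))))
            = Sum.elim (fun x => b (.inr (.inr (.inl x)))) fun a => b (.inl (.inl a))) := by
        refine ((lookupWires X M m Z Key Sel Anc).injective.extend_apply c b
          (.inr (.inr (.inr (.inr (Fin.last _)))))).trans (hc2.trans ?_)
        congr 2
        funext u
        cases u <;> rfl
      have e5 : (Function.extend (lookupWires X M m Z Key Sel Anc) c b)
          (answerToggle h cond mode i : Toggle DW).tgt = b (answerToggle h cond mode i : Toggle DW).tgt :=
        extend_off hv
      rw [r1, e5]
      refine congrArg (xor _) ?_
      simp only [answerToggle, e1, e2, e3, e4]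
      simp only [answerBits, Sum.elim_inr, Sum.elim_inl]
      congr 1
      unfold reprogrammed
      by_cases hm : (mode fun s => b (.inr (.inr (.inr (.inr (.inl s)))))) = true <;>
        by_cases hu : (fun u => b (.inr (.inl (.inl u))))
            = Sum.elim (fun x => b (.inr (.inr (.inl x)))) fun a => b (.inl (.inl a)) <;>
        simp [hm, hu]
    · have hv'' := not_exists.1 hv'
      rw [r2 v hv'', extend_off hv]
      rcases v with v | (v | v | v) | v
      · exact Bool.xor_false _
      · exact absurd ⟨.inl v, rfl⟩ hv
      · exact absurd rfl (hv'' v)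
      · change xor (b _) (_ && false) = b _
        rw [Bool.and_false, Bool.xor_false]
      · exact Bool.xor_false _

/-- A conditional query acts on the states with clean ancillas as a query to the (reprogrammed) hash
function with the key in question, if the selector allows it. -/
theorem queryBlock_mulVec (A : Adversary (QueryComm X M m Z) q) (h : HashScheme (X ⊕ M) Key Anc m)
    (cond mode : Bits Sel → Bool) (Φ : Bits (ProverComm M m Z) → Bits X → Bits Key → Bits Sel →
      Bits (QueryComm X M m Z) × A.E → ℂ) :
    (Program.oper A (CProgram.plain (queryBlock h cond mode : CProgram _ DW q))).mulVec (clean Φ)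
      = clean fun n x k s => bif cond s then queryFn (reprogrammed (h.fn k) (mode s) n x) (Φ n x k s)
          else Φ n x k s := by
  classical
  have hr : ∀ (b : Bits DW) v, answerPerm h cond mode b (.inr (.inr v)) = b (.inr (.inr v)) :=
    fun b v => Bool.xor_false _
  have hl : ∀ (b : Bits DW) v, answerPerm h cond mode b (.inl v) = b (.inl v) :=
    fun b v => Bool.xor_false _
  have hq : ∀ (b : Bits DW) v, answerPerm h cond mode b (.inr (.inl (.inl v))) = b (.inr (.inl (.inl v))) := by
    intro b v
    change xor (b _) (_ && false) = b _
    rw [Bool.and_false, Bool.xor_false]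
  funext p
  obtain ⟨h1, h2⟩ := mulVec_of_maps
    {b : Bits DW | ∀ v, b (.inr (.inr (.inr (.inr (.inr v))))) = false} (answerPerm h cond mode)
    (fun b hb => maps_queryBlock A h cond mode b hb) (fun b hb v => (hr b _).trans (hb v))
    (fun b _ => by
      funext v
      rcases v with v | v | v
      · rw [hl, hl]
      · have e : answerBits h cond mode (answerPerm h cond mode b) = answerBits h cond mode b := by
          unfold answerBits
          simp only [hr, hl, hq]
        change xor (xor (b _) (answerBits h cond mode b v))
          (answerBits h cond mode (answerPerm h cond mode b) v) = b _
        rw [e, Bool.xor_assoc, Bool.xor_self, Bool.xor_false]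
      · rw [hr, hr])
    (clean Φ) (fun p hp => if_neg hp) p
  by_cases hp : ∀ v, p.1 (.inr (.inr (.inr (.inr (.inr v))))) = false
  · rw [h1 hp]
    unfold clean
    simp only [hr, hl]
    rw [if_pos hp, if_pos hp]
    unfold answerPerm queryFn answerBits
    cases hc : cond fun s => p.1 (.inr (.inr (.inr (.inr (.inl s)))))
    · simp only [Bool.false_and, Bool.xor_false, cond_false]
    · simp only [Bool.true_and, cond_true]
  · rw [h2 hp]
    exact (if_neg hp).symm

end ProverWires

/-! ### Uniform superpositions -/

section Hadamard

variable {W E : Type} [Fintype W] [DecidableEq W] [Fintype E] [DecidableEq E]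

/-- The Hadamard matrix. -/
def hadamardMatrix : Matrix (BitString 1) (BitString 1) ℂ := Matrix.of fun b b' =>
  ((Real.sqrt 2)⁻¹ : ℝ) * if b 0 && b' 0 then -1 else 1

theorem hadamardMatrix_mem_unitary : hadamardMatrix ∈ Matrix.unitaryGroup (BitString 1) ℂ := by
  have h2 : (((Real.sqrt 2)⁻¹ : ℝ) : ℂ) * (((Real.sqrt 2)⁻¹ : ℝ) : ℂ) = 1 / 2 := by
    rw [← Complex.ofReal_mul, ← mul_inv, Real.mul_self_sqrt (by norm_num)]
    norm_num
  rw [Matrix.mem_unitaryGroup_iff]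
  ext b b'
  rw [Matrix.mul_apply, ← (Equiv.funUnique (Fin 1) Bool).symm.sum_comp]
  have hb : ∀ b : BitString 1, b = fun _ => b 0 := fun b => funext fun i => by rw [Subsingleton.elim i 0]
  rw [hb b, hb b']
  cases b 0 <;> cases b' 0
  all_goals
    simp [hadamardMatrix, Matrix.star_apply, funext_iff, -Complex.ofReal_inv] at h2 ⊢
  all_goals linear_combination (2 : ℂ) * h2

/-- The Hadamard gate. -/
def hadamard (w : W) : Gate W :=
  ⟨1, ⟨fun _ => w, Function.injective_of_subsingleton _⟩, ⟨hadamardMatrix, hadamardMatrix_mem_unitary⟩⟩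

theorem hadamard_mulVec (w : W) (ψ : Bits W × E → ℂ) (hψ : ∀ p, p.1 w = true → ψ p = 0)
    (p : Bits W × E) :
    (hadamard w).oper.mulVec ψ p
      = ((Real.sqrt 2)⁻¹ : ℝ) * ψ (Function.update p.1 w false, p.2) := by
  have hsum : ∀ g : BitString 1 → ℂ, ∑ b, g b = g (fun _ => true) + g fun _ => false := by
    intro g
    rw [← (Equiv.funUnique (Fin 1) Bool).symm.sum_comp, Fintype.sum_bool]
    rfl
  have he : ∀ x : Bool, Function.extend (hadamard w).wires (fun _ => x) p.1
      = Function.update p.1 w x := by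
    intro x
    funext v
    by_cases hv : v = w
    · subst hv
      rw [Function.update_self]
      exact (hadamard v).wires.injective.extend_apply _ _ (0 : Fin 1)
    · rw [Function.update_of_ne hv]
      refine extend_off ?_
      rintro ⟨i, hi⟩
      exact hv hi.symm
  have e : ∀ x : Bool, (hadamard w).unitary.1 (p.1 ∘ (hadamard w).wires) (fun _ => x)
      * slice (hadamard w).wires p.1 ψ (fun _ => x, p.2)
      = (((Real.sqrt 2)⁻¹ : ℝ) * if p.1 w && x then -1 else 1) * ψ (Function.update p.1 w x, p.2) :=
    fun x => congrArg₂ (· * ·) rfl (congrArg (fun b => ψ (b, p.2)) (he x))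
  rw [Gate.oper, ext_mulVec, tensorOne_mulVec, mulVec_eq]
  refine (hsum _).trans ((congrArg₂ (· + ·) (e true) (e false)).trans ?_)
  rw [hψ _ (Function.update_self _ _ _)]
  simp

/-- Hadamard gates on distinct wires in the state 0 produce a uniform superposition. -/
theorem hadamards_mulVec (L : List W) (hL : L.Nodup) (ψ : Bits W × E → ℂ)
    (hψ : ∀ p, ∀ w ∈ L, p.1 w = true → ψ p = 0) (p : Bits W × E) :
    (Circuit.oper (L.map hadamard)).mulVec ψ p
      = (((Real.sqrt 2)⁻¹ ^ L.length : ℝ) : ℂ) *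
        ψ (fun v => if v ∈ L then false else p.1 v, p.2) := by
  induction L generalizing ψ with
  | nil => simp [Circuit.oper]
  | cons w L ih =>
    have hw := List.nodup_cons.1 hL
    have h1 : (Circuit.oper ((w :: L).map hadamard) : Oper W E)
        = Circuit.oper (L.map hadamard) * (hadamard w).oper := by simp [Circuit.oper]
    have h2 := hadamard_mulVec w ψ fun p => hψ p w List.mem_cons_self
    rw [h1, ← Matrix.mulVec_mulVec, ih hw.2, h2]
    · rw [List.length_cons, pow_succ, Complex.ofReal_mul, mul_assoc]
      congr 3
      refine Prod.ext (funext fun v => ?_) rfl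
      by_cases hv : v = w
      · subst hv
        simp
      · simp [hv]
    · intro p v hv hp
      rw [h2, hψ _ v (List.mem_cons_of_mem _ hv), mul_zero]
      refine (Function.update_of_ne ?_ _ _).trans hp
      rintro rfl
      exact hw.1 hv

end Hadamard

/-! ### The program of the derived prover -/

section Copies

variable {W E ι : Type} [Fintype W] [DecidableEq W] [Fintype E] [DecidableEq E] [Fintype ι]

theorem family_mulVec (τ : ι → Toggle W)
    (hinj : Function.Injective fun i => (τ i).tgt) (hsupp : ∀ i j, (τ i).tgt ∉ (τ j).supp)
    (ψ : Bits W × E → ℂ) (p : Bits W × E) :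
    (toggleCircuit (familyToggles τ)).oper.mulVec ψ p
      = ψ (runToggles (familyToggles τ) p.1, p.2) := by
  refine (mulVec_of_maps Set.univ (runToggles (familyToggles τ))
    (fun b _ => maps_toggleCircuit _ b) (fun _ _ => Set.mem_univ _) (fun b _ => ?_) ψ
    (fun _ h => absurd (Set.mem_univ _) h) p).1 (Set.mem_univ _)
  obtain ⟨h1, h2⟩ := runToggles_family τ hinj hsupp b
  obtain ⟨h3, h4⟩ := runToggles_family τ hinj hsupp (runToggles (familyToggles τ) b)
  funext v
  by_cases hv : ∃ i, (τ i).tgt = v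
  · obtain ⟨i, rfl⟩ := hv
    have : (τ i).fn (runToggles (familyToggles τ) b) = (τ i).fn b := by
      refine (τ i).fn_congr _ _ fun v hv => h2 v ?_
      rintro j rfl
      exact hsupp j i hv
    rw [h3, h1, this, Bool.xor_assoc, Bool.xor_self, Bool.xor_false]
  · rw [h4 v (not_exists.1 hv), h2 v (not_exists.1 hv)]

/-- Addition of the bit `src` to the bit `dst`. -/
def copyToggle (src dst : W) (h : dst ≠ src) : Toggle W where
  supp := {src}
  tgt := dst
  fn b := b src
  tgt_notMem := by simpa using h
  fn_congr b b' hb := hb _ (Finset.mem_singleton_self _)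

end Copies

section DerivedProver

variable {X M Z Key Sel Anc E : Type} [Fintype X] [DecidableEq X] [Fintype M] [DecidableEq M]
  [Fintype Z] [DecidableEq Z] [Fintype Key] [DecidableEq Key] [Fintype Sel] [DecidableEq Sel]
  [Fintype Anc] [DecidableEq Anc] [Fintype E] [DecidableEq E] {m q : ℕ}

local notation "DW" => DerivedWires X M m Z Key Sel Anc

/-- The families of states that describe the clean states of the derived prover. -/
abbrev CleanFamily (X M : Type) (m : ℕ) (Z Key Sel E : Type) : Type :=
  Bits (ProverComm M m Z) → Bits X → Bits Key → Bits Sel → Bits (QueryComm X M m Z) × E → ℂ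

/-- The communication wires of the adversary among those of the derived prover. -/
def commWires (X M : Type) (m : ℕ) (Z Key Sel Anc : Type) [Fintype X] [Fintype M] :
    QueryComm X M m Z ↪ DerivedWires X M m Z Key Sel Anc :=
  Function.Embedding.inl.trans Function.Embedding.inr

theorem notMem_commWires {v : DW} (hv : ∀ w, v ≠ .inr (.inl w)) :
    v ∉ Set.range (commWires X M m Z Key Sel Anc) := by
  rintro ⟨w, rfl⟩
  exact hv w rfl

open Classical in
theorem slice_clean (Φ : CleanFamily X M m Z Key Sel E) (b : Bits DW) :
    slice (commWires X M m Z Key Sel Anc) b (clean Φ)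
      = if ∀ v, b (.inr (.inr (.inr (.inr (.inr v))))) = false then
          Φ (fun v => b (.inl v)) (fun v => b (.inr (.inr (.inl v))))
            (fun v => b (.inr (.inr (.inr (.inl v))))) (fun v => b (.inr (.inr (.inr (.inr (.inl v))))))
        else 0 := by
  funext r
  have h1 : ∀ v, Function.extend (commWires X M m Z Key Sel Anc) r.1 b (.inr (.inr v))
      = b (.inr (.inr v)) := fun v => extend_off (notMem_commWires fun w h => by simp at h)
  have h2 : ∀ v, Function.extend (commWires X M m Z Key Sel Anc) r.1 b (.inl v)
      = b (.inl v) := fun v => extend_off (notMem_commWires fun w h => by simp at h)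
  have h3 : ∀ v, Function.extend (commWires X M m Z Key Sel Anc) r.1 b (.inr (.inl v)) = r.1 v :=
    fun v => (commWires X M m Z Key Sel Anc).injective.extend_apply _ _ v
  simp only [slice, clean, h1, h2, h3]
  split_ifs <;> rfl

/-- The control wire for the calls is flipped if the selector satisfies `cond`. -/
def controlToggle (X M : Type) (m : ℕ) (Z Key Anc : Type) [Fintype X] [DecidableEq X] [Fintype M]
    [DecidableEq M] [Fintype Z] [DecidableEq Z] [Fintype Key] [DecidableEq Key] [Fintype Anc]
    [DecidableEq Anc] (cond : Bits Sel → Bool) :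
    Toggle (DerivedWires X M m Z Key Sel Anc) where
  supp := Finset.univ.image (fun s : Sel => .inr (.inr (.inr (.inr (.inl s)))))
  tgt := .inr (.inr (.inr (.inr (.inr (.inr (.inr ()))))))
  fn b := cond fun s => b (.inr (.inr (.inr (.inr (.inl s)))))
  tgt_notMem := by simp
  fn_congr b b' hb := congrArg cond (funext fun s => hb _ (by simp))

/-- A conditional call. The control wire is computed from the selector and uncomputed again; the
inverse call, which is made with the control wire off, makes the block the identity when
its toggles are left out. -/
def stepBlock (X M : Type) (m : ℕ) (Z Key Anc : Type) [Fintype X] [DecidableEq X] [Fintype M]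
    [DecidableEq M] [Fintype Z] [DecidableEq Z] [Fintype Key] [DecidableEq Key] [Fintype Anc]
    [DecidableEq Anc] (cond : Bits Sel → Bool)
    (j : Fin q) : CProgram (QueryComm X M m Z) (DerivedWires X M m Z Key Sel Anc) q :=
  [.inr (controlToggle X M m Z Key Anc cond),
    .inl (.call j false (commWires X M m Z Key Sel Anc) (controlToggle X M m Z Key Anc cond).tgt
      (notMem_commWires fun w h => by simp [controlToggle] at h)),
    .inr (controlToggle X M m Z Key Anc cond),
    .inl (.call j true (commWires X M m Z Key Sel Anc) (controlToggle X M m Z Key Anc cond).tgt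
      (notMem_commWires fun w h => by simp [controlToggle] at h))]

theorem off_stepBlock (A : Adversary (QueryComm X M m Z) q) (cond : Bits Sel → Bool) (j : Fin q) :
    Program.oper A (CProgram.off (stepBlock X M m Z Key Anc cond j)) = 1 := by
  have hf : ∀ w, (controlToggle X M m Z Key Anc cond).tgt ≠ (.inr (.inl w)) := fun w h => by
    simp [controlToggle] at h
  have h1 : CProgram.off (stepBlock X M m Z Key Anc cond j)
      = [.call j false (commWires X M m Z Key Sel Anc) (controlToggle X M m Z Key Anc cond).tgt
        (notMem_commWires hf), .call j true (commWires X M m Z Key Sel Anc)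
        (controlToggle X M m Z Key Anc cond).tgt (notMem_commWires hf)] := rfl
  rw [h1, Program.oper_cons, Program.oper_cons, Program.oper_nil, one_mul, Instr.matrix_call,
    Instr.matrix_call, sel_mul (Keeps.ext_of_notMem (notMem_commWires hf) _) (Keeps.one _), ← ext_mul]
  have : A.callOper j true * A.callOper j false = 1 := by
    have h := A.callOper_not j false
    rw [Bool.not_false] at h
    rw [h]
    exact conjTranspose_mul_of_unitary (A.callOper_mem_unitary j false)
  rw [this, ext_one, one_mul, sel_self]

theorem oper_stepBlock (A : Adversary (QueryComm X M m Z) q) (cond : Bits Sel → Bool) (j : Fin q) :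
    Program.oper A (CProgram.plain (stepBlock X M m Z Key Anc cond j))
      = sel (controlToggle X M m Z Key Anc cond).tgt
          (ext (commWires X M m Z Key Sel Anc) (A.callOper j true)) 1 *
        ((controlToggle X M m Z Key Anc cond).gate.oper *
          (sel (controlToggle X M m Z Key Anc cond).tgt
            (ext (commWires X M m Z Key Sel Anc) (A.callOper j false)) 1 *
          (controlToggle X M m Z Key Anc cond).gate.oper)) := by
  simp only [stepBlock, CProgram.plain, List.map_cons, List.map_nil, CInstr.plain,
    Program.oper_cons, Program.oper_nil, one_mul, Instr.matrix_call, Instr.matrix_gate, mul_assoc]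

/-- A conditional call acts on the states with clean ancillas as the unitary of the adversary, if
the selector allows it. -/
theorem stepBlock_mulVec (A : Adversary (QueryComm X M m Z) q) (cond : Bits Sel → Bool) (j : Fin q)
    (Φ : CleanFamily X M m Z Key Sel A.E) :
    (Program.oper A (CProgram.plain (stepBlock X M m Z Key Anc cond j))).mulVec (clean Φ)
      = clean fun n x k s => bif cond s then (A.step j).1.mulVec (Φ n x k s) else Φ n x k s := by
  classical
  set t := controlToggle (Sel := Sel) X M m Z Key Anc cond with ht
  set Φ' : CleanFamily X M m Z Key Sel A.E := fun n x k s =>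
    bif cond s then (A.step j).1.mulVec (Φ n x k s) else Φ n x k s with hΦ'
  have hcl : ∀ (Φ : CleanFamily X M m Z Key Sel A.E) (b : Bits DW),
      b t.tgt = true → slice (commWires X M m Z Key Sel Anc) b (clean Φ) = 0 := by
    intro Φ b hb
    rw [slice_clean, if_neg]
    intro h
    have := h (.inr (.inr ()))
    rw [show b (.inr (.inr (.inr (.inr (.inr (.inr (.inr ()))))))) = b t.tgt from rfl, hb] at this
    exact Bool.noConfusion this
  have hev : ∀ (Φ : CleanFamily X M m Z Key Sel A.E) (p : Bits DW × A.E),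
      clean Φ p = slice (commWires X M m Z Key Sel Anc) p.1 (clean Φ)
        (p.1 ∘ commWires X M m Z Key Sel Anc, p.2) := fun Φ p => (slice_eval _ _ p).symm
  have htgt : t.tgt ∉ Set.range (commWires X M m Z Key Sel Anc) :=
    notMem_commWires fun w h => by simp [ht, controlToggle] at h
  have hflip : ∀ (b : Bits DW) (c : Bits (QueryComm X M m Z)),
      t.flip (Function.extend (commWires X M m Z Key Sel Anc) c b)
        = Function.extend (commWires X M m Z Key Sel Anc) c (t.flip b) := by
    intro b c
    have hfn : t.fn (Function.extend (commWires X M m Z Key Sel Anc) c b) = t.fn b := by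
      refine t.fn_congr _ _ fun v hv => extend_off (notMem_commWires ?_)
      obtain ⟨s, -, rfl⟩ := Finset.mem_image.1 hv
      intro w h
      simp at h
    funext v
    by_cases hv : v = t.tgt
    · subst hv
      rw [t.flip_tgt, extend_off htgt, extend_off htgt, t.flip_tgt, hfn]
    · rw [t.flip_of_ne _ hv]
      by_cases hv' : v ∈ Set.range (commWires X M m Z Key Sel Anc)
      · obtain ⟨w, rfl⟩ := hv'
        rw [(commWires X M m Z Key Sel Anc).injective.extend_apply,
          (commWires X M m Z Key Sel Anc).injective.extend_apply]
      · rw [extend_off hv', extend_off hv', t.flip_of_ne _ hv]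
  -- the call has been made if the selector satisfies `cond`
  have key : t.gate.oper.mulVec ((sel t.tgt (ext (commWires X M m Z Key Sel Anc)
      (A.callOper j false)) 1).mulVec (t.gate.oper.mulVec (clean Φ))) = clean Φ' := by
    funext p
    rw [Toggle.gate_mulVec, sel_mulVec, Matrix.one_mulVec, ext_mulVec, Toggle.gate_mulVec]
    have hsl : slice (commWires X M m Z Key Sel Anc) (t.flip p.1) (t.gate.oper.mulVec (clean Φ))
        = slice (commWires X M m Z Key Sel Anc) p.1 (clean Φ) := by
      funext r
      rw [slice, Toggle.gate_mulVec, hflip, t.flip_flip]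
      rfl
    have hcomm : t.flip p.1 ∘ commWires X M m Z Key Sel Anc = p.1 ∘ commWires X M m Z Key Sel Anc :=
      funext fun w => t.flip_of_ne p.1 fun h => htgt ⟨w, h⟩
    simp only [hsl, hcomm, t.flip_flip]
    rw [hev Φ', t.flip_tgt]
    have hfn : t.fn p.1 = cond fun s => p.1 (.inr (.inr (.inr (.inr (.inl s))))) := rfl
    cases hp : p.1 t.tgt
    · rw [slice_clean, Bool.false_xor, slice_clean]
      have hcall : A.callOper j false = (A.step j).1 := rfl
      cases hc : cond fun s => p.1 (.inr (.inr (.inr (.inr (.inl s)))))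
      · rw [hfn, hc, if_neg Bool.false_ne_true, hev Φ, slice_clean]
        simp only [hΦ', hc, cond_false]
      · rw [hfn, hc, if_pos rfl, hcall]
        simp only [hΦ', hc, cond_true]
        split_ifs
        · rfl
        · rw [Matrix.mulVec_zero]
    · rw [hcl Φ' _ hp, hcl Φ _ hp, hev Φ, hcl Φ _ hp, Matrix.mulVec_zero, ite_self]
  rw [oper_stepBlock, ← Matrix.mulVec_mulVec, ← Matrix.mulVec_mulVec, ← Matrix.mulVec_mulVec, ← ht, key]
  -- the inverse call is not made
  funext p
  rw [sel_mulVec, Matrix.one_mulVec, ext_mulVec]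
  cases hp : p.1 t.tgt
  · rw [if_neg Bool.false_ne_true]
  · rw [if_pos rfl, hev, hcl _ _ hp, Matrix.mulVec_zero]

/-- Conditional queries and calls, for all rounds. -/
def rounds (h : HashScheme (X ⊕ M) Key Anc m) (cond mode : Fin q → Bits Sel → Bool) :
    CProgram (QueryComm X M m Z) DW q :=
  (List.finRange q).flatMap fun j =>
    queryBlock h (cond j) (mode j) ++ stepBlock X M m Z Key Anc (cond j) j

/-- The run of an adversary, restricted to the rounds `c`; the hash function may change. -/
def runRounds (A : Adversary (QueryComm X M m Z) q) (G : Fin q → Bits (X ⊕ M) → BitString m)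
    (c : Fin q → Bool) (L : List (Fin q)) (ψ : Bits (QueryComm X M m Z) × A.E → ℂ) :
    Bits (QueryComm X M m Z) × A.E → ℂ :=
  L.foldl (fun ψ j => bif c j then (A.step j).1.mulVec (queryFn (G j) ψ) else ψ) ψ

/-- With its toggles left out, each query and each call is followed by its inverse. -/
theorem off_rounds (A : Adversary (QueryComm X M m Z) q) (h : HashScheme (X ⊕ M) Key Anc m)
    (cond mode : Fin q → Bits Sel → Bool) :
    Program.oper A (CProgram.off (rounds h cond mode : CProgram _ DW q)) = 1 := by
  unfold rounds
  induction List.finRange q with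
  | nil => rfl
  | cons j L ih =>
    rw [List.flatMap_cons, CProgram.off_append, CProgram.off_append, Program.oper_append, ih,
      Program.oper_append, off_queryBlock, off_stepBlock, one_mul, one_mul]

/-- For each value of the key and the selector, the rounds act as a run of the adversary with the
corresponding hash function. -/
theorem rounds_mulVec (A : Adversary (QueryComm X M m Z) q) (h : HashScheme (X ⊕ M) Key Anc m)
    (cond mode : Fin q → Bits Sel → Bool) (Φ : CleanFamily X M m Z Key Sel A.E) :
    (Program.oper A (CProgram.plain (rounds h cond mode : CProgram _ DW q))).mulVec (clean Φ)
      = clean fun n x k s => runRounds A (fun j => reprogrammed (h.fn k) (mode j s) n x)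
          (fun j => cond j s) (List.finRange q) (Φ n x k s) := by
  unfold rounds
  induction List.finRange q generalizing Φ with
  | nil => exact Matrix.one_mulVec _
  | cons j L ih =>
    rw [List.flatMap_cons, CProgram.plain_append, CProgram.plain_append, Program.oper_append,
      Program.oper_append, ← Matrix.mulVec_mulVec, ← Matrix.mulVec_mulVec, queryBlock_mulVec,
      stepBlock_mulVec, ih]
    congr 1
    funext n x k s
    unfold runRounds
    rw [List.foldl_cons]
    cases hc : cond j s <;> simp only [hc, cond_true, cond_false]

/-- The output of the adversary's query register is copied to the instance register and the message
register. -/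
def outputToggle (Z Key Sel Anc : Type) [DecidableEq Z] [DecidableEq Key] [DecidableEq Sel]
    [DecidableEq Anc] (m : ℕ) : X ⊕ M → Toggle (DerivedWires X M m Z Key Sel Anc)
  | .inl x => copyToggle (.inr (.inl (.inl (.inl x)))) (.inr (.inr (.inl x))) (by simp)
  | .inr a => copyToggle (.inr (.inl (.inl (.inr a)))) (.inl (.inl a)) (by simp)

theorem outputToggle_mulVec (Φ : CleanFamily X M m Z Key Sel E) :
    (toggleCircuit (familyToggles (outputToggle (X := X) (M := M) Z Key Sel Anc m))).oper.mulVec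
        (clean Φ)
      = clean fun n x k s p => Φ
          (fun v => xor (n v) (Sum.elim (fun a => p.1 (.inl (.inr a))) (zeros _) v))
          (fun i => xor (x i) (p.1 (.inl (.inl i)))) k s p := by
  have hinj : Function.Injective
      fun i => (outputToggle (X := X) (M := M) Z Key Sel Anc m i).tgt := by
    rintro (i | i) (j | j) h <;> simp_all [outputToggle, copyToggle]
  have hsupp : ∀ i j, (outputToggle (X := X) (M := M) Z Key Sel Anc m i).tgt
      ∉ (outputToggle (X := X) (M := M) Z Key Sel Anc m j).supp := by
    rintro (i | i) (j | j) <;> simp [outputToggle, copyToggle]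
  funext p
  rw [family_mulVec _ hinj hsupp]
  obtain ⟨h1, h2⟩ := runToggles_family _ hinj hsupp p.1
  have e1 : ∀ x, runToggles (familyToggles (outputToggle (X := X) (M := M) Z Key Sel Anc m)) p.1
      (.inr (.inr (.inl x))) = xor (p.1 (.inr (.inr (.inl x)))) (p.1 (.inr (.inl (.inl (.inl x))))) :=
    fun x => h1 (.inl x)
  have e2 : ∀ a, runToggles (familyToggles (outputToggle (X := X) (M := M) Z Key Sel Anc m)) p.1
      (.inl (.inl a)) = xor (p.1 (.inl (.inl a))) (p.1 (.inr (.inl (.inl (.inr a))))) :=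
    fun a => h1 (.inr a)
  have e3 : ∀ v, runToggles (familyToggles (outputToggle (X := X) (M := M) Z Key Sel Anc m)) p.1
      (.inr (.inr (.inr v))) = p.1 (.inr (.inr (.inr v))) := fun v =>
    h2 _ (by rintro (i | i) <;> simp [outputToggle, copyToggle])
  have e4 : ∀ v, runToggles (familyToggles (outputToggle (X := X) (M := M) Z Key Sel Anc m)) p.1
      (.inl (.inr v)) = p.1 (.inl (.inr v)) := fun v =>
    h2 _ (by rintro (i | i) <;> simp [outputToggle, copyToggle])
  have e5 : ∀ v, runToggles (familyToggles (outputToggle (X := X) (M := M) Z Key Sel Anc m)) p.1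
      (.inr (.inl v)) = p.1 (.inr (.inl v)) := fun v =>
    h2 _ (by rintro (i | i) <;> simp [outputToggle, copyToggle])
  have e6 : (fun v => runToggles (familyToggles (outputToggle (X := X) (M := M) Z Key Sel Anc m)) p.1
      (.inl v)) = fun v => xor (p.1 (.inl v))
        (Sum.elim (fun a => p.1 (.inr (.inl (.inl (.inr a))))) (zeros _) v) := by
    funext v
    rcases v with v | v
    · exact e2 v
    · exact (e4 v).trans (Bool.xor_false _).symm
  simp only [clean, e1, e3, e5, e6]

/-- The adversary's response is copied to the response register. -/
def responseToggle (X M Key Sel Anc : Type) [Fintype X] [Fintype M] [DecidableEq X] [DecidableEq M]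
    [DecidableEq Key] [DecidableEq Sel] [DecidableEq Anc] (m : ℕ) (z : Z) :
    Toggle (DerivedWires X M m Z Key Sel Anc) :=
  copyToggle (.inr (.inl (.inr (.inr z)))) (.inl (.inr (.inr z))) (by simp)

theorem responseToggle_mulVec (Φ : CleanFamily X M m Z Key Sel E) :
    (toggleCircuit (familyToggles (responseToggle (Z := Z) X M Key Sel Anc m))).oper.mulVec (clean Φ)
      = clean fun n x k s p => Φ
          (fun v => xor (n v) (Sum.elim (zeros _) (Sum.elim (zeros _) fun z => p.1 (.inr (.inr z))) v))
          x k s p := by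
  have hinj : Function.Injective
      fun i => (responseToggle (Z := Z) X M Key Sel Anc m i).tgt := by
    intro i j h
    simpa [responseToggle, copyToggle] using h
  have hsupp : ∀ i j, (responseToggle (Z := Z) X M Key Sel Anc m i).tgt
      ∉ (responseToggle (Z := Z) X M Key Sel Anc m j).supp := by
    intro i j
    simp [responseToggle, copyToggle]
  funext p
  rw [family_mulVec _ hinj hsupp]
  obtain ⟨h1, h2⟩ := runToggles_family _ hinj hsupp p.1
  have e1 : ∀ z, runToggles (familyToggles (responseToggle (Z := Z) X M Key Sel Anc m)) p.1
      (.inl (.inr (.inr z))) = xor (p.1 (.inl (.inr (.inr z)))) (p.1 (.inr (.inl (.inr (.inr z))))) :=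
    fun z => h1 z
  have e3 : ∀ v, runToggles (familyToggles (responseToggle (Z := Z) X M Key Sel Anc m)) p.1
      (.inr v) = p.1 (.inr v) := fun v => h2 _ fun i => by simp [responseToggle, copyToggle]
  have e6 : (fun v => runToggles (familyToggles (responseToggle (Z := Z) X M Key Sel Anc m)) p.1
      (.inl v)) = fun v => xor (p.1 (.inl v)) (Sum.elim (zeros _) (Sum.elim (zeros _)
        fun z => p.1 (.inr (.inl (.inr (.inr z))))) v) := by
    funext v
    rcases v with v | v | v
    · exact (h2 _ fun i => by simp [responseToggle, copyToggle]).trans (Bool.xor_false _).symm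
    · exact (h2 _ fun i => by simp [responseToggle, copyToggle]).trans (Bool.xor_false _).symm
    · exact e1 v
  simp only [clean, e3, e6]

/-- The wires that are put in a uniform superposition: the key and the selector. -/
def randomWires (X M : Type) (m : ℕ) (Z Key Sel Anc : Type) [Fintype X] [Fintype M] :
    Key ⊕ Sel ↪ DerivedWires X M m Z Key Sel Anc where
  toFun
    | .inl k => .inr (.inr (.inr (.inl k)))
    | .inr s => .inr (.inr (.inr (.inr (.inl s))))
  inj' v v' h := by
    rcases v with v | v <;> rcases v' with v' | v' <;> simp_all

/-- Preparation of a uniformly random key and a uniformly random selector. -/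
def randomCircuit (X M : Type) (m : ℕ) (Z Key Sel Anc : Type) [Fintype X] [Fintype M] [Fintype Key]
    [Fintype Sel] : Circuit (DerivedWires X M m Z Key Sel Anc) :=
  (((Finset.univ : Finset (Key ⊕ Sel)).toList.map (randomWires X M m Z Key Sel Anc))).map hadamard

open Classical in
theorem randomCircuit_mulVec (ψ : Bits (QueryComm X M m Z) × E → ℂ) :
    (Circuit.oper (randomCircuit X M m Z Key Sel Anc)).mulVec
        (clean fun n x k s => if n = zeros _ ∧ x = zeros _ ∧ k = zeros _ ∧ s = zeros _ then ψ else 0)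
      = clean (Anc := Anc) fun n x _ _ => if n = zeros _ ∧ x = zeros _ then
          (((Real.sqrt 2)⁻¹ ^ (Fintype.card Key + Fintype.card Sel) : ℝ) : ℂ) • ψ else 0 := by
  set L := (Finset.univ : Finset (Key ⊕ Sel)).toList.map (randomWires X M m Z Key Sel Anc) with hL
  have hnd : L.Nodup := (Finset.nodup_toList _).map (randomWires X M m Z Key Sel Anc).injective
  have hlen : L.length = Fintype.card Key + Fintype.card Sel := by
    rw [hL, List.length_map, Finset.length_toList, Finset.card_univ, Fintype.card_sum]
  have hmem : ∀ v, v ∈ L ↔ v ∈ Set.range (randomWires X M m Z Key Sel Anc) := by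
    intro v
    simp [hL]
  funext p
  rw [randomCircuit, ← hL, hadamards_mulVec L hnd, hlen]
  · have h1 : ∀ v, ((.inr (.inr (.inr (.inl v))) : DW) ∈ L) = True := fun v =>
      eq_true ((hmem _).2 ⟨.inl v, rfl⟩)
    have h2 : ∀ v, ((.inr (.inr (.inr (.inr (.inl v)))) : DW) ∈ L) = True := fun v =>
      eq_true ((hmem _).2 ⟨.inr v, rfl⟩)
    have h3 : ∀ v, ((.inl v : DW) ∈ L) = False := fun v => eq_false fun h => by
      obtain ⟨i | i, hi⟩ := (hmem _).1 h <;> exact Sum.inr_ne_inl hi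
    have h4 : ∀ v, ((.inr (.inl v) : DW) ∈ L) = False := fun v => eq_false fun h => by
      obtain ⟨i | i, hi⟩ := (hmem _).1 h <;> exact Sum.inr_ne_inl (Sum.inr.inj hi)
    have h5 : ∀ v, ((.inr (.inr (.inl v)) : DW) ∈ L) = False := fun v => eq_false fun h => by
      obtain ⟨i | i, hi⟩ := (hmem _).1 h <;> exact Sum.inr_ne_inl (Sum.inr.inj (Sum.inr.inj hi))
    have h6 : ∀ v, ((.inr (.inr (.inr (.inr (.inr v)))) : DW) ∈ L) = False := fun v =>
      eq_false fun h => by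
        obtain ⟨i | i, hi⟩ := (hmem _).1 h
        · exact Sum.inl_ne_inr (Sum.inr.inj (Sum.inr.inj (Sum.inr.inj hi)))
        · exact Sum.inl_ne_inr (Sum.inr.inj (Sum.inr.inj (Sum.inr.inj (Sum.inr.inj hi))))
    simp only [clean, h1, h2, h3, h4, h5, h6, if_true, if_false]
    have e1 : (fun _ : Key => false) = zeros Key := rfl
    have e2 : (fun _ : Sel => false) = zeros Sel := rfl
    rw [e1, e2]
    simp only [and_true]
    split_ifs
    · rfl
    · exact mul_zero _
    · exact mul_zero _
  · intro p w hw hp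
    obtain ⟨v, rfl⟩ := (hmem w).1 hw
    unfold clean
    split_ifs with h
    · rcases v with v | v
      · refine congrFun (if_neg ?_) _
        rintro ⟨-, -, hk, -⟩
        exact Bool.noConfusion (hp.symm.trans (congrFun hk v))
      · refine congrFun (if_neg ?_) _
        rintro ⟨-, -, -, hs⟩
        exact Bool.noConfusion (hp.symm.trans (congrFun hs v))
    · rfl

end DerivedProver

/-! ### The stages of the derived prover -/

section DerivedProver

variable {X M Z Key Sel Anc E : Type} [Fintype X] [DecidableEq X] [Fintype M] [DecidableEq M]
  [Fintype Z] [DecidableEq Z] [Fintype Key] [DecidableEq Key] [Fintype Sel] [DecidableEq Sel]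
  [Fintype Anc] [DecidableEq Anc] [Fintype E] [DecidableEq E] {m q : ℕ}

local notation "DW" => DerivedWires X M m Z Key Sel Anc

/-- The preparation of the derived prover: with a random key and a random selector, run the
adversary up to the selected query, whose input is the instance and the first message. -/
def prepProgram (h : HashScheme (X ⊕ M) Key Anc m) (idx : Bits Sel → ℕ) :
    Program (QueryComm X M m Z) DW q :=
  Program.ofCircuit (randomCircuit X M m Z Key Sel Anc) ++
    CProgram.plain (rounds h (fun j s => decide (j.1 < idx s)) fun _ _ => false) ++
    Program.ofCircuit (toggleCircuit (familyToggles (outputToggle (X := X) (M := M) Z Key Sel Anc m)))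

/-- Whether the hash function is reprogrammed in a given round after the selected query. The
selected query itself is answered with the reprogrammed function if `flag` does not hold. -/
def reprogramMode (idx : Bits Sel → ℕ) (flag : Bits Sel → Bool) (j : Fin q) (s : Bits Sel) : Bool :=
  decide (idx s < j.1) || (decide (idx s = j.1) && !flag s)

/-- The second stage of the derived prover: run the adversary from the selected query on, with the
hash function reprogrammed to the challenge. -/
def respondProgram (h : HashScheme (X ⊕ M) Key Anc m) (idx : Bits Sel → ℕ) (flag : Bits Sel → Bool) :
    CProgram (QueryComm X M m Z) DW q :=
  rounds h (fun j s => decide (idx s ≤ j.1)) (reprogramMode idx flag) ++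
    CProgram.ofToggles (familyToggles (responseToggle (Z := Z) X M Key Sel Anc m))

theorem off_respondProgram (A : Adversary (QueryComm X M m Z) q) (h : HashScheme (X ⊕ M) Key Anc m)
    (idx : Bits Sel → ℕ) (flag : Bits Sel → Bool) :
    Program.oper A (CProgram.off (respondProgram h idx flag : CProgram _ DW q)) = 1 := by
  rw [respondProgram, CProgram.off_append, CProgram.off_ofToggles, List.append_nil, off_rounds]

theorem keeps_toggleCircuit {W : Type} [Fintype W] [DecidableEq W] (l : List (Toggle W)) {c : W}
    (h : ∀ t ∈ l, c ≠ t.tgt) : Keeps c ((toggleCircuit l).oper : Oper W E) := by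
  refine Keeps.seqProd fun M hM => ?_
  rw [toggleCircuit, List.map_map] at hM
  obtain ⟨t, ht, rfl⟩ := List.mem_map.1 hM
  exact t.keeps_gate (h t ht)

theorem keeps_lookupCircuit {Q : Type} [Fintype Q] [DecidableEq Q] (h : HashScheme Q Key Anc m) (v : Q) :
    Keeps (.inr (.inl v)) ((lookupCircuit h).oper : Oper (LookupWires Q Key Anc) E) := by
  rw [lookupCircuit, Circuit.append_oper, Circuit.map_oper, Circuit.map_oper]
  refine Keeps.mul ?_ (Keeps.ext_of_notMem ?_ _)
  · refine Keeps.ext (c := (.inr (.inl v) : EqWires Q)) (lookupEqWires Q Key Anc)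
      (keeps_toggleCircuit (eqToggles Q) ?_)
    intro t ht htv
    rcases List.mem_cons.1 ht with rfl | ht
    · exact Sum.inl_ne_inr (Sum.inr.inj htv)
    · obtain ⟨s, hs⟩ := mem_upTo ht
      rw [List.mem_singleton] at hs
      subst hs
      exact Sum.inl_ne_inr (Sum.inr.inj htv)
  · rintro ⟨w | w | w, hw⟩
    · exact Sum.inl_ne_inr hw
    · exact Sum.inr_ne_inl (Sum.inr.inj hw)
    · exact Sum.inr_ne_inl (Sum.inr.inj hw)

theorem keeps_respondProgram (A : Adversary (QueryComm X M m Z) q)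
    (h : HashScheme (X ⊕ M) Key Anc m) (idx : Bits Sel → ℕ) (flag : Bits Sel → Bool) (x : X) :
    Keeps (.inr (.inr (.inl x)))
      (Program.oper A (CProgram.plain (respondProgram h idx flag : CProgram _ DW q))) := by
  have hlook : Keeps (.inr (.inr (.inl x)))
      (((lookupCircuit h).map (lookupWires X M m Z Key Sel Anc)).oper : Oper DW A.E) := by
    rw [Circuit.map_oper]
    exact Keeps.ext (c := (.inr (.inl (.inl x)) : LookupWires (X ⊕ M) Key Anc))
      (lookupWires X M m Z Key Sel Anc) (keeps_lookupCircuit h _)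
  have hcomm : (.inr (.inr (.inl x)) : DW) ∉ Set.range (commWires X M m Z Key Sel Anc) :=
    notMem_commWires fun w hw => by simp at hw
  have hrounds : ∀ cond mode, Keeps (.inr (.inr (.inl x)))
      (Program.oper A (CProgram.plain (rounds h cond mode : CProgram _ DW q))) := by
    intro cond mode
    unfold rounds
    induction List.finRange q with
    | nil => exact Keeps.one _
    | cons j L ih =>
      rw [List.flatMap_cons, CProgram.plain_append, CProgram.plain_append, Program.oper_append,
        Program.oper_append, oper_queryBlock, oper_stepBlock]
      have ht : Keeps (.inr (.inr (.inl x)))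
          ((controlToggle (Sel := Sel) X M m Z Key Anc (cond j)).gate.oper : Oper DW A.E) :=
        Toggle.keeps_gate _ (by simp [controlToggle])
      refine ih.mul (Keeps.mul ?_ ?_)
      · exact ((Keeps.ext_of_notMem hcomm _).sel (Keeps.one _)).mul
          (ht.mul (((Keeps.ext_of_notMem hcomm _).sel (Keeps.one _)).mul ht))
      · refine hlook.conjTranspose.mul ((keeps_toggleCircuit _ ?_).mul hlook)
        intro t ht htv
        obtain ⟨i, -, rfl⟩ := List.mem_map.1 ht
        simp [answerToggle] at htv
  rw [respondProgram, CProgram.plain_append, Program.oper_append, oper_ofToggles]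
  refine (keeps_toggleCircuit _ ?_).mul (hrounds _ _)
  intro t ht htv
  obtain ⟨i, -, rfl⟩ := List.mem_map.1 ht
  simp [responseToggle, copyToggle] at htv

theorem queryFn_smul (H : Bits (X ⊕ M) → BitString m) (z : ℂ) (ψ : Bits (QueryComm X M m Z) × E → ℂ) :
    queryFn H (z • ψ) = z • queryFn H ψ := rfl

theorem runRounds_smul (A : Adversary (QueryComm X M m Z) q)
    (G : Fin q → Bits (X ⊕ M) → BitString m) (c : Fin q → Bool) (L : List (Fin q)) (z : ℂ)
    (ψ : Bits (QueryComm X M m Z) × A.E → ℂ) :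
    runRounds A G c L (z • ψ) = z • runRounds A G c L ψ := by
  induction L generalizing ψ with
  | nil => rfl
  | cons j L ih =>
    have h1 : ∀ ψ, runRounds A G c (j :: L) ψ = runRounds A G c L
      (bif c j then (A.step j).1.mulVec (queryFn (G j) ψ) else ψ) := fun _ => rfl
    rw [h1, h1, ← ih]
    cases c j
    · rfl
    · rw [cond_true, cond_true, queryFn_smul, Matrix.mulVec_smul]

open Classical in
theorem startState_eq (A : Adversary (QueryComm X M m Z) q) :
    startState (ProverComm M m Z) X (Key ⊕ Sel ⊕ ProverAnc X M Anc) A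
      = clean fun n x k s =>
        if n = zeros _ ∧ x = zeros _ ∧ k = zeros _ ∧ s = zeros _ then A.init else 0 := by
  funext p
  unfold startState clean
  by_cases h : ∀ v, p.1 (.inr (.inr (.inr (.inr (.inr v))))) = false
  · rw [if_pos h]
    have : ((∀ v, p.1 (.inl v) = false) ∧ ∀ v, p.1 (.inr (.inr v)) = false) ↔
        (fun v => p.1 (.inl v)) = zeros _ ∧ (fun v => p.1 (.inr (.inr (.inl v)))) = zeros _ ∧
        (fun v => p.1 (.inr (.inr (.inr (.inl v))))) = zeros _ ∧
        (fun v => p.1 (.inr (.inr (.inr (.inr (.inl v)))))) = zeros _ := by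
      simp only [funext_iff, zeros, Sum.forall] at h ⊢
      tauto
    by_cases h' : (∀ v, p.1 (.inl v) = false) ∧ ∀ v, p.1 (.inr (.inr v)) = false
    · rw [if_pos h']
      exact (congrFun (if_pos (this.1 h')) _).symm
    · rw [if_neg h']
      beta_reduce
      rw [if_neg fun h'' => h' (this.2 h'')]
      rfl
  · rw [if_neg h, if_neg]
    exact fun h' => h fun v => h'.2 _

/-- The amplitude of each value of the key and the selector. -/
def randomAmp (Key Sel : Type) [Fintype Key] [Fintype Sel] : ℝ :=
  (Real.sqrt 2)⁻¹ ^ (Fintype.card Key + Fintype.card Sel)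

theorem randomAmp_sq : randomAmp Key Sel ^ 2 = (1 / 2) ^ (Fintype.card Key + Fintype.card Sel) := by
  rw [randomAmp, ← pow_mul, mul_comm, pow_mul, inv_pow, Real.sq_sqrt (by norm_num), one_div]

theorem reprogrammed_false (H : Bits (X ⊕ M) → BitString m) (n : Bits (ProverComm M m Z))
    (x : Bits X) : reprogrammed H false n x = H := by
  funext u
  exact if_neg fun h => Bool.noConfusion h.1

/-- The state of the adversary at the selected query. -/
def selectedState (A : Adversary (QueryComm X M m Z) q) (H : Bits (X ⊕ M) → BitString m) (i : ℕ) :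
    Bits (QueryComm X M m Z) × A.E → ℂ :=
  runRounds A (fun _ => H) (fun j => decide (j.1 < i)) (List.finRange q) A.init

open Classical in
/-- The state after the preparation: for each key and each selector, the state of the adversary at
the selected query, with a copy of the query in the wires of the instance and the first message. -/
theorem prepProgram_mulVec (A : Adversary (QueryComm X M m Z) q) (h : HashScheme (X ⊕ M) Key Anc m)
    (idx : Bits Sel → ℕ) :
    (Program.oper A (prepProgram h idx)).mulVec
        (startState (ProverComm M m Z) X (Key ⊕ Sel ⊕ ProverAnc X M Anc) A)
      = clean fun n x k s p =>
        (if n = Sum.elim (fun a => p.1 (.inl (.inr a))) (zeros _) ∧ x = fun i => p.1 (.inl (.inl i)) then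
          (randomAmp Key Sel : ℂ) else 0) * selectedState A (h.fn k) (idx s) p := by
  rw [prepProgram, Program.oper_append, Program.oper_append, Program.oper_ofCircuit,
    Program.oper_ofCircuit, ← Matrix.mulVec_mulVec, ← Matrix.mulVec_mulVec, startState_eq,
    randomCircuit_mulVec]
  have e1 : (fun (n : Bits (ProverComm M m Z)) (x : Bits X) (_ : Bits Key) (_ : Bits Sel) =>
      if n = zeros _ ∧ x = zeros _ then
        (((Real.sqrt 2)⁻¹ ^ (Fintype.card Key + Fintype.card Sel) : ℝ) : ℂ) • A.init else 0)
      = fun n x _ _ => (if n = zeros _ ∧ x = zeros _ then (randomAmp Key Sel : ℂ) else 0) • A.init := by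
    funext n x k s
    split_ifs
    · rfl
    · rw [zero_smul]
  rw [e1, rounds_mulVec]
  simp only [reprogrammed_false, runRounds_smul]
  rw [outputToggle_mulVec]
  congr 1
  funext n x k s p
  rw [Pi.smul_apply, smul_eq_mul, selectedState]
  refine congrArg (· * _) (if_congr (and_congr ?_ ?_) rfl rfl)
  · rw [funext_iff, funext_iff]
    refine forall_congr' fun v => ?_
    simp only [zeros]
    exact bne_eq_false_iff_eq
  · rw [funext_iff, funext_iff]
    exact forall_congr' fun v => bne_eq_false_iff_eq

/-- Delivery of a challenge, on the wires of the derived prover. -/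
def deliverTo (X M : Type) [Fintype X] [Fintype M] (Z Key Sel Anc : Type) (c : BitString m)
    (ψ : Bits (DerivedWires X M m Z Key Sel Anc) × E → ℂ) :
    Bits (DerivedWires X M m Z Key Sel Anc) × E → ℂ := fun p =>
  ψ (fun v => xor (p.1 v) (Sum.elim (Sum.elim (zeros _) (Sum.elim c (zeros _))) (zeros _) v), p.2)

/-- The second stage of the adversary: after the measurement of the selected query with result
`(x, a)`, it is run with the hash function reprogrammed to `c`. -/
def measuredRun (A : Adversary (QueryComm X M m Z) q) (H : Bits (X ⊕ M) → BitString m) (i : ℕ)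
    (f : Bool) (x : Bits X) (a : Bits M) (c : BitString m) :
    Bits (QueryComm X M m Z) × A.E → ℂ :=
  runRounds A (fun j => reprogrammed (Z := Z) H (decide (i < j.1) || (decide (i = j.1) && !f))
      (Sum.elim a (Sum.elim c (zeros _))) x)
    (fun j => decide (i ≤ j.1)) (List.finRange q)
    ({p | (fun u => p.1 (.inl u)) = Sum.elim x a}.indicator (selectedState A H i))

open Classical in
/-- The state of the derived prover at its end, up to normalisation: for each key and each selector,
the measured run of the adversary. -/
theorem respondProgram_mulVec (A : Adversary (QueryComm X M m Z) q)
    (h : HashScheme (X ⊕ M) Key Anc m) (idx : Bits Sel → ℕ) (flag : Bits Sel → Bool) (x : Bits X)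
    (a : Bits M) (c : BitString m) :
    (Program.oper A (CProgram.plain (respondProgram h idx flag))).mulVec
      (deliverTo X M Z Key Sel Anc c ({p : Bits DW × A.E | (fun i => p.1 (.inl (.inl i))) = a}.indicator
        (restrict x ((Program.oper A (prepProgram h idx)).mulVec
          (startState (ProverComm M m Z) X (Key ⊕ Sel ⊕ ProverAnc X M Anc) A)))))
      = clean fun n x' k s p =>
        (if n = Sum.elim a (Sum.elim c fun z => p.1 (.inr (.inr z))) ∧ x' = x then
          (randomAmp Key Sel : ℂ) else 0) * measuredRun A (h.fn k) (idx s) (flag s) x a c p := by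
  have e1 : deliverTo X M Z Key Sel Anc c
        ({p : Bits DW × A.E | (fun i => p.1 (.inl (.inl i))) = a}.indicator
        (restrict x ((Program.oper A (prepProgram h idx)).mulVec
          (startState (ProverComm M m Z) X (Key ⊕ Sel ⊕ ProverAnc X M Anc) A))))
      = clean fun n x' k s =>
        (if n = Sum.elim a (Sum.elim c (zeros _)) ∧ x' = x then (randomAmp Key Sel : ℂ) else 0) •
          {p | (fun u => p.1 (.inl u)) = Sum.elim x a}.indicator (selectedState A (h.fn k) (idx s)) := by
    rw [prepProgram_mulVec]
    funext p
    have hheld : ∀ b : Bits DW, heldInstance b = fun i => b (.inr (.inr (.inl i))) := fun _ => rfl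
    simp only [deliverTo, restrict, Set.indicator_apply, Set.mem_ofPred_eq, hheld, clean,
      Pi.smul_apply, smul_eq_mul, Sum.elim_inr, Sum.elim_inl, zeros, Bool.xor_false]
    by_cases h0 : ∀ v, p.1 (.inr (.inr (.inr (.inr (.inr v))))) = false
    swap
    · simp only [h0, if_false, ite_self]
    simp only [h0, implies_true, if_true]
    by_cases ha : (fun i => p.1 (.inl (.inl i))) = a
    swap
    · rw [if_neg ha, if_neg, zero_mul]
      rintro ⟨h1, -⟩
      exact ha (funext fun i => congrFun h1 (.inl i))
    by_cases hx : (fun i => p.1 (.inr (.inr (.inl i)))) = x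
    swap
    · rw [if_neg hx, ite_self, if_neg fun h => hx h.2, zero_mul]
    rw [if_pos ha, if_pos hx]
    by_cases hu : (fun u => p.1 (.inr (.inl (.inl u)))) = Sum.elim x a
    · rw [if_pos hu]
      refine congrArg (· * _) (if_congr ?_ rfl rfl)
      have hu1 : ∀ i, p.1 (.inr (.inl (.inl (.inr i)))) = a i := fun i => congrFun hu (.inr i)
      have hu2 : ∀ i, p.1 (.inr (.inl (.inl (.inl i)))) = x i := fun i => congrFun hu (.inl i)
      have ha' : ∀ i, p.1 (.inl (.inl i)) = a i := congrFun ha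
      simp only [hu1, hu2]
      refine and_congr ?_ (iff_of_eq rfl)
      rw [funext_iff, funext_iff]
      constructor
      · rintro h (v | v | v)
        · exact ha' v
        · have := h (.inr (.inl v))
          exact bne_eq_false_iff_eq.1 this
        · have := h (.inr (.inr v))
          exact (Bool.xor_false _).symm.trans this
      · rintro h (v | v | v)
        · exact (Bool.xor_false _).trans (ha' v)
        · exact bne_eq_false_iff_eq.2 (h (.inr (.inl v)))
        · exact (Bool.xor_false _).trans (h (.inr (.inr v)))
    · rw [if_neg hu, mul_zero, if_neg, zero_mul]
      rintro ⟨h1, h2⟩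
      refine hu (funext fun u => ?_)
      rcases u with u | u
      · exact (congrFun h2 u).symm.trans (congrFun hx u)
      · exact ((congrFun h1 (.inl u)).symm.trans (Bool.xor_false _)).trans (congrFun ha u)
  rw [e1, respondProgram, CProgram.plain_append, Program.oper_append, ← Matrix.mulVec_mulVec,
    rounds_mulVec, oper_ofToggles, responseToggle_mulVec]
  simp only [runRounds_smul]
  congr 1
  funext n x' k s p
  rw [Pi.smul_apply, smul_eq_mul]
  have e2 : ((fun v => xor (n v) (Sum.elim (zeros _) (Sum.elim (zeros _) fun z => p.1 (.inr (.inr z))) v))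
      = Sum.elim a (Sum.elim c (zeros _))) ↔ n = Sum.elim a (Sum.elim c fun z => p.1 (.inr (.inr z))) := by
    rw [funext_iff, funext_iff]
    refine forall_congr' ?_
    rintro (v | v | v)
    · exact iff_of_eq (congrArg (· = a v) (Bool.xor_false _))
    · exact iff_of_eq (congrArg (· = c v) (Bool.xor_false _))
    · exact bne_eq_false_iff_eq
  by_cases hc : n = Sum.elim a (Sum.elim c fun z => p.1 (.inr (.inr z))) ∧ x' = x
  · rw [if_pos hc, if_pos ⟨e2.2 hc.1, hc.2⟩, e2.2 hc.1, hc.2]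
    rfl
  · rw [if_neg hc, if_neg fun h => hc ⟨e2.1 h.1, h.2⟩, zero_mul, zero_mul]

open Classical in
/-- A lower bound for the probability that the response of the derived prover lies in `V`. The key,
the selector and the adversary's registers are not measured, so their probabilities add up. -/
theorem sum_measuredRun_le (A : Adversary (QueryComm X M m Z) q) (x : Bits X) (a : Bits M)
    (c : BitString m) (T : Bits Key → Bits Sel → Bits (QueryComm X M m Z) × A.E → ℂ)
    (V : Set (Bits Z)) :
    randomAmp Key Sel ^ 2 * ∑ k, ∑ s, measureProb (T k s) {p | (fun z => p.1 (.inr (.inr z))) ∈ V}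
      ≤ measureProb (clean (Anc := Anc) fun n x' k s p =>
        (if n = Sum.elim a (Sum.elim c fun z => p.1 (.inr (.inr z))) ∧ x' = x then
          (randomAmp Key Sel : ℂ) else 0) * T k s p) {p | (fun z => p.1 (.inl (.inr (.inr z)))) ∈ V} := by
  let f : Bits Key × Bits Sel × (Bits (QueryComm X M m Z) × A.E) ↪ Bits DW × A.E :=
    { toFun := fun r => (Sum.elim (Sum.elim a (Sum.elim c fun z => r.2.2.1 (.inr (.inr z))))
        (Sum.elim r.2.2.1 (Sum.elim x (Sum.elim r.1 (Sum.elim r.2.1 (zeros _))))), r.2.2.2)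
      inj' := by
        rintro ⟨k, s, b, e⟩ ⟨k', s', b', e'⟩ h
        rw [Prod.mk.injEq] at h
        have h1 : k = k' := funext fun v => congrFun h.1 (.inr (.inr (.inr (.inl v))))
        have h2 : s = s' := funext fun v => congrFun h.1 (.inr (.inr (.inr (.inr (.inl v)))))
        have h3 : b = b' := funext fun v => congrFun h.1 (.inr (.inl v))
        have h4 : e = e' := h.2
        rw [h1, h2, h3, h4] }
  unfold measureProb
  rw [← Fintype.sum_prod_type', Finset.mul_sum]
  simp only [Finset.mul_sum]
  rw [← Fintype.sum_prod_type']
  rw [← (Equiv.prodAssoc _ _ _).symm.sum_comp]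
  refine le_trans (le_of_eq ?_) (Finset.sum_le_sum_of_subset_of_nonneg
    (Finset.subset_univ (Finset.univ.map f))
    fun i _ _ => Set.indicator_nonneg (fun _ _ => sq_nonneg _) i)
  rw [Finset.sum_map]
  refine Finset.sum_congr rfl fun r _ => ?_
  obtain ⟨k, s, b, e⟩ := r
  have h1 : clean (Anc := Anc) (fun n x' k s p =>
        (if n = Sum.elim a (Sum.elim c fun z => p.1 (.inr (.inr z))) ∧ x' = x then
          (randomAmp Key Sel : ℂ) else 0) * T k s p) (f (k, s, b, e))
      = randomAmp Key Sel * T k s (b, e) := by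
    refine (if_pos fun _ => rfl).trans ?_
    exact congrArg (· * T k s (b, e)) (if_pos ⟨rfl, rfl⟩)
  simp only [Set.indicator_apply]
  have h2 : f (k, s, b, e) ∈ {p : Bits DW × A.E | (fun z => p.1 (.inl (.inr (.inr z)))) ∈ V} ↔
      (b, e) ∈ {p : Bits (QueryComm X M m Z) × A.E | (fun z => p.1 (.inr (.inr z))) ∈ V} := Iff.rfl
  rw [h1]
  by_cases hV : (b, e) ∈ {p : Bits (QueryComm X M m Z) × A.E | (fun z => p.1 (.inr (.inr z))) ∈ V}
  · rw [if_pos (h2.2 hV), norm_mul, mul_pow, Complex.norm_real, Real.norm_eq_abs, sq_abs]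
    exact congrArg (randomAmp Key Sel ^ 2 * ·) (if_pos hV)
  · rw [if_neg fun h => hV (h2.1 h)]
    refine (congrArg (randomAmp Key Sel ^ 2 * ·) (if_neg hV)).trans (mul_zero _)

end DerivedProver

/-! ### Acceptance of the derived prover -/

section Acceptance

variable (P : SigmaProtocol) {η q : ℕ} {Key Sel Anc : Type} [Fintype Key] [DecidableEq Key]
  [Fintype Sel] [DecidableEq Sel] [Fintype Anc] [DecidableEq Anc]

/-- The derived prover that holds the instance `x`. -/
def derivedProver (A : P.FSAdversary η q)
    (h : HashScheme (Fin (P.instLen η) ⊕ Fin (P.msgLen η)) Key Anc (P.chalLen η))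
    (idx : Bits Sel → ℕ) (flag : Bits Sel → Bool) (x : BitString (P.instLen η)) : P.Prover η :=
  proverAt A (prepProgram h idx) (respondProgram h idx flag) x

/-- The probability that the derived prover holds `x` and is accepted is at least the average
acceptance probability of the measured runs, over the key, the selector and the challenge. -/
theorem acceptProb_derivedProver (A : P.FSAdversary η q)
    (h : HashScheme (Fin (P.instLen η) ⊕ Fin (P.msgLen η)) Key Anc (P.chalLen η))
    (idx : Bits Sel → ℕ) (flag : Bits Sel → Bool) (x : BitString (P.instLen η)) :
    randomAmp Key Sel ^ 2 * (∑ c ∈ P.chal η, ∑ a, ∑ k, ∑ s,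
      measureProb (measuredRun A (h.fn k) (idx s) (flag s) x a c)
        {p | P.verify η x a c fun z => p.1 (.inr (.inr z))}) / (P.chal η).card
      ≤ instProb A (prepProgram (Sel := Sel) h idx) x *
        P.acceptProb (derivedProver P A h idx flag x) x := by
  classical
  rw [SigmaProtocol.acceptProb, mul_div_assoc', Finset.mul_sum, Finset.mul_sum]
  refine div_le_div_of_nonneg_right (Finset.sum_le_sum fun c _ => ?_) (Nat.cast_nonneg _)
  rw [Finset.mul_sum, Finset.mul_sum]
  refine Finset.sum_le_sum fun a _ => ?_
  refine (sum_measuredRun_le (Anc := Anc) A x a c _ {z | P.verify η x a c z}).trans (le_of_eq ?_)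
  rw [← respondProgram_mulVec]
  set Ψ := (Program.oper A (prepProgram h idx)).mulVec
    (startState (P.Wires η) (Fin (P.instLen η))
      (Key ⊕ Sel ⊕ ProverAnc (Fin (P.instLen η)) (Fin (P.msgLen η)) Anc) A) with hΨ
  set U := Program.oper A (CProgram.plain (respondProgram (Z := Fin (P.respLen η)) h idx flag)) with hU
  set χ := normalise (someState (P.Wires η) (Fin (P.instLen η))
    (Key ⊕ Sel ⊕ ProverAnc (Fin (P.instLen η)) (Fin (P.msgLen η)) Anc) A) (restrict x Ψ) with hχ
  have e0 : ((Real.sqrt (instProb A (prepProgram (Sel := Sel) h idx) x) : ℝ) : ℂ) • χ = restrict x Ψ :=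
    sqrt_smul_normalise _ _
  have hstep0 : ((derivedProver P A h idx flag x).step 0).1.mulVec (derivedProver P A h idx flag x).init
      = χ ∘ assocEquiv _ _ A.E := Matrix.one_mulVec _
  have hstep1 : ((derivedProver P A h idx flag x).step 1).1 = absorb U := rfl
  rw [hstep0, hstep1]
  have e1 : P.deliver c ({p : Bits (P.Wires η) × (Bits _ × A.E) | p.1 ∘ Sum.inl = a}.indicator
        (χ ∘ assocEquiv _ _ A.E))
      = deliverTo (Fin (P.instLen η)) (Fin (P.msgLen η)) (Fin (P.respLen η)) Key Sel Anc c
        ({p | (fun i => p.1 (.inl (.inl i))) = a}.indicator χ) ∘ assocEquiv _ _ A.E := by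
    funext p
    simp only [SigmaProtocol.deliver, Function.comp_apply, deliverTo, Set.indicator_apply]
    have h3 : ((fun v => xor (p.1 v) (Sum.elim (zeros _) (Sum.elim c (zeros _)) v), p.2) :
        Bits (P.Wires η) × (Bits _ × A.E)) ∈ {p : Bits (P.Wires η) × (Bits _ × A.E) | p.1 ∘ Sum.inl = a} ↔
        (fun i => xor (p.1 (.inl i)) false) = a := Iff.rfl
    have h4 : assocEquiv _ _ A.E (fun v => xor (p.1 v) (Sum.elim (zeros _) (Sum.elim c (zeros _)) v), p.2)
        = (fun v => xor ((assocEquiv _ _ A.E p).1 v) (Sum.elim (Sum.elim (zeros (Fin (P.msgLen η)))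
          (Sum.elim c (zeros (Fin (P.respLen η))))) (zeros (Inner (P.FSWires η) (Fin (P.instLen η))
          (Key ⊕ Sel ⊕ ProverAnc (Fin (P.instLen η)) (Fin (P.msgLen η)) Anc))) v),
          (assocEquiv _ _ A.E p).2) := by
      refine Prod.ext (funext fun v => ?_) rfl
      rcases v with v | v
      · rfl
      · exact (Bool.xor_false _).symm
    rw [← h4]
    exact if_congr h3 rfl rfl
  have e2 : deliverTo (Fin (P.instLen η)) (Fin (P.msgLen η)) (Fin (P.respLen η)) Key Sel Anc c
        ({p | (fun i => p.1 (.inl (.inl i))) = a}.indicator (restrict x Ψ))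
      = ((Real.sqrt (instProb A (prepProgram (Sel := Sel) h idx) x) : ℝ) : ℂ) •
        deliverTo (Fin (P.instLen η)) (Fin (P.msgLen η)) (Fin (P.respLen η)) Key Sel Anc c
        ({p | (fun i => p.1 (.inl (.inl i))) = a}.indicator χ) := by
    rw [← e0]
    funext p
    simp only [deliverTo, Set.indicator_apply, Pi.smul_apply, smul_eq_mul]
    split_ifs
    · rfl
    · rw [mul_zero]
  refine Eq.trans ?_ (congrArg (fun ψ => _ * measureProb ((absorb U).mulVec ψ) _) e1).symm
  rw [absorb_mulVec, e2, Matrix.mulVec_smul, measureProb_smul, Real.sq_sqrt (instProb_nonneg _ _ _)]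
  refine congrArg _ ?_
  exact (measureProb_comp_equiv (assocEquiv _ _ A.E) _ _).symm

end Acceptance

/-! ### Cost of the extractor -/

section Cost

variable {N W W₁ W₂ : Type} [Fintype N] [DecidableEq N] [Fintype W] [DecidableEq W]
  [Fintype W₁] [DecidableEq W₁] [Fintype W₂] [DecidableEq W₂] {q : ℕ}

/-- A bound on the cost of a controllable instruction, with or without control. -/
def CInstr.bound : CInstr N W q → ℕ
  | .inl i => i.cost
  | .inr t => 4 * 4 ^ (t.supp.card + 1)

/-- A bound on the cost of a controllable program, with or without control. -/
def CProgram.bound (l : CProgram N W q) : ℕ := (List.map CInstr.bound l).sum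

theorem CProgram.plain_cost (l : CProgram N W q) : Program.cost (plain l) ≤ bound l := by
  rw [Program.cost, plain, bound, List.map_map]
  refine List.sum_le_sum fun i _ => ?_
  cases i with
  | inl i => exact le_rfl
  | inr t => exact t.gate_cost.trans (Nat.le_mul_of_pos_left _ (by norm_num))

theorem CProgram.ctrl_cost (ι : W₁ ↪ W₂) (c : W₂) (hc : c ∉ Set.range ι) (l : CProgram N W₁ q) :
    Program.cost (ctrl ι c hc l) ≤ bound l := by
  rw [Program.cost, ctrl, bound, List.map_map]
  refine List.sum_le_sum fun i _ => ?_
  cases i with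
  | inl i => exact (Instr.map_cost ι i).le
  | inr t => exact t.ctrl_cost ι c hc

theorem CProgram.bound_append (l l' : CProgram N W q) : bound (l ++ l') = bound l + bound l' := by
  simp [bound]

theorem CProgram.bound_ofProgram (l : Program N W q) : bound (ofProgram l) = Program.cost l := by
  rw [bound, ofProgram, List.map_map]
  rfl

theorem CProgram.bound_ofToggles {ι : Type} [Fintype ι] (τ : ι → Toggle W) (k : ℕ)
    (h : ∀ i, (τ i).supp.card ≤ k) :
    bound (ofToggles (familyToggles τ) : CProgram N W q) ≤ Fintype.card ι * (4 * 4 ^ (k + 1)) := by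
  rw [bound, ofToggles, familyToggles, List.map_map, List.map_map, ← smul_eq_mul]
  refine (List.sum_le_card_nsmul _ (4 * 4 ^ (k + 1)) ?_).trans (by
    rw [List.length_map, Finset.length_toList, Finset.card_univ])
  intro x hx
  obtain ⟨i, -, rfl⟩ := List.mem_map.1 hx
  exact Nat.mul_le_mul_left _ (Nat.pow_le_pow_right (by norm_num) (Nat.succ_le_succ (h i)))

variable {X M Z Key Sel Anc : Type} [Fintype X] [DecidableEq X] [Fintype M] [DecidableEq M]
  [Fintype Z] [DecidableEq Z] [Fintype Key] [DecidableEq Key] [Fintype Sel] [DecidableEq Sel]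
  [Fintype Anc] [DecidableEq Anc] {m : ℕ}

local notation "DW" => DerivedWires X M m Z Key Sel Anc

/-- A bound on the cost of one round of the derived prover. -/
def roundCost (X M Sel : Type) [Fintype X] [Fintype M] [Fintype Sel] (m hashCost : ℕ) : ℕ :=
  2 * (hashCost + (Fintype.card (X ⊕ M) + 1) * 256) + m * (4 * 4 ^ (Fintype.card Sel + 4)) +
    (2 * (4 * 4 ^ (Fintype.card Sel + 1)) + 2)

theorem rounds_bound (h : HashScheme (X ⊕ M) Key Anc m) (cond mode : Fin q → Bits Sel → Bool) :
    CProgram.bound (rounds h cond mode : CProgram (QueryComm X M m Z) DW q)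
      ≤ q * roundCost X M Sel m h.circuit.cost := by
  have hlook : (lookupCircuit h).cost ≤ h.circuit.cost + (Fintype.card (X ⊕ M) + 1) * 256 := by
    rw [lookupCircuit, Circuit.append_cost, Circuit.map_cost, Circuit.map_cost]
    exact Nat.add_le_add_left eqCircuit_cost _
  have hround : ∀ j : Fin q, CProgram.bound (queryBlock h (cond j) (mode j) ++
      stepBlock X M m Z Key Anc (cond j) j : CProgram (QueryComm X M m Z) DW q)
        ≤ roundCost X M Sel m h.circuit.cost := by
    intro j
    rw [CProgram.bound_append]
    refine add_le_add ?_ ?_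
    · rw [queryBlock, CProgram.bound_append, CProgram.bound_append, CProgram.bound_ofProgram,
        CProgram.bound_ofProgram, Program.cost_ofCircuit, Program.cost_ofCircuit, Circuit.inv_cost,
        Circuit.map_cost]
      have h1 := CProgram.bound_ofToggles (N := QueryComm X M m Z) (q := q)
        (answerToggle h (cond j) (mode j) : Fin m → Toggle DW)
        (Fintype.card Sel + 3) fun i => answerToggle_supp_card h _ _ i
      rw [Fintype.card_fin, show Fintype.card Sel + 3 + 1 = Fintype.card Sel + 4 from rfl] at h1
      omega
    · have h1 : (controlToggle (Sel := Sel) X M m Z Key Anc (cond j)).supp.card ≤ Fintype.card Sel :=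
        Finset.card_image_le
      have h2 : CProgram.bound (stepBlock X M m Z Key Anc (cond j) j)
          = 2 * (4 * 4 ^ ((controlToggle (Sel := Sel) X M m Z Key Anc (cond j)).supp.card + 1)) + 2 := by
        simp only [CProgram.bound, stepBlock, List.map_cons, List.map_nil, List.sum_cons, List.sum_nil,
          CInstr.bound, Instr.cost]
        ring
      rw [h2]
      have h3 := Nat.pow_le_pow_right (n := 4) (by norm_num) (Nat.succ_le_succ h1)
      simp only [Nat.succ_eq_add_one] at h3
      omega
  unfold rounds
  have key : ∀ L : List (Fin q), CProgram.bound (L.flatMap fun j => queryBlock h (cond j) (mode j) ++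
      stepBlock X M m Z Key Anc (cond j) j : CProgram (QueryComm X M m Z) DW q)
        ≤ L.length * roundCost X M Sel m h.circuit.cost := by
    intro L
    induction L with
    | nil => exact Nat.zero_le _
    | cons j L ih =>
      rw [List.flatMap_cons, CProgram.bound_append, List.length_cons, Nat.succ_mul, add_comm]
      exact add_le_add ih (hround j)
  exact (key _).trans (by rw [List.length_finRange])

theorem toggleCircuit_family_cost {ι : Type} [Fintype ι] (τ : ι → Toggle W) (k : ℕ)
    (h : ∀ i, (τ i).supp.card ≤ k) :
    (toggleCircuit (familyToggles τ)).cost ≤ Fintype.card ι * 4 ^ (k + 1) := by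
  refine (toggleCircuit_cost_le _ k ?_).trans (by
    rw [familyToggles, List.length_map, Finset.length_toList, Finset.card_univ])
  intro t ht
  obtain ⟨i, -, rfl⟩ := List.mem_map.1 ht
  exact h i

theorem prepProgram_cost (h : HashScheme (X ⊕ M) Key Anc m) (idx : Bits Sel → ℕ) :
    Program.cost (prepProgram h idx : Program (QueryComm X M m Z) DW q)
      ≤ (Fintype.card Key + Fintype.card Sel) * 4 + q * roundCost X M Sel m h.circuit.cost +
        Fintype.card (X ⊕ M) * 16 := by
  rw [prepProgram, Program.cost_append, Program.cost_append, Program.cost_ofCircuit,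
    Program.cost_ofCircuit]
  refine add_le_add (add_le_add ?_ ((CProgram.plain_cost _).trans (rounds_bound h _ _))) ?_
  · rw [randomCircuit, Circuit.cost, List.map_map, List.map_map]
    have : ∀ L : List (Key ⊕ Sel), (L.map ((Gate.cost ∘ hadamard) ∘
        randomWires X M m Z Key Sel Anc)).sum = L.length * 4 := by
      intro L
      induction L with
      | nil => rfl
      | cons v L ih =>
        rw [List.map_cons, List.sum_cons, ih, List.length_cons, Nat.succ_mul, add_comm]
        rfl
    refine (this _).le.trans ?_
    rw [Finset.length_toList, Finset.card_univ, Fintype.card_sum]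
  · refine toggleCircuit_family_cost _ 1 ?_
    rintro (i | i)
    · exact (Finset.card_singleton _).le
    · exact (Finset.card_singleton _).le

theorem respondProgram_bound (h : HashScheme (X ⊕ M) Key Anc m) (idx : Bits Sel → ℕ)
    (flag : Bits Sel → Bool) :
    CProgram.bound (respondProgram h idx flag : CProgram (QueryComm X M m Z) DW q)
      ≤ q * roundCost X M Sel m h.circuit.cost + Fintype.card Z * 64 := by
  rw [respondProgram, CProgram.bound_append]
  refine add_le_add (rounds_bound h _ _) (CProgram.bound_ofToggles _ 1 fun i => ?_)
  exact (Finset.card_singleton _).le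

theorem extractor_cost {N₁ N₂ X O R : Type} [Fintype N₁] [DecidableEq N₁] [Fintype N₂]
    [DecidableEq N₂] [Fintype X] [DecidableEq X] [Fintype O] [DecidableEq O] [Fintype R]
    [DecidableEq R] (pre : Program N₁ (N₂ ⊕ Inner N₁ X R) q)
    (l : CProgram N₁ (N₂ ⊕ Inner N₁ X R) q) (K : BlackBoxAlg N₂ X O 2) :
    (extractor pre l K).cost ≤ pre.cost + Fintype.card X * 16 + K.cost * (CProgram.bound l + 1) := by
  have h1 : (extractor pre l K).cost = Program.cost (extractorProgram pre l K) :=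
    Program.cost_map _ _
  rw [h1, extractorProgram, Program.cost_append, Program.cost_append, Program.cost_map,
    Program.cost_ofCircuit]
  refine add_le_add (Nat.add_le_add_left ?_ _) (simulate_cost l _ (fun ι c hc =>
    CProgram.ctrl_cost ι c hc l) _)
  have := toggleCircuit_family_cost (copyToInput N₁ N₂ O R K.work : X → _) 1
    fun i => (Finset.card_singleton _).le
  rw [toggleCircuit, familyToggles, List.map_map] at this
  exact this

end Cost

/-! ### Measuring a query and reprogramming the hash function -/

section MeasureReprogram

variable {X M Z : Type} [Fintype X] [DecidableEq X] [Fintype M] [DecidableEq M]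
  [Fintype Z] [DecidableEq Z] {m q : ℕ}

theorem queryFn_sub {E : Type} (H : Bits (X ⊕ M) → BitString m)
    (ψ φ : Bits (QueryComm X M m Z) × E → ℂ) :
    queryFn H (ψ - φ) = queryFn H ψ - queryFn H φ := rfl

theorem runRounds_cons (A : Adversary (QueryComm X M m Z) q)
    (G : Fin q → Bits (X ⊕ M) → BitString m) (c : Fin q → Bool) (j : Fin q) (L : List (Fin q))
    (ψ : Bits (QueryComm X M m Z) × A.E → ℂ) :
    runRounds A G c (j :: L) ψ = runRounds A G c L
      (bif c j then (A.step j).1.mulVec (queryFn (G j) ψ) else ψ) := rfl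

theorem runRounds_sub (A : Adversary (QueryComm X M m Z) q)
    (G : Fin q → Bits (X ⊕ M) → BitString m) (c : Fin q → Bool) (L : List (Fin q))
    (ψ φ : Bits (QueryComm X M m Z) × A.E → ℂ) :
    runRounds A G c L (ψ - φ) = runRounds A G c L ψ - runRounds A G c L φ := by
  induction L generalizing ψ φ with
  | nil => rfl
  | cons j L ih =>
    rw [runRounds_cons, runRounds_cons, runRounds_cons, ← ih]
    cases c j
    · rfl
    · rw [cond_true, cond_true, cond_true, queryFn_sub, Matrix.mulVec_sub]

theorem runRounds_congr (A : Adversary (QueryComm X M m Z) q)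
    {G G' : Fin q → Bits (X ⊕ M) → BitString m} {c c' : Fin q → Bool} {L : List (Fin q)}
    (hG : ∀ j ∈ L, G j = G' j) (hc : ∀ j ∈ L, c j = c' j)
    (ψ : Bits (QueryComm X M m Z) × A.E → ℂ) :
    runRounds A G c L ψ = runRounds A G' c' L ψ := by
  induction L generalizing ψ with
  | nil => rfl
  | cons j L ih =>
    rw [runRounds_cons, runRounds_cons, hG j List.mem_cons_self, hc j List.mem_cons_self]
    exact ih (fun i hi => hG i (List.mem_cons_of_mem _ hi))
      (fun i hi => hc i (List.mem_cons_of_mem _ hi)) _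

theorem runRounds_of_false (A : Adversary (QueryComm X M m Z) q)
    (G : Fin q → Bits (X ⊕ M) → BitString m) {c : Fin q → Bool} {L : List (Fin q)}
    (hc : ∀ j ∈ L, c j = false) (ψ : Bits (QueryComm X M m Z) × A.E → ℂ) :
    runRounds A G c L ψ = ψ := by
  induction L with
  | nil => rfl
  | cons j L ih =>
    rw [runRounds_cons, hc j List.mem_cons_self]
    exact ih fun i hi => hc i (List.mem_cons_of_mem _ hi)

/-- The rounds `L`, with `H` as hash function before round `i` and `G` afterwards; the state before
round `i` is projected to `S`. The flag tells whether round `i` itself still uses `H`. -/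
def switchedRun (A : Adversary (QueryComm X M m Z) q) (H G : Bits (X ⊕ M) → BitString m)
    (S : Set (Bits (QueryComm X M m Z) × A.E)) (L : List (Fin q))
    (ψ : Bits (QueryComm X M m Z) × A.E → ℂ) (i : ℕ) (f : Bool) :
    Bits (QueryComm X M m Z) × A.E → ℂ :=
  runRounds A (fun j => bif decide (i < j.1) || (decide (i = j.1) && !f) then G else H)
    (fun j => decide (i ≤ j.1)) L
    (S.indicator (runRounds A (fun _ => H) (fun j => decide (j.1 < i)) L ψ))

/-- If `H` and `G` agree outside the queries in `S`, then a run with `G` differs from the run with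
`H` only by runs in which some query is projected to `S`. -/
theorem runRounds_eq_add_sum (A : Adversary (QueryComm X M m Z) q) (H G : Bits (X ⊕ M) → BitString m)
    (S : Set (Bits (QueryComm X M m Z) × A.E))
    (hS : ∀ ψ : Bits (QueryComm X M m Z) × A.E → ℂ,
      queryFn G ψ - queryFn H ψ = queryFn G (S.indicator ψ) - queryFn H (S.indicator ψ))
    (L : List (Fin q)) (hL : L.Pairwise (· < ·)) (ψ : Bits (QueryComm X M m Z) × A.E → ℂ) :
    runRounds A (fun _ => G) (fun _ => true) L ψ
      = runRounds A (fun _ => H) (fun _ => true) L ψ +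
        (L.map fun i => switchedRun A H G S L ψ i.1 false - switchedRun A H G S L ψ i.1 true).sum := by
  induction L generalizing ψ with
  | nil => exact (add_zero _).symm
  | cons j L ih =>
    rw [List.pairwise_cons] at hL
    rw [List.map_cons, List.sum_cons, runRounds_cons, runRounds_cons, cond_true, cond_true]
    have h1 : (A.step j).1.mulVec (queryFn G ψ) = (A.step j).1.mulVec (queryFn H ψ) +
        ((A.step j).1.mulVec (queryFn G (S.indicator ψ)) -
          (A.step j).1.mulVec (queryFn H (S.indicator ψ))) := by
      rw [← Matrix.mulVec_sub, ← hS, Matrix.mulVec_sub, add_sub_cancel]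
    have h3 : ∀ f, switchedRun A H G S (j :: L) ψ j.1 f
        = runRounds A (fun _ => G) (fun _ => true) L
          ((A.step j).1.mulVec (queryFn (bif f then H else G) (S.indicator ψ))) := by
      intro f
      unfold switchedRun
      have hsel : runRounds A (fun _ => H) (fun i => decide (i.1 < j.1)) (j :: L) ψ = ψ := by
        refine runRounds_of_false A _ (fun i hi => ?_) ψ
        rcases List.mem_cons.1 hi with rfl | hi
        · exact decide_eq_false (lt_irrefl _)
        · exact decide_eq_false (not_lt.2 (le_of_lt (hL.1 i hi)))
      rw [hsel, runRounds_cons, decide_eq_true (le_refl j.1), cond_true]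
      · rw [decide_eq_false (lt_irrefl j.1), Bool.false_or, decide_eq_true rfl, Bool.true_and]
        rw [runRounds_congr A (G' := fun _ => G) (c' := fun _ => true)]
        · cases f <;> rfl
        · intro i hi
          have : j.1 < i.1 := hL.1 i hi
          simp [this]
        · exact fun i hi => decide_eq_true (le_of_lt (hL.1 i hi))
    have h4 : ∀ i ∈ L, ∀ f, switchedRun A H G S (j :: L) ψ i.1 f
        = switchedRun A H G S L ((A.step j).1.mulVec (queryFn H ψ)) i.1 f := by
      intro i hi f
      unfold switchedRun
      rw [runRounds_cons, runRounds_cons, decide_eq_true (show j.1 < i.1 from hL.1 i hi), cond_true,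
        decide_eq_false (not_le.2 (show j.1 < i.1 from hL.1 i hi)), cond_false]
    rw [h3, h3, cond_true, cond_false, List.map_congr_left (g := fun i : Fin q =>
      switchedRun A H G S L ((A.step j).1.mulVec (queryFn H ψ)) i.1 false -
      switchedRun A H G S L ((A.step j).1.mulVec (queryFn H ψ)) i.1 true)
      (fun i hi => by rw [h4 i hi, h4 i hi])]
    rw [add_left_comm, ← ih hL.2, ← runRounds_sub, add_comm]
    conv_lhs => rw [h1]
    rw [← sub_eq_iff_eq_add', ← runRounds_sub, add_sub_cancel_left]

variable (A : Adversary (QueryComm X M m Z) q)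

/-- The final state of the adversary with hash function `H`. -/
def finalState (H : Bits (X ⊕ M) → BitString m) : Bits (QueryComm X M m Z) × A.E → ℂ :=
  runRounds A (fun _ => H) (fun _ => true) (List.finRange q) A.init

theorem measuredRun_eq (H : Bits (X ⊕ M) → BitString m) (i : ℕ) (f : Bool) (x : Bits X) (a : Bits M)
    (c : BitString m) :
    measuredRun A H i f x a c = switchedRun A H (Function.update H (Sum.elim x a) c)
      {p | (fun u => p.1 (.inl u)) = Sum.elim x a} (List.finRange q) A.init i f := by
  unfold measuredRun switchedRun selectedState
  refine runRounds_congr A (fun j _ => ?_) (fun _ _ => rfl) _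
  cases decide (i < j.1) || (decide (i = j.1) && !f)
  · exact reprogrammed_false _ _ _
  · funext u
    by_cases h : u = Sum.elim x a
    · rw [h, cond_true, Function.update_self]
      exact if_pos ⟨rfl, rfl⟩
    · rw [cond_true, Function.update_of_ne h]
      exact if_neg fun h' => h h'.2

/-- If the output of the adversary is measured instead of a query, nothing remains to be run. -/
theorem measuredRun_last (H : Bits (X ⊕ M) → BitString m) (f : Bool) (x : Bits X) (a : Bits M)
    (c : BitString m) :
    measuredRun A H q f x a c
      = {p | (fun u => p.1 (.inl u)) = Sum.elim x a}.indicator (finalState A H) := by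
  unfold measuredRun selectedState finalState
  rw [runRounds_of_false]
  · refine congrArg _ (runRounds_congr A (fun _ _ => rfl) (fun j _ => ?_) _)
    exact decide_eq_true j.2
  · exact fun j _ => decide_eq_false (not_le.2 j.2)

/-- Reprogramming at `v` changes the answer only where the query is `v`. -/
theorem queryFn_update_sub {E : Type} (H : Bits (X ⊕ M) → BitString m) (v : Bits (X ⊕ M))
    (c : BitString m) (ψ : Bits (QueryComm X M m Z) × E → ℂ) :
    queryFn (Function.update H v c) ψ - queryFn H ψ
      = queryFn (Function.update H v c)
          (({p | (fun u => p.1 (.inl u)) = v} : Set (Bits (QueryComm X M m Z) × E)).indicator ψ) -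
        queryFn H
          (({p | (fun u => p.1 (.inl u)) = v} : Set (Bits (QueryComm X M m Z) × E)).indicator ψ) := by
  classical
  funext p
  have hin : ∀ b : BitString m, (fun u : X ⊕ M => xor (p.1 (.inl u)) ((Sum.elim (zeros (X ⊕ M))
      (Sum.elim b (zeros Z)) : Bits (QueryComm X M m Z)) (.inl u))) = fun u => p.1 (.inl u) :=
    fun b => funext fun u => Bool.xor_false _
  simp only [Pi.sub_apply, queryFn, Set.indicator_apply, Set.mem_ofPred_eq, hin]
  by_cases h : (fun u => p.1 (.inl u)) = v
  · rw [if_pos h, if_pos h]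
  · rw [if_neg h, if_neg h, Function.update_of_ne h, sub_self, sub_self]

/-- At the outcomes with query register `(x, a)`, the final state of a run with the reprogrammed
function is a combination of `2q + 1` measured runs. -/
theorem finalState_update (H : Bits (X ⊕ M) → BitString m) (x : Bits X) (a : Bits M)
    (c : BitString m) {p : Bits (QueryComm X M m Z) × A.E}
    (hp : (fun u => p.1 (.inl u)) = Sum.elim x a) :
    finalState A (Function.update H (Sum.elim x a) c) p
      = measuredRun A H q false x a c p + ∑ i : Fin q,
        (measuredRun A H i false x a c p - measuredRun A H i true x a c p) := by
  have h := runRounds_eq_add_sum A H (Function.update H (Sum.elim x a) c)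
    {p | (fun u => p.1 (.inl u)) = Sum.elim x a} (queryFn_update_sub H _ c) (List.finRange q)
    (List.pairwise_lt_finRange q) A.init
  have h1 := congrFun h p
  rw [Pi.add_apply] at h1
  refine h1.trans (congrArg₂ (· + ·) ?_ ?_)
  · rw [measuredRun_last, Set.indicator_of_mem (show p ∈ _ from hp)]
    rfl
  · simp only [← measuredRun_eq]
    rw [← List.ofFn_eq_map, List.sum_ofFn, Finset.sum_apply]
    rfl

/-- Cauchy-Schwarz, for the `2q + 1` terms of a telescoping sum. -/
theorem normSq_add_sum_sub_le (z : ℂ) (u w : Fin q → ℂ) :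
    ‖z + ∑ i, (u i - w i)‖ ^ 2 ≤ (2 * q + 1) * (‖z‖ ^ 2 + ∑ i, (‖u i‖ ^ 2 + ‖w i‖ ^ 2)) := by
  let f : Option (Fin q ⊕ Fin q) → ℝ := fun o => o.elim ‖z‖ (Sum.elim (fun i => ‖u i‖) fun i => ‖w i‖)
  have h1 : ‖z + ∑ i, (u i - w i)‖ ≤ ∑ o, f o := by
    rw [Fintype.sum_option, Fintype.sum_sum_type]
    refine (norm_add_le _ _).trans (add_le_add le_rfl ((norm_sum_le _ _).trans ?_))
    rw [← Finset.sum_add_distrib]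
    exact Finset.sum_le_sum fun i _ => norm_sub_le _ _
  have h2 := sq_sum_le_card_mul_sum_sq (s := (Finset.univ : Finset (Option (Fin q ⊕ Fin q)))) (f := f)
  refine (pow_le_pow_left₀ (norm_nonneg _) h1 2).trans (h2.trans (le_of_eq ?_))
  rw [Finset.card_univ, Fintype.card_option, Fintype.card_sum, Fintype.card_fin, Fintype.sum_option,
    Fintype.sum_sum_type, Finset.sum_add_distrib]
  push_cast
  rw [two_mul]
  rfl

/-- The measure-and-reprogram bound: what the adversary achieves with a reprogrammed hash function
is achieved, up to a factor, by measuring one of its queries and reprogramming from there on. -/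
theorem measureProb_finalState_update_le (H : Bits (X ⊕ M) → BitString m) (x : Bits X) (a : Bits M)
    (c : BitString m) (V : Set (Bits Z)) :
    measureProb (finalState A (Function.update H (Sum.elim x a) c))
        {p | (fun u => p.1 (.inl u)) = Sum.elim x a ∧ (fun z => p.1 (.inr (.inr z))) ∈ V}
      ≤ (2 * q + 1) * ∑ i : Fin (q + 1), ∑ f : Bool,
        measureProb (measuredRun A H i f x a c) {p | (fun z => p.1 (.inr (.inr z))) ∈ V} := by
  classical
  unfold measureProb
  simp only [Finset.sum_comm (t := (Finset.univ : Finset (Bits (QueryComm X M m Z) × A.E)))]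
  rw [Finset.mul_sum]
  refine Finset.sum_le_sum fun p _ => ?_
  simp only [Set.indicator_apply, Set.mem_ofPred_eq]
  by_cases hp : (fun u => p.1 (.inl u)) = Sum.elim x a ∧ (fun z => p.1 (.inr (.inr z))) ∈ V
  · rw [if_pos hp, finalState_update A H x a c hp.1]
    simp only [if_pos hp.2]
    refine (normSq_add_sum_sub_le _ _ _).trans (mul_le_mul_of_nonneg_left ?_ (by positivity))
    -- the last index stands for the measured output, for which one of the two flags suffices
    rw [Fin.sum_univ_castSucc, add_comm]
    refine add_le_add (Finset.sum_le_sum fun i _ => ?_) ?_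
    · rw [Fintype.sum_bool, add_comm]
      rfl
    · rw [Fintype.sum_bool]
      exact le_add_of_nonneg_left (sq_nonneg _)
  · rw [if_neg hp]
    refine mul_nonneg (by positivity) (Finset.sum_nonneg fun i _ => Finset.sum_nonneg fun f _ => ?_)
    split_ifs
    · exact sq_nonneg _
    · exact le_rfl

/-! ### The measured runs depend on few hash values at a time -/

variable {Y : Type} [Fintype Y] (val : Y → BitString m)

/-- A query raises by one the number of hash values on which the amplitudes depend. -/
theorem queryFn_mem_juntas {E : Type} {G : (Bits (X ⊕ M) → Y) → Bits (X ⊕ M) → BitString m}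
    (hG : ∀ u y, (fun H => if G H u = y then (1 : ℂ) else 0) ∈ juntas (Bits (X ⊕ M)) Y 1)
    {ψ : (Bits (X ⊕ M) → Y) → Bits (QueryComm X M m Z) × E → ℂ} {d : ℕ}
    (hψ : ∀ p, (fun H => ψ H p) ∈ juntas (Bits (X ⊕ M)) Y d) (p : Bits (QueryComm X M m Z) × E) :
    (fun H => queryFn (G H) (ψ H) p) ∈ juntas (Bits (X ⊕ M)) Y (d + 1) := by
  have h := sum_mem_juntas (Finset.univ : Finset (BitString m))
    (Q := fun y H => ψ H (fun v => xor (p.1 v) (Sum.elim (zeros _) (Sum.elim y (zeros _)) v), p.2) *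
      if G H (fun u => p.1 (.inl u)) = y then (1 : ℂ) else 0)
    fun y _ => mul_mem_juntas (hψ _) (hG _ y)
  convert h using 2 with H
  simp only [mul_ite, mul_one, mul_zero]
  rw [Finset.sum_ite_eq, if_pos (Finset.mem_univ _)]
  rfl

theorem runRounds_mem_juntas {G : (Bits (X ⊕ M) → Y) → Fin q → Bits (X ⊕ M) → BitString m}
    (hG : ∀ j u y, (fun H => if G H j u = y then (1 : ℂ) else 0) ∈ juntas (Bits (X ⊕ M)) Y 1)
    (c : Fin q → Bool) (L : List (Fin q))
    {ψ : (Bits (X ⊕ M) → Y) → Bits (QueryComm X M m Z) × A.E → ℂ} {d : ℕ}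
    (hψ : ∀ p, (fun H => ψ H p) ∈ juntas (Bits (X ⊕ M)) Y d) (p : Bits (QueryComm X M m Z) × A.E) :
    (fun H => runRounds A (G H) c L (ψ H) p) ∈ juntas (Bits (X ⊕ M)) Y (d + L.length) := by
  induction L generalizing ψ d with
  | nil => exact hψ p
  | cons j L ih =>
    have h := ih (ψ := fun H => bif c j then (A.step j).1.mulVec (queryFn (G H j) (ψ H)) else ψ H)
      (d := d + 1) ?_
    · rw [List.length_cons, add_comm L.length, ← add_assoc]
      exact h
    · intro p
      cases c j
      · exact juntas_mono (Nat.le_succ d) (hψ p)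
      · refine sum_mem_juntas Finset.univ fun p' _ => ?_
        have := mul_mem_juntas (const_mem_juntas (V := Bits (X ⊕ M)) (Y := Y) ((A.step j).1 p p') 0)
          (queryFn_mem_juntas (hG j) hψ p')
        rwa [zero_add] at this

/-- A measured run consists of two partial runs of at most `q` queries each, and probabilities are
quadratic in the amplitudes. -/
theorem measureProb_measuredRun_mem_juntas (i : ℕ) (f : Bool) (x : Bits X) (a : Bits M)
    (c : BitString m) (V : Set (Bits (QueryComm X M m Z) × A.E)) :
    (fun H : Bits (X ⊕ M) → Y => ((measureProb (measuredRun A (fun u => val (H u)) i f x a c) V : ℝ) : ℂ))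
      ∈ juntas (Bits (X ⊕ M)) Y (4 * q) := by
  classical
  have hG : ∀ (b : Bool) (n : Bits (ProverComm M m Z)) (u : Bits (X ⊕ M)) (y : BitString m),
      (fun H : Bits (X ⊕ M) → Y => if reprogrammed (fun u => val (H u)) b n x u = y then (1 : ℂ) else 0)
        ∈ juntas (Bits (X ⊕ M)) Y 1 := by
    intro b n u y
    unfold reprogrammed
    by_cases h : b = true ∧ u = Sum.elim x fun a => n (.inl a)
    · simp only [if_pos h]
      exact const_mem_juntas _ _
    · simp only [if_neg h]
      exact eval_mem_juntas u fun z => if val z = y then (1 : ℂ) else 0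
  have hH : ∀ (u : Bits (X ⊕ M)) (y : BitString m),
      (fun H : Bits (X ⊕ M) → Y => if val (H u) = y then (1 : ℂ) else 0) ∈ juntas (Bits (X ⊕ M)) Y 1 :=
    fun u y => eval_mem_juntas u fun z => if val z = y then (1 : ℂ) else 0
  have h1 : ∀ p, (fun H : Bits (X ⊕ M) → Y => selectedState A (fun u => val (H u)) i p)
      ∈ juntas (Bits (X ⊕ M)) Y q := by
    intro p
    have := runRounds_mem_juntas A (G := fun (H : Bits (X ⊕ M) → Y) _ u => val (H u)) (fun _ => hH)
      (fun j => decide (j.1 < i)) (List.finRange q) (ψ := fun _ => A.init) (d := 0)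
      (fun p => const_mem_juntas _ _) p
    rwa [zero_add, List.length_finRange] at this
  have h2 : ∀ p, (fun H : Bits (X ⊕ M) → Y => measuredRun A (fun u => val (H u)) i f x a c p)
      ∈ juntas (Bits (X ⊕ M)) Y (2 * q) := by
    intro p
    have := runRounds_mem_juntas A
      (G := fun (H : Bits (X ⊕ M) → Y) j => reprogrammed (Z := Z) (fun u => val (H u))
        (decide (i < j.1) || (decide (i = j.1) && !f)) (Sum.elim a (Sum.elim c (zeros _))) x)
      (fun j => hG _ _) (fun j => decide (i ≤ j.1)) (List.finRange q)
      (ψ := fun H => {p | (fun u => p.1 (.inl u)) = Sum.elim x a}.indicator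
        (selectedState A (fun u => val (H u)) i)) (d := q) ?_ p
    · rwa [List.length_finRange, ← two_mul] at this
    · intro p
      by_cases hp : p ∈ {p : Bits (QueryComm X M m Z) × A.E | (fun u => p.1 (.inl u)) = Sum.elim x a}
      · simp only [Set.indicator_of_mem hp]
        exact h1 p
      · simp only [Set.indicator_of_notMem hp]
        exact const_mem_juntas _ _
  unfold measureProb
  simp only [Complex.ofReal_sum]
  refine sum_mem_juntas Finset.univ fun p _ => ?_
  by_cases hp : p ∈ V
  · simp only [Set.indicator_of_mem hp]
    have := normSq_mem_juntas (h2 p)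
    rwa [← mul_assoc] at this
  · simp only [Set.indicator_of_notMem hp]
    exact const_mem_juntas _ _

end MeasureReprogram

/-! ### Samplers without idle ancillas -/

section Trim

variable {W W₁ W₂ : Type} [DecidableEq W]

/-- The wires touched by the gates of a circuit. -/
def Circuit.touched (C : Circuit W) : Finset W :=
  C.foldr (fun g T => Finset.univ.map g.wires ∪ T) ∅

theorem Circuit.card_touched_le (C : Circuit W) : (Circuit.touched C).card ≤ C.cost := by
  induction C with
  | nil => exact Nat.zero_le _
  | cons g C ih =>
    have hg : (Finset.univ.map g.wires).card ≤ g.cost := by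
      rw [Finset.card_map, Finset.card_univ, Fintype.card_fin]
      exact (Nat.lt_pow_self (by norm_num)).le
    refine (Finset.card_union_le _ _).trans ((add_le_add hg ih).trans_eq ?_)
    rw [Circuit.cost, Circuit.cost, List.map_cons, List.sum_cons]

theorem Circuit.mem_touched {C : Circuit W} {g : Gate W} (hg : g ∈ C) (i : Fin g.arity) :
    g.wires i ∈ Circuit.touched C := by
  induction C with
  | nil => simp at hg
  | cons g' C ih =>
    rcases List.mem_cons.1 hg with rfl | hg
    · exact Finset.mem_union_left _ (Finset.mem_map_of_mem _ (Finset.mem_univ i))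
    · exact Finset.mem_union_right _ (ih hg)

/-- A circuit whose gates touch only wires in the range of `ι` comes from a circuit on these wires.
-/
theorem Circuit.exists_map_eq (ι : W₁ ↪ W₂) (C : Circuit W₂)
    (h : ∀ g ∈ C, ∀ i, g.wires i ∈ Set.range ι) : ∃ D : Circuit W₁, Circuit.map ι D = C := by
  induction C with
  | nil => exact ⟨[], rfl⟩
  | cons g C ih =>
    obtain ⟨D, rfl⟩ := ih fun g' hg' => h g' (List.mem_cons_of_mem _ hg')
    choose w hw using h g List.mem_cons_self
    refine ⟨⟨g.arity, ⟨w, fun i j hij => g.wires.injective ?_⟩, g.unitary⟩ :: D, ?_⟩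
    · rw [← hw, ← hw, hij]
    · refine congrArg (· :: Circuit.map ι D) ?_
      obtain ⟨k, v, u⟩ := g
      unfold Gate.map
      congr 1
      exact Function.Embedding.ext hw

variable {n m anc : ℕ}

/-- The ancillas touched by a circuit. -/
def usedAncillas (C : Circuit (Fin n ⊕ Fin m ⊕ Fin anc)) : Finset (Fin anc) :=
  Finset.univ.filter fun a => .inr (.inr a) ∈ Circuit.touched C

theorem card_usedAncillas_le (C : Circuit (Fin n ⊕ Fin m ⊕ Fin anc)) :
    (usedAncillas C).card ≤ C.cost := by
  refine le_trans ?_ (Circuit.card_touched_le C)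
  refine Finset.card_le_card_of_injOn (fun a => .inr (.inr a))
    (fun a ha => (Finset.mem_filter.1 ha).2) fun a _ b _ h => ?_
  simpa using h

/-- The embedding of the wires in use. -/
def trimWires (n m : ℕ) {anc : ℕ} (T : Finset (Fin anc)) :
    Fin n ⊕ Fin m ⊕ Fin T.card ↪ Fin n ⊕ Fin m ⊕ Fin anc :=
  .sumMap (.refl _) (.sumMap (.refl _) (T.orderEmbOfFin rfl).toEmbedding)

theorem exists_trim (C : Circuit (Fin n ⊕ Fin m ⊕ Fin anc)) :
    ∃ D, Circuit.map (trimWires n m (usedAncillas C)) D = C := by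
  refine Circuit.exists_map_eq _ C fun g hg i => ?_
  have h := Circuit.mem_touched hg i
  generalize g.wires i = w at h
  rcases w with v | v | v
  · exact ⟨.inl v, rfl⟩
  · exact ⟨.inr (.inl v), rfl⟩
  · have hv : v ∈ Set.range ((usedAncillas C).orderEmbOfFin rfl) := by
      rw [Finset.range_orderEmbOfFin]
      exact Finset.mem_filter.2 ⟨Finset.mem_univ _, h⟩
    obtain ⟨a, rfl⟩ := hv
    exact ⟨.inr (.inr a), rfl⟩

/-- The sampler given by a circuit, restricted to the ancillas in use. Their number is bounded by
the size of the circuit, while the number of all its ancillas need not be bounded. -/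
def Sampler.ofCircuit {chal : Finset (BitString m)} (f : BitString n → BitString m)
    (C : Circuit (Fin n ⊕ Fin m ⊕ Fin anc)) (hf : ∀ r, f r ∈ chal)
    (hC : ∀ r : BitString n, C.matrix.mulVec (Pi.single (Sum.elim r (Sum.elim (zeros _) (zeros _))) 1) =
        Pi.single (Sum.elim r (Sum.elim (f r) (zeros _))) 1) : Sampler m chal where
  bits := n
  anc := (usedAncillas C).card
  fn := f
  circuit := (exists_trim C).choose
  fn_mem := hf
  maps E _ _ r := by
    have hD := (exists_trim C).choose_spec
    have h1 : Maps (C.oper : Oper _ E) (Sum.elim r (Sum.elim (zeros _) (zeros _)))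
        (Sum.elim r (Sum.elim (f r) (zeros _))) := by
      rw [Circuit.oper_eq]
      exact maps_tensorOne (hC r)
    rw [← hD, Circuit.map_oper] at h1
    have h2 : (Sum.elim r (Sum.elim (f r) (zeros _)) : Bits (Fin n ⊕ Fin m ⊕ Fin anc))
        = Function.extend (trimWires n m (usedAncillas C)) (Sum.elim r (Sum.elim (f r) (zeros _)))
          (Sum.elim r (Sum.elim (zeros _) (zeros _))) := by
      funext v
      by_cases hv : v ∈ Set.range (trimWires n m (usedAncillas C))
      · obtain ⟨w, rfl⟩ := hv
        rw [(trimWires n m (usedAncillas C)).injective.extend_apply]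
        rcases w with w | w | w <;> rfl
      · rw [extend_off hv]
        rcases v with v | v | v
        · rfl
        · exact absurd ⟨.inr (.inl v), rfl⟩ hv
        · rfl
    rw [h2] at h1
    have h3 := h1.of_ext
    refine (congrArg (fun b => Maps _ b _) (funext fun v => ?_)).mp h3
    rcases v with v | v | v <;> rfl

theorem Sampler.ofCircuit_cost {chal : Finset (BitString m)} (f : BitString n → BitString m)
    (C : Circuit (Fin n ⊕ Fin m ⊕ Fin anc)) (hf : ∀ r, f r ∈ chal)
    (hC : ∀ r : BitString n, C.matrix.mulVec (Pi.single (Sum.elim r (Sum.elim (zeros _) (zeros _))) 1) =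
        Pi.single (Sum.elim r (Sum.elim (f r) (zeros _))) 1) :
    (Sampler.ofCircuit f C hf hC).circuit.cost = C.cost := by
  have hD := (exists_trim C).choose_spec
  conv_rhs => rw [← hD]
  exact (Circuit.map_cost _ _).symm

end Trim

/-! ### The hash function with a random key -/

/-- With a random key, the hash scheme gives at least half of the average over all hash functions
with values in `chal`, for nonnegative quantities that depend on at most `d` hash values at a
time. -/
def HashScheme.HalfFools {Q Key Anc : Type} [Fintype Q] [DecidableEq Q] [Fintype Key] [DecidableEq Key]
    [Fintype Anc] [DecidableEq Anc] {m : ℕ} (h : HashScheme Q Key Anc m) (chal : Finset (BitString m))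
    (d : ℕ) : Prop :=
  ∃ F : Bits Key → Bits Q → {c // c ∈ chal}, (∀ κ v, h.fn κ v = (F κ v).1) ∧
    ∀ R : (Bits Q → {c // c ∈ chal}) → ℝ, (∀ H, 0 ≤ R H) →
      (fun H => ((R H : ℝ) : ℂ)) ∈ juntas (Bits Q) {c // c ∈ chal} d →
      1 / 2 * (2 : ℝ) ^ Fintype.card Key * ∑ H, R H
        ≤ (Fintype.card (Bits Q → {c // c ∈ chal}) : ℝ) * ∑ κ, R (F κ)

section KeyedHash

variable {n t m : ℕ} {chal : Finset (BitString m)} {Q : Type} [Fintype Q] [DecidableEq Q]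
  {F : Type} [Field F] [Fintype F] [DecidableEq F] [Algebra (ZMod 2) F]
  (β : Module.Basis (Fin n) (ZMod 2) F) (γ : Q ↪ Fin n) (S : Sampler m chal) (hS : S.bits ≤ n)

/-- The hash scheme given by polynomials over a field of characteristic 2, followed by the sampler.
-/
def hashScheme (t : ℕ) : HashScheme Q (Fin t × Fin n) (HashAnc n t m S.anc) m where
  circuit := hashCircuit β γ S hS
  fn := hashFn β γ S hS
  out i := .inr (.inl i)
  maps E _ _ _ hb := by
    obtain ⟨b', h1, h2, -, h4⟩ := maps_hashCircuit (E := E) β γ S hS _ hb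
    exact ⟨b', h1, h2, h4⟩

/-- Boolean values and the elements of the field with two elements. -/
def zmodTwoEquiv : ZMod 2 ≃ Bool where
  toFun x := decide (x = 1)
  invFun := toZ
  left_inv x := toZ_decide x
  right_inv _ := toZ_injective (toZ_decide _)

/-- For a uniform field element, the bits given to the sampler are uniform. -/
theorem card_sampleElt (c : BitString m) :
    (2 : ℝ) ^ S.bits * (Finset.univ.filter fun x : F => sampleElt β S hS x = c).card
      = Fintype.card F * (Finset.univ.filter fun r => S.fn r = c).card := by
  let φ : F →+ (Fin S.bits → ZMod 2) :=
    { toFun := fun x i => β.repr x (Fin.castLE hS i)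
      map_zero' := by
        funext i
        rw [map_zero]
        rfl
      map_add' := fun x y => by
        funext i
        rw [map_add]
        rfl }
  have hφ : Function.Surjective φ := by
    intro y
    refine ⟨elt β fun k => if h : k.1 < S.bits then zmodTwoEquiv (y ⟨k.1, h⟩) else false, ?_⟩
    funext i
    refine (repr_elt β _ _).trans ?_
    rw [dif_pos (show (Fin.castLE hS i).1 < S.bits from i.2)]
    exact zmodTwoEquiv.symm_apply_apply (y i)
  have h := sum_comp_surjective φ hφ fun y => if S.fn (fun i => zmodTwoEquiv (y i)) = c then (1 : ℂ) else 0
  rw [← (Equiv.arrowCongr (Equiv.refl (Fin S.bits)) zmodTwoEquiv).symm.sum_comp] at h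
  have e1 : ∀ r : BitString S.bits, (fun i => zmodTwoEquiv
      ((Equiv.arrowCongr (Equiv.refl (Fin S.bits)) zmodTwoEquiv).symm r i)) = r :=
    fun r => funext fun i => zmodTwoEquiv.apply_symm_apply (r i)
  simp only [e1] at h
  rw [Finset.sum_boole, Finset.sum_boole, Fintype.card_fun, ZMod.card, Fintype.card_fin] at h
  have h' : ((2 ^ S.bits * (Finset.univ.filter fun x : F => sampleElt β S hS x = c).card : ℕ) : ℂ)
      = ((Fintype.card F * (Finset.univ.filter fun r => S.fn r = c).card : ℕ) : ℂ) := by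
    rw [Nat.cast_mul, Nat.cast_mul]
    exact h
  exact_mod_cast Nat.cast_injective (R := ℂ) h'

/-- Keys as tuples of field elements. -/
def keyEquiv (t : ℕ) : Bits (Fin t × Fin n) ≃ (Fin t → F) :=
  (Equiv.curry _ _ _).trans (Equiv.arrowCongr (Equiv.refl _) (eltEquiv β))

/-- The scheme is adequate if the sampler takes each value with almost the uniform probability. -/
theorem halfFools_hashScheme (t : ℕ) {δ : ℝ} (hδ : δ * 2 ^ Fintype.card Q ≤ 1 / 2) (hδ1 : δ ≤ 1)
    (hfn : ∀ c ∈ chal, (1 - δ) * 2 ^ S.bits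
      ≤ chal.card * ((Finset.univ.filter fun r => S.fn r = c).card : ℝ)) :
    (hashScheme β γ S hS t).HalfFools chal t := by
  let G : F → {c // c ∈ chal} := fun x => ⟨sampleElt β S hS x, S.fn_mem _⟩
  refine ⟨fun κ v => G (polyHash (keyElts β κ) (encode β γ v)), fun _ _ => rfl, fun R hR hRj => ?_⟩
  have h1 := sum_polyHash (encode_injective β γ) G hRj
  have h2 := half_sum_le_sum (V := Bits Q) G δ (by
    rw [Fintype.card_fun, Fintype.card_bool]
    exact_mod_cast hδ) hδ1 (by
    rintro ⟨c, hc⟩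
    have h3 := card_sampleElt β S hS c
    have h4 := mul_le_mul_of_nonneg_left (hfn c hc) (Nat.cast_nonneg (α := ℝ) (Fintype.card F))
    have h5 : (Finset.univ.filter fun x => G x = ⟨c, hc⟩)
        = Finset.univ.filter fun x : F => sampleElt β S hS x = c := by
      ext x
      simp only [Finset.mem_filter]
      exact and_congr_right fun _ => Subtype.ext_iff
    rw [h5, Fintype.card_coe]
    refine le_of_mul_le_mul_left ?_ (show (0 : ℝ) < 2 ^ S.bits by positivity)
    calc (2 : ℝ) ^ S.bits * ((1 - δ) * Fintype.card F)
        = Fintype.card F * ((1 - δ) * 2 ^ S.bits) := by ring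
      _ ≤ _ := h4
      _ = chal.card * (Fintype.card F * ((Finset.univ.filter fun r => S.fn r = c).card : ℝ)) := by ring
      _ = _ := by
        rw [← h3]
        ring) R hR
  have h1' : (Fintype.card (Bits Q → F) : ℝ) * ∑ k : Fin t → F, R (fun v => G (polyHash k (encode β γ v)))
      = Fintype.card (Fin t → F) * ∑ r : Bits Q → F, R (fun v => G (r v)) := by
    have h1'' := h1
    rw [← Complex.ofReal_sum, ← Complex.ofReal_sum] at h1''
    exact_mod_cast h1''
  rw [← (keyEquiv β t).sum_comp] at h1'
  have h6 : (Fintype.card (Fin t → F) : ℝ) = 2 ^ Fintype.card (Fin t × Fin n) := by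
    rw [← Fintype.card_congr (keyEquiv β t), Fintype.card_fun, Fintype.card_bool]
    push_cast
    rfl
  rw [h6] at h1'
  have hpos : (0 : ℝ) < Fintype.card (Bits Q → F) := by
    have : Nonempty (Bits Q → F) := ⟨fun _ => 0⟩
    exact_mod_cast Fintype.card_pos
  refine le_of_mul_le_mul_left ?_ hpos
  calc (Fintype.card (Bits Q → F) : ℝ) * (1 / 2 * 2 ^ Fintype.card (Fin t × Fin n) * ∑ H, R H)
      = 2 ^ Fintype.card (Fin t × Fin n) * (1 / 2 * Fintype.card (Bits Q → F) * ∑ H, R H) := by ring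
    _ ≤ 2 ^ Fintype.card (Fin t × Fin n) * _ := mul_le_mul_of_nonneg_left h2 (by positivity)
    _ = Fintype.card (Bits Q → {c // c ∈ chal}) *
        (2 ^ Fintype.card (Fin t × Fin n) * ∑ r : Bits Q → F, R fun v => G (r v)) := by ring
    _ = _ := by
      rw [← h1']
      ring_nf
      rfl

end KeyedHash

/-- From a sampler with precision `2 ^ (-(m + |Q| + 2))`: each challenge then has at least `1 - δ`
times its uniform probability, with `δ = 2 ^ (-(|Q| + 1))`, and there are `2 ^ |Q|` hash values. -/
theorem exists_hashScheme {m : ℕ} {chal : Finset (BitString m)} (hne : chal.Nonempty) {Q : Type}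
    [Fintype Q] [DecidableEq Q] {k anc : ℕ} (f : BitString k → BitString m)
    (C : Circuit (Fin k ⊕ Fin m ⊕ Fin anc)) (hf : ∀ r, f r ∈ chal)
    (hC : ∀ r : BitString k, C.matrix.mulVec (Pi.single (Sum.elim r (Sum.elim (zeros _) (zeros _))) 1) =
        Pi.single (Sum.elim r (Sum.elim (f r) (zeros _))) 1)
    (hunif : (1 / 2 : ℝ) * ∑ c ∈ chal,
      |((Finset.univ.filter fun r => f r = c).card : ℝ) / 2 ^ k - 1 / (chal.card : ℝ)|
        ≤ (1 / 2 : ℝ) ^ (m + Fintype.card Q + 2)) :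
    ∃ a ≤ C.cost, ∀ t, ∃ h : HashScheme Q (Fin t × Fin (Fintype.card Q + k + 1))
        (HashAnc (Fintype.card Q + k + 1) t m a) m,
      h.HalfFools chal t ∧ h.circuit.cost ≤ t * ((Fintype.card Q + k + 1) + (Fintype.card Q + k + 1) *
        ((Fintype.card Q + k + 1) * Fintype.card Q)) * 64 + C.cost := by
  classical
  refine ⟨(usedAncillas C).card, card_usedAncillas_le C, fun t => ?_⟩
  let n := Fintype.card Q + k + 1
  let S := Sampler.ofCircuit f C hf hC
  let _ : Fintype (GaloisField 2 n) := Fintype.ofFinite _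
  let β : Module.Basis (Fin n) (ZMod 2) (GaloisField 2 n) :=
    Module.finBasisOfFinrankEq _ _ (GaloisField.finrank 2 (Nat.succ_ne_zero _))
  have hQ : Fintype.card Q ≤ n := by omega
  let γ : Q ↪ Fin n := (Fintype.equivFin Q).toEmbedding.trans (Fin.castLEEmb hQ)
  have hS : S.bits ≤ n := by
    change k ≤ Fintype.card Q + k + 1
    omega
  refine ⟨hashScheme β γ S hS t, halfFools_hashScheme β γ S hS t
    (δ := (1 / 2) ^ (Fintype.card Q + 1)) ?_ (pow_le_one₀ (by norm_num) (by norm_num)) ?_, ?_⟩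
  · rw [pow_succ, mul_right_comm, ← mul_pow]
    norm_num
  · intro c hc
    have hN : (0 : ℝ) < chal.card := by exact_mod_cast hne.card_pos
    -- the sampler's statistical distance is absolute; relative to `1 / |chal|` it grows by `2 ^ m`
    have hN' : (chal.card : ℝ) ≤ 2 ^ m := by
      have := Finset.card_le_univ chal
      rw [Fintype.card_fun, Fintype.card_bool, Fintype.card_fin] at this
      exact_mod_cast this
    have h1 := Finset.single_le_sum (s := chal) (f := fun c =>
      |((Finset.univ.filter fun r => f r = c).card : ℝ) / 2 ^ k - 1 / (chal.card : ℝ)|)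
      (fun _ _ => abs_nonneg _) hc
    have h2 := (abs_le.1 (le_refl |((Finset.univ.filter fun r => f r = c).card : ℝ) / 2 ^ k -
      1 / (chal.card : ℝ)|)).1
    have h3 : 1 / (chal.card : ℝ) - 2 * (1 / 2 : ℝ) ^ (m + Fintype.card Q + 2)
        ≤ ((Finset.univ.filter fun r => f r = c).card : ℝ) / 2 ^ k := by
      beta_reduce at h1
      linarith
    have h4 : (2 : ℝ) ^ m * (2 * (1 / 2 : ℝ) ^ (m + Fintype.card Q + 2))
        = (1 / 2) ^ (Fintype.card Q + 1) := by
      have : (2 : ℝ) ^ m * (1 / 2) ^ m = 1 := by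
        rw [← mul_pow]
        norm_num
      rw [show m + Fintype.card Q + 2 = m + (Fintype.card Q + 1) + 1 by ring, pow_succ, pow_add]
      linear_combination (1 / 2 : ℝ) ^ (Fintype.card Q + 1) * this
    have h5 : (chal.card : ℝ) * (2 * (1 / 2 : ℝ) ^ (m + Fintype.card Q + 2))
        ≤ (1 / 2) ^ (Fintype.card Q + 1) := by
      rw [← h4]
      exact mul_le_mul_of_nonneg_right hN' (by positivity)
    have h6 := mul_le_mul_of_nonneg_left h3 hN.le
    rw [mul_sub, mul_one_div_cancel hN.ne', mul_div_assoc', le_div_iff₀ (by positivity)] at h6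
    refine le_trans (mul_le_mul_of_nonneg_right ?_ (by positivity)) h6
    linarith
  · refine (hashCircuit_cost (t := t) β γ S hS).trans (Nat.add_le_add_left ?_ _)
    exact (Sampler.ofCircuit_cost f C hf hC).le

/-! ### The derived provers are accepted often enough -/

/-- Reprogramming a random function at a point with a random value yields a random function. -/
theorem sum_sum_update {V Y : Type} [Fintype V] [DecidableEq V] [Fintype Y] (v : V)
    (g : (V → Y) → Y → ℝ) :
    ∑ H, ∑ c, g (Function.update H v c) c = Fintype.card Y * ∑ H, g H (H v) := by
  have hinv : Function.Involutive
      (fun r : (V → Y) × Y => (Function.update r.1 v r.2, r.1 v)) := by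
    rintro ⟨H, c⟩
    simp
  rw [← Fintype.sum_prod_type', ← Equiv.sum_comp (hinv.toPerm _), Fintype.sum_prod_type, Finset.mul_sum]
  refine Finset.sum_congr rfl fun H _ => ?_
  simp [Function.Involutive.toPerm]

section Average

variable {X M Z : Type} [Fintype X] [DecidableEq X] [Fintype M] [DecidableEq M]
  [Fintype Z] [DecidableEq Z] {m q : ℕ} (A : Adversary (QueryComm X M m Z) q)
  (chal : Finset (BitString m))
  (verify : Bits X → Bits M → BitString m → Bits Z → Prop)

/-- The probability that a measured run is accepted, summed over the challenge, the first message
and the measured query. -/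
def measuredAccept (x : Bits X) (H : Bits (X ⊕ M) → BitString m) : ℝ :=
  ∑ c ∈ chal, ∑ a, ∑ i : Fin (q + 1), ∑ f,
    measureProb (measuredRun A H i f x a c) {p | verify x a c fun z => p.1 (.inr (.inr z))}

/-- The success of the adversary with a random hash function is bounded by the acceptance of its
measured runs, summed over the instances in `S`. -/
theorem sum_finalState_le (S : Set (Bits X)) [DecidablePred (· ∈ S)] :
    chal.card * ∑ H : Bits (X ⊕ M) → {c // c ∈ chal}, measureProb (finalState A fun u => (H u).1)
        {p | (fun i => p.1 (.inl (.inl i))) ∈ S ∧ verify (fun i => p.1 (.inl (.inl i)))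
          (fun i => p.1 (.inl (.inr i))) (H fun u => p.1 (.inl u)).1 fun z => p.1 (.inr (.inr z))}
      ≤ (2 * q + 1) * ∑ x with x ∈ S, ∑ H : Bits (X ⊕ M) → {c // c ∈ chal},
        measuredAccept A chal verify x fun u => (H u).1 := by
  classical
  have h1 : ∀ H : Bits (X ⊕ M) → {c // c ∈ chal}, measureProb (finalState A fun u => (H u).1)
        {p | (fun i => p.1 (.inl (.inl i))) ∈ S ∧ verify (fun i => p.1 (.inl (.inl i)))
          (fun i => p.1 (.inl (.inr i))) (H fun u => p.1 (.inl u)).1 fun z => p.1 (.inr (.inr z))}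
      ≤ ∑ x with x ∈ S, ∑ a, measureProb (finalState A fun u => (H u).1)
        {p | (fun u => p.1 (.inl u)) = Sum.elim x a ∧ (fun z => p.1 (.inr (.inr z))) ∈
          {z | verify x a (H (Sum.elim x a)).1 z}} := by
    intro H
    unfold measureProb
    simp only [Finset.sum_comm (t := (Finset.univ : Finset (Bits (QueryComm X M m Z) × A.E)))]
    refine Finset.sum_le_sum fun p _ => ?_
    simp only [Set.indicator_apply]
    have hnn : ∀ (x : Bits X) (a : Bits M), (0 : ℝ) ≤ if p ∈ {p : Bits (QueryComm X M m Z) × A.E |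
        (fun u => p.1 (.inl u)) = Sum.elim x a ∧ (fun z => p.1 (.inr (.inr z))) ∈
          {z | verify x a (H (Sum.elim x a)).1 z}} then ‖finalState A (fun u => (H u).1) p‖ ^ 2 else 0 := by
      intro x a
      split_ifs
      · exact sq_nonneg _
      · exact le_rfl
    by_cases hp : p ∈ {p : Bits (QueryComm X M m Z) × A.E |
        (fun i => p.1 (.inl (.inl i))) ∈ S ∧ verify (fun i => p.1 (.inl (.inl i)))
          (fun i => p.1 (.inl (.inr i))) (H fun u => p.1 (.inl u)).1 fun z => p.1 (.inr (.inr z))}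
    · have he : (fun u => p.1 (.inl u)) = Sum.elim (fun i => p.1 (.inl (.inl i)))
          (fun i => p.1 (.inl (.inr i))) := by
        funext u
        cases u <;> rfl
      refine le_trans ?_ (Finset.single_le_sum (fun x _ => Finset.sum_nonneg fun a _ => hnn x a)
        (Finset.mem_filter.2 ⟨Finset.mem_univ (fun i => p.1 (.inl (.inl i))), hp.1⟩))
      refine le_trans ?_ (Finset.single_le_sum (fun a _ => hnn _ a)
        (Finset.mem_univ (fun i => p.1 (.inl (.inr i)))))
      rw [if_pos hp, if_pos]
      refine ⟨he, ?_⟩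
      rw [← he]
      exact hp.2
    · rw [if_neg hp]
      exact Finset.sum_nonneg fun x _ => Finset.sum_nonneg fun a _ => hnn x a
  refine (mul_le_mul_of_nonneg_left (Finset.sum_le_sum fun H _ => h1 H) (Nat.cast_nonneg _)).trans ?_
  rw [Finset.sum_comm, Finset.mul_sum, Finset.mul_sum]
  refine Finset.sum_le_sum fun x _ => ?_
  rw [Finset.sum_comm, Finset.mul_sum]
  unfold measuredAccept
  rw [Finset.sum_comm' (t' := chal) (s' := fun _ => Finset.univ) (by simp)]
  simp only [Finset.sum_comm (s := (Finset.univ : Finset (Bits (X ⊕ M) → {c // c ∈ chal})))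
    (t := (Finset.univ : Finset (Bits M)))]
  rw [Finset.sum_comm, Finset.mul_sum]
  refine Finset.sum_le_sum fun a _ => ?_
  have h2 := sum_sum_update (Sum.elim x a) fun (H : Bits (X ⊕ M) → {c // c ∈ chal}) c =>
    measureProb (finalState A fun u => (H u).1)
        {p | (fun u => p.1 (.inl u)) = Sum.elim x a ∧ (fun z => p.1 (.inr (.inr z))) ∈
          {z | verify x a c.1 z}}
  rw [Fintype.card_coe] at h2
  rw [← h2, ← Finset.sum_coe_sort chal, Finset.sum_comm, Finset.mul_sum]
  refine Finset.sum_le_sum fun c _ => ?_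
  rw [Finset.mul_sum]
  refine Finset.sum_le_sum fun H _ => ?_
  have h3 : (fun u => (Function.update H (Sum.elim x a) c u).1)
      = Function.update (fun u => (H u).1) (Sum.elim x a) c.1 := by
    funext u
    by_cases h : u = Sum.elim x a
    · rw [h, Function.update_self, Function.update_self]
    · rw [Function.update_of_ne h, Function.update_of_ne h]
  rw [h3]
  exact measureProb_finalState_update_le A (fun u => (H u).1) x a c.1 {z | verify x a c.1 z}

theorem measuredAccept_nonneg (x : Bits X) (H : Bits (X ⊕ M) → BitString m) :
    0 ≤ measuredAccept A chal verify x H :=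
  Finset.sum_nonneg fun _ _ => Finset.sum_nonneg fun _ _ => Finset.sum_nonneg fun _ _ =>
    Finset.sum_nonneg fun _ _ => measureProb_nonneg _ _

theorem measuredAccept_mem_juntas (x : Bits X) :
    (fun H : Bits (X ⊕ M) → {c // c ∈ chal} =>
      ((measuredAccept A chal verify x fun u => (H u).1 : ℝ) : ℂ)) ∈ juntas _ _ (4 * q) := by
  unfold measuredAccept
  simp only [Complex.ofReal_sum]
  exact sum_mem_juntas _ fun c _ => sum_mem_juntas _ fun a _ => sum_mem_juntas _ fun i _ =>
    sum_mem_juntas _ fun f _ => measureProb_measuredRun_mem_juntas A _ i f x a c _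

end Average

section Total

variable (P : SigmaProtocol) {η q : ℕ} {Key Sel Anc : Type} [Fintype Key] [DecidableEq Key]
  [Fintype Sel] [DecidableEq Sel] [Fintype Anc] [DecidableEq Anc]

/-- Hash functions on strings and on pairs of strings. -/
def hashEquiv (η : ℕ) : (Bits (Fin (P.instLen η) ⊕ Fin (P.msgLen η)) → {c // c ∈ P.chal η}) ≃ P.Hash η :=
  Equiv.arrowCongr (Equiv.sumArrowEquivProdArrow _ _ _) (Equiv.refl _)

theorem hashEquiv_apply (H : Bits (Fin (P.instLen η) ⊕ Fin (P.msgLen η)) → {c // c ∈ P.chal η})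
    (b : Bits (P.FSWires η)) : hashEquiv P η H (P.queryReg b) = H fun u => b (.inl u) := by
  refine congrArg H (funext fun u => ?_)
  cases u <;> rfl

theorem fsFinalState_eq (A : P.FSAdversary η q)
    (H : Bits (Fin (P.instLen η) ⊕ Fin (P.msgLen η)) → {c // c ∈ P.chal η}) :
    P.fsFinalState A (hashEquiv P η H) = finalState A fun u => (H u).1 := by
  unfold SigmaProtocol.fsFinalState finalState runRounds
  congr 1
  funext ψ j
  rw [cond_true]
  refine congrArg _ (funext fun p => ?_)
  unfold SigmaProtocol.query queryFn
  rw [hashEquiv_apply]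

/-- The success of the adversary is bounded by the acceptance of the derived provers, weighted with
the probabilities of their instances. -/
theorem fsSuccessProb_le (A : P.FSAdversary η q)
    (h : HashScheme (Fin (P.instLen η) ⊕ Fin (P.msgLen η)) Key Anc (P.chalLen η))
    (hh : h.HalfFools (P.chal η) (4 * q)) (idx : Bits Sel → ℕ) (flag : Bits Sel → Bool)
    (e : Fin (q + 1) × Bool ↪ Bits Sel) (hidx : ∀ r, idx (e r) = r.1) (hflag : ∀ r, flag (e r) = r.2)
    (X : Set (BitString (P.instLen η))) [DecidablePred (· ∈ X)] :
    P.fsSuccessProb A X ≤ 2 * 2 ^ Fintype.card Sel * (2 * q + 1) *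
      ∑ x with x ∈ X, instProb A (prepProgram (Sel := Sel) h idx) x *
        P.acceptProb (derivedProver P A h idx flag x) x := by
  classical
  obtain ⟨F, hF, havg⟩ := hh
  set N : ℝ := ((P.chal η).card : ℝ) with hN
  have hNpos : 0 < N := by
    exact Nat.cast_pos.2 (P.chal_nonempty η).card_pos
  set D : ℝ := (Fintype.card (Bits (Fin (P.instLen η) ⊕ Fin (P.msgLen η)) → {c // c ∈ P.chal η}) : ℝ)
    with hD
  have hDpos : 0 < D := by
    obtain ⟨c, hc⟩ := P.chal_nonempty η
    have : Nonempty (Bits (Fin (P.instLen η) ⊕ Fin (P.msgLen η)) → {c // c ∈ P.chal η}) :=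
      ⟨fun _ => ⟨c, hc⟩⟩
    exact Nat.cast_pos.2 Fintype.card_pos
  -- a single instance, with the average over all hash functions instead of the keys
  have hx : ∀ x, ∑ H : Bits (Fin (P.instLen η) ⊕ Fin (P.msgLen η)) → {c // c ∈ P.chal η},
      measuredAccept A (P.chal η) (P.verify η) x (fun u => (H u).1)
        ≤ 2 * 2 ^ Fintype.card Sel * (N * D) * (instProb A (prepProgram (Sel := Sel) h idx) x *
          P.acceptProb (derivedProver P A h idx flag x) x) := by
    intro x
    have h1 := acceptProb_derivedProver P A h idx flag x
    have h2 := havg (fun H => measuredAccept A (P.chal η) (P.verify η) x fun u => (H u).1)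
      (fun H => measuredAccept_nonneg _ _ _ _ _) (measuredAccept_mem_juntas _ _ _ _)
    have h3 : ∑ κ, measuredAccept A (P.chal η) (P.verify η) x (fun u => (F κ u).1)
        ≤ ∑ c ∈ P.chal η, ∑ a, ∑ k, ∑ s, measureProb (measuredRun A (h.fn k) (idx s) (flag s) x a c)
          {p | P.verify η x a c fun z => p.1 (.inr (.inr z))} := by
      unfold measuredAccept
      rw [Finset.sum_comm]
      refine Finset.sum_le_sum fun c _ => ?_
      rw [Finset.sum_comm]
      refine Finset.sum_le_sum fun a _ => Finset.sum_le_sum fun κ _ => ?_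
      rw [← Fintype.sum_prod_type']
      -- values of the selector outside the range of `e` are discarded
      refine le_trans (le_of_eq ?_) (Finset.sum_le_sum_of_subset_of_nonneg
        (Finset.subset_univ (Finset.univ.map e)) fun _ _ _ => measureProb_nonneg _ _)
      rw [Finset.sum_map]
      refine Finset.sum_congr rfl fun r _ => ?_
      rw [hidx, hflag, show h.fn κ = fun u => (F κ u).1 from funext (hF κ)]
    rw [randomAmp_sq, div_le_iff₀ hNpos] at h1
    set T := ∑ H : Bits (Fin (P.instLen η) ⊕ Fin (P.msgLen η)) → {c // c ∈ P.chal η},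
      measuredAccept A (P.chal η) (P.verify η) x (fun u => (H u).1)
    have hk : (0 : ℝ) < 2 ^ Fintype.card Key := by positivity
    have hs : (0 : ℝ) < 2 ^ Fintype.card Sel := by positivity
    have h4 := h2.trans (mul_le_mul_of_nonneg_left h3 hDpos.le)
    have h5 := mul_le_mul_of_nonneg_left h1
      (show (0 : ℝ) ≤ 2 * 2 ^ Fintype.card Sel * D by positivity)
    have h6 := mul_le_mul_of_nonneg_left h4 (show (0 : ℝ) ≤ 2 * (2 ^ Fintype.card Key)⁻¹ by positivity)
    rw [one_div, inv_pow, pow_add] at h5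
    refine le_trans (le_of_eq ?_) (h6.trans (le_trans (le_of_eq ?_) (h5.trans (le_of_eq ?_))))
    · field_simp
    · field_simp
    · ring
  have h1 := sum_finalState_le A (P.chal η) (P.verify η) X
  have h2 : P.fsSuccessProb A X = (∑ H : Bits (Fin (P.instLen η) ⊕ Fin (P.msgLen η)) → {c // c ∈ P.chal η},
      measureProb (finalState A fun u => (H u).1)
        {p | (fun i => p.1 (.inl (.inl i))) ∈ X ∧ P.verify η (fun i => p.1 (.inl (.inl i)))
          (fun i => p.1 (.inl (.inr i))) (H fun u => p.1 (.inl u)).1 fun z => p.1 (.inr (.inr z))}) / D := by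
    unfold SigmaProtocol.fsSuccessProb
    rw [hD, ← Fintype.card_congr (hashEquiv P η)]
    refine congrArg (· / _) ?_
    rw [← (hashEquiv P η).sum_comp]
    refine Finset.sum_congr rfl fun H _ => ?_
    rw [fsFinalState_eq]
    refine congrArg _ (Set.ext fun p => ?_)
    have := hashEquiv_apply P H p.1
    refine and_congr_right fun _ => ?_
    unfold SigmaProtocol.fsVerify
    rw [← this]
    rfl
  rw [h2, div_le_iff₀ hDpos]
  refine le_of_mul_le_mul_left (h1.trans ?_) hNpos
  rw [← mul_assoc, mul_comm N]
  refine le_trans (mul_le_mul_of_nonneg_left (Finset.sum_le_sum fun x _ => hx x) (by positivity))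
    (le_of_eq ?_)
  rw [← Finset.mul_sum]
  ring

theorem acceptProb_nonneg (A : P.Prover η) (x : BitString (P.instLen η)) : 0 ≤ P.acceptProb A x :=
  div_nonneg (Finset.sum_nonneg fun _ _ => Finset.sum_nonneg fun _ _ => measureProb_nonneg _ _)
    (Nat.cast_nonneg _)

theorem acceptProb_le_one (A : P.Prover η) (x : BitString (P.instLen η)) : P.acceptProb A x ≤ 1 := by
  classical
  unfold SigmaProtocol.acceptProb
  refine div_le_one_of_le₀ ?_ (Nat.cast_nonneg _)
  rw [← nsmul_one (P.chal η).card, ← Finset.sum_const]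
  refine Finset.sum_le_sum fun c _ => ?_
  set ψ := (A.step 0).1.mulVec A.init
  have hψ : normSq ψ = 1 := (normSq_mulVec (A.step 0).2 _).trans A.init_norm
  have hdel : ∀ φ : Bits (P.Wires η) × A.E → ℂ, normSq (P.deliver c φ) = normSq φ := by
    intro φ
    have hinv : Function.Involutive (fun p : Bits (P.Wires η) × A.E =>
        ((fun v => xor (p.1 v) (Sum.elim (zeros _) (Sum.elim c (zeros _)) v), p.2) :
          Bits (P.Wires η) × A.E)) := by
      rintro ⟨b, e⟩
      refine Prod.ext (funext fun v => ?_) rfl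
      simp
    exact normSq_comp_equiv (hinv.toPerm _) φ
  have h1 : ∀ a, measureProb ((A.step 1).1.mulVec (P.deliver c
      (({p | p.1 ∘ Sum.inl = a} : Set (Bits (P.Wires η) × A.E)).indicator ψ)))
      {p | P.verify η x a c (fun k => p.1 (Sum.inr (Sum.inr k)))}
        ≤ normSq (({p | p.1 ∘ Sum.inl = a} : Set (Bits (P.Wires η) × A.E)).indicator ψ) := fun a =>
    (measureProb_le_normSq _ _).trans (le_of_eq ((normSq_mulVec (A.step 1).2 _).trans (hdel _)))
  refine (Finset.sum_le_sum fun a _ => h1 a).trans (le_of_eq ?_)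
  rw [← hψ]
  unfold normSq
  rw [Finset.sum_comm]
  refine Finset.sum_congr rfl fun p _ => ?_
  rw [Finset.sum_eq_single (p.1 ∘ Sum.inl)]
  · rw [Set.indicator_of_mem (show p ∈ {p' : Bits (P.Wires η) × A.E | p'.1 ∘ Sum.inl = p.1 ∘ Sum.inl} from rfl)]
  · intro a _ ha
    rw [Set.indicator_of_notMem fun h => ha h.symm, norm_zero]
    exact zero_pow two_ne_zero
  · simp

end Total

/-! ### Polynomial bounds -/

theorem eval_mono (b : ℕ[X]) {n n' : ℕ} (h : n ≤ n') : b.eval n ≤ b.eval n' := by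
  rw [Polynomial.eval_eq_sum_range, Polynomial.eval_eq_sum_range]
  exact Finset.sum_le_sum fun i _ => Nat.mul_le_mul_left _ (Nat.pow_le_pow_left h i)

/-- Polynomially bounded in the security parameter and the number of queries. -/
def PolyBounded (f : ℕ → ℕ → ℕ) : Prop := ∃ b : ℕ[X], ∀ η q, f η q ≤ b.eval (η + q)

namespace PolyBounded

variable {f g : ℕ → ℕ → ℕ}

theorem mono (hg : PolyBounded g) (h : ∀ η q, f η q ≤ g η q) : PolyBounded f := by
  obtain ⟨b, hb⟩ := hg
  exact ⟨b, fun η q => (h η q).trans (hb η q)⟩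

theorem const (c : ℕ) : PolyBounded fun _ _ => c := ⟨Polynomial.C c, fun η q => by simp⟩

theorem queries : PolyBounded fun _ q => q := ⟨Polynomial.X, fun η q => by simp⟩

theorem of_le {f : ℕ → ℕ} (b : ℕ[X]) (h : ∀ η, f η ≤ b.eval η) : PolyBounded fun η _ => f η :=
  ⟨b, fun η _ => (h η).trans (eval_mono b (Nat.le_add_right _ _))⟩

theorem add (hf : PolyBounded f) (hg : PolyBounded g) : PolyBounded fun η q => f η q + g η q := by
  obtain ⟨b, hb⟩ := hf
  obtain ⟨c, hc⟩ := hg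
  refine ⟨b + c, fun η q => ?_⟩
  rw [Polynomial.eval_add]
  exact add_le_add (hb η q) (hc η q)

theorem mul (hf : PolyBounded f) (hg : PolyBounded g) : PolyBounded fun η q => f η q * g η q := by
  obtain ⟨b, hb⟩ := hf
  obtain ⟨c, hc⟩ := hg
  refine ⟨b * c, fun η q => ?_⟩
  rw [Polynomial.eval_mul]
  exact Nat.mul_le_mul (hb η q) (hc η q)

end PolyBounded

/-! ### The selector of the measured query -/

/-- The number of bits of the selector: enough to select one of `q + 1` queries and a flag, but such
that the number of all values is linear in `q`. -/
def selBits (q : ℕ) : ℕ := Nat.log 2 (q + 1) + 2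

theorem two_pow_selBits_le (q : ℕ) : 2 ^ selBits q ≤ 4 * (q + 1) := by
  have := Nat.pow_log_le_self 2 (Nat.succ_ne_zero q)
  rw [selBits, pow_add]
  simp only [Nat.succ_eq_add_one] at this
  omega

theorem exists_selEmb (q : ℕ) : Nonempty (Fin (q + 1) × Bool ↪ BitString (selBits q)) := by
  refine Function.Embedding.nonempty_of_card_le ?_
  rw [Fintype.card_prod, Fintype.card_fin, Fintype.card_bool, Fintype.card_fun, Fintype.card_bool,
    Fintype.card_fin, selBits]
  have := Nat.lt_pow_succ_log_self (b := 2) (by norm_num) (q + 1)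
  rw [pow_succ]
  simp only [Nat.succ_eq_add_one] at this
  omega

/-- Queries and flags, encoded as values of the selector. -/
def selEmb (q : ℕ) : Fin (q + 1) × Bool ↪ BitString (selBits q) := (exists_selEmb q).some

/-- The query that is measured. -/
def selIdx (q : ℕ) : BitString (selBits q) → ℕ := Function.extend (selEmb q) (fun r => r.1) 0

/-- The flag that tells whether the measured query is answered before the hash function is
reprogrammed. -/
def selFlag (q : ℕ) : BitString (selBits q) → Bool :=
  Function.extend (selEmb q) (fun r => r.2) fun _ => false

theorem selIdx_selEmb (q : ℕ) (r : Fin (q + 1) × Bool) : selIdx q (selEmb q r) = r.1 :=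
  (selEmb q).injective.extend_apply _ _ _

theorem selFlag_selEmb (q : ℕ) (r : Fin (q + 1) × Bool) : selFlag q (selEmb q r) = r.2 :=
  (selEmb q).injective.extend_apply _ _ _

/-! ### The extractor for the Fiat-Shamir transform -/

section Extraction

variable (P : SigmaProtocol)

/-- The type of the hash scheme used against adversaries with `q` queries, with field elements of
`n` bits and `a` ancillas for the sampler. -/
abbrev QueryScheme (η q n a : ℕ) : Type :=
  HashScheme (Fin (P.instLen η) ⊕ Fin (P.msgLen η)) (Fin (4 * q) × Fin n)
    (HashAnc n (4 * q) (P.chalLen η) a) (P.chalLen η)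

/-- If challenges can be sampled efficiently, there are efficient hash schemes. -/
theorem exists_queryScheme (hS : P.ChallengeSamplable) :
    ∃ (B : ℕ[X]) (n a : ℕ → ℕ), (∀ η, n η ≤ B.eval η) ∧ (∀ η, a η ≤ B.eval η) ∧
      ∀ η q, ∃ h : QueryScheme P η q (n η) (a η),
        h.HalfFools (P.chal η) (4 * q) ∧ h.circuit.cost ≤ (4 * q + 1) * B.eval η := by
  obtain ⟨b, hb⟩ := hS
  obtain ⟨len, hlen⟩ := P.len_poly
  let L : ℕ → ℕ := fun η => Fintype.card (Fin (P.instLen η) ⊕ Fin (P.msgLen η))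
  have hL : ∀ η, L η = P.instLen η + P.msgLen η := fun η => by simp [L]
  -- the precision is exponentially small in the length of the queries, at polynomial cost
  choose k anc f C hk hcost hf hunif hC using fun η => hb η (P.chalLen η + L η + 2)
  choose a ha hsch using fun η => exists_hashScheme (P.chal_nonempty η) (f η) (C η) (hf η) (hC η)
    (hunif η)
  let D : ℕ[X] := b.comp (Polynomial.X + (len + 2))
  have hD : ∀ η, b.eval (η + (P.chalLen η + L η + 2)) ≤ D.eval η := by
    intro η
    simp only [D, Polynomial.eval_comp, Polynomial.eval_add, Polynomial.eval_X]
    refine eval_mono b ?_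
    have := hlen η
    rw [hL]
    simp only [Polynomial.eval_ofNat]
    omega
  let N : ℕ[X] := len + D + 1
  have hN : ∀ η, N.eval η = len.eval η + D.eval η + 1 := fun η => by simp [N]
  have hn : ∀ η, L η + k η + 1 ≤ N.eval η := by
    intro η
    have h1 := hlen η
    have h2 := (hk η).trans (hD η)
    rw [hN, hL]
    omega
  have hB : ∀ η, (N + (N + N * (N * N)) * 64).eval η
      = N.eval η + (N.eval η + N.eval η * (N.eval η * N.eval η)) * 64 := fun η => by simp
  refine ⟨N + (N + N * (N * N)) * 64, fun η => L η + k η + 1, a, fun η => ?_, fun η => ?_,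
    fun η q => ?_⟩
  · rw [hB]
    exact (hn η).trans (Nat.le_add_right _ _)
  · have h1 := (ha η).trans ((hcost η).trans (hD η))
    rw [hB, hN]
    omega
  · obtain ⟨h, h1, h2⟩ := hsch η (4 * q)
    refine ⟨h, h1, h2.trans ?_⟩
    have h3 : (C η).cost ≤ N.eval η := by
      have := (hcost η).trans (hD η)
      rw [hN]
      omega
    have h4 : L η ≤ N.eval η := le_trans (by omega) (hn η)
    have h5 : (L η + k η + 1) + (L η + k η + 1) * ((L η + k η + 1) * L η)
        ≤ N.eval η + N.eval η * (N.eval η * N.eval η) :=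
      add_le_add (hn η) (Nat.mul_le_mul (hn η) (Nat.mul_le_mul (hn η) h4))
    rw [hB]
    calc 4 * q * ((L η + k η + 1) + (L η + k η + 1) * ((L η + k η + 1) * L η)) * 64 + (C η).cost
        ≤ 4 * q * (N.eval η + N.eval η * (N.eval η * N.eval η)) * 64 + N.eval η :=
          add_le_add (Nat.mul_le_mul_right _ (Nat.mul_le_mul_left _ h5)) h3
      _ ≤ _ := by nlinarith [Nat.zero_le (4 * q * N.eval η),
          Nat.zero_le ((N.eval η + N.eval η * (N.eval η * N.eval η)) * 64)]

variable {P} {n a : ℕ → ℕ} (h : ∀ η q, QueryScheme P η q (n η) (a η))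

/-- The extractor for the Fiat-Shamir transform: the static extractor, applied to the derived
provers. -/
def fsExtractor (K : P.Extractor) : P.FSExtractor := fun η q =>
  extractor (prepProgram (h η q) (selIdx q)) (respondProgram (h η q) (selIdx q) (selFlag q)) (K η)

/-- The prover derived from an adversary with `q` queries that holds the instance `x`. -/
def fsProver {η q : ℕ} (A : P.FSAdversary η q) (x : BitString (P.instLen η)) : P.Prover η :=
  derivedProver P A (h η q) (selIdx q) (selFlag q) x

/-- The probability that the derived prover holds the instance `x`. -/
def fsInstProb {η q : ℕ} (A : P.FSAdversary η q) (x : BitString (P.instLen η)) : ℝ :=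
  instProb A (prepProgram (Sel := Fin (selBits q)) (h η q) (selIdx q)) x

theorem outputProb_fsExtractor (K : P.Extractor) {η q : ℕ} (A : P.FSAdversary η q)
    (X : Set (BitString (P.instLen η))) [DecidablePred (· ∈ X)] :
    (fsExtractor h K η q).outputProb A Empty.elim
        {o | o ∘ Sum.inl ∈ X ∧ P.rel η (o ∘ Sum.inl) (o ∘ Sum.inr)}
      = ∑ x with x ∈ X, fsInstProb h A x * (K η).outputProb (fsProver h A x) x {w | P.rel η x w} :=
  outputProb_extractor A _ _ (off_respondProgram A (h η q) _ _)
    (fun x => keeps_respondProgram A (h η q) _ _ x) (K η) X (P.rel η)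

/-- The bound of `fsSuccessProb_le` with its factor `2 * 2 ^ selBits q * (2q + 1)` estimated; for `q
= 0`, `q` is read as 1. -/
theorem fsSuccessProb_le_sum (hh : ∀ η q, (h η q).HalfFools (P.chal η) (4 * q)) {η q : ℕ}
    (A : P.FSAdversary η q) (X : Set (BitString (P.instLen η))) [DecidablePred (· ∈ X)] :
    P.fsSuccessProb A X ≤ 48 * ((max q 1 : ℕ) : ℝ) ^ 2 *
      ∑ x with x ∈ X, fsInstProb h A x * P.acceptProb (fsProver h A x) x := by
  refine (fsSuccessProb_le P A (h η q) (hh η q) (selIdx q) (selFlag q) (selEmb q) (selIdx_selEmb q)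
    (selFlag_selEmb q) X).trans (mul_le_mul_of_nonneg_right ?_ (Finset.sum_nonneg fun x _ =>
      mul_nonneg (instProb_nonneg _ _ _) (acceptProb_nonneg _ _ _)))
  rw [Fintype.card_fin]
  have h1 : (2 : ℝ) ^ selBits q ≤ 4 * (q + 1) := by exact_mod_cast two_pow_selBits_le q
  have h2 : (q : ℝ) ≤ (max q 1 : ℕ) := by exact_mod_cast le_max_left q 1
  have h3 : (1 : ℝ) ≤ (max q 1 : ℕ) := by exact_mod_cast le_max_right q 1
  set μ : ℝ := ((max q 1 : ℕ) : ℝ)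
  have h0 : (0 : ℝ) ≤ q := Nat.cast_nonneg q
  have h4 : (2 : ℝ) ^ selBits q ≤ 8 * μ := by linarith
  have h5 : (2 * q + 1 : ℝ) ≤ 3 * μ := by linarith
  calc 2 * (2 : ℝ) ^ selBits q * (2 * q + 1) ≤ 2 * (8 * μ) * (3 * μ) := by gcongr
    _ = _ := by ring

end Extraction

/-! ### The extractor and the derived provers have polynomial size -/

section Size

variable {P : SigmaProtocol} {n a : ℕ → ℕ} (h : ∀ η q, QueryScheme P η q (n η) (a η))

theorem polyBounded_len : ∃ len : ℕ → ℕ, PolyBounded (fun η _ => len η) ∧ ∀ η, P.instLen η ≤ len η ∧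
    P.msgLen η ≤ len η ∧ P.chalLen η ≤ len η ∧ P.respLen η ≤ len η := by
  obtain ⟨b, hb⟩ := P.len_poly
  refine ⟨fun η => b.eval η, .of_le b fun _ => le_rfl, fun η => ?_⟩
  have := hb η
  beta_reduce
  omega

/-- Toggles conditioned on the selector have cost exponential in its length, which is logarithmic in
`q`. -/
theorem four_pow_selBits (k : ℕ) : PolyBounded fun _ q => 4 * 4 ^ (selBits q + k) := by
  refine PolyBounded.mono (g := fun _ q => 4 * (4 * (q + 1) * (4 * (q + 1)) * 4 ^ k))
    ((PolyBounded.const _).mul ((((PolyBounded.const _).mul (.add .queries (.const _))).mul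
      ((PolyBounded.const _).mul (.add .queries (.const _)))).mul (.const _))) fun η q => ?_
  rw [pow_add, show (4 : ℕ) ^ selBits q = 2 ^ selBits q * 2 ^ selBits q from mul_pow 2 2 _]
  exact Nat.mul_le_mul_left _ (Nat.mul_le_mul_right _
    (Nat.mul_le_mul (two_pow_selBits_le q) (two_pow_selBits_le q)))

theorem polyBounded_selBits : PolyBounded fun _ q => selBits q := by
  refine .mono (four_pow_selBits 0) fun _ q => ?_
  have : selBits q < 4 ^ selBits q := Nat.lt_pow_self (by norm_num)
  rw [add_zero]
  omega

theorem polyBounded_roundCost (hcost : PolyBounded fun η q => (h η q).circuit.cost) :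
    PolyBounded fun η q => roundCost (Fin (P.instLen η)) (Fin (P.msgLen η)) (Fin (selBits q))
      (P.chalLen η) (h η q).circuit.cost := by
  obtain ⟨len, hlen, hl⟩ := polyBounded_len (P := P)
  refine PolyBounded.mono ((((PolyBounded.const 2).mul (hcost.add (((hlen.add hlen).add (.const 1)).mul
    (.const 256)))).add (hlen.mul (four_pow_selBits 4))).add
      (((PolyBounded.const 2).mul (four_pow_selBits 1)).add (.const 2))) fun η q => ?_
  obtain ⟨h1, h2, h3, h4⟩ := hl η
  unfold roundCost
  rw [Fintype.card_sum, Fintype.card_fin, Fintype.card_fin, Fintype.card_fin]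
  gcongr

theorem polyBounded_prepProgram (hn : PolyBounded fun η _ => n η)
    (hcost : PolyBounded fun η q => (h η q).circuit.cost) :
    PolyBounded fun η q => Program.cost (prepProgram (Z := Fin (P.respLen η)) (q := q) (h η q) (selIdx q)) := by
  obtain ⟨len, hlen, hl⟩ := polyBounded_len (P := P)
  refine PolyBounded.mono ((((((PolyBounded.const 4).mul .queries).mul hn).add polyBounded_selBits).mul (.const 4)).add
    (PolyBounded.queries.mul (polyBounded_roundCost h hcost)) |>.add ((hlen.add hlen).mul (.const 16)))
    fun η q => (prepProgram_cost (h η q) (selIdx q)).trans ?_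
  obtain ⟨h1, h2, h3, h4⟩ := hl η
  rw [Fintype.card_sum, Fintype.card_prod, Fintype.card_fin, Fintype.card_fin, Fintype.card_fin,
    Fintype.card_fin, Fintype.card_fin]
  gcongr

theorem polyBounded_respondProgram (hcost : PolyBounded fun η q => (h η q).circuit.cost) :
    PolyBounded fun η q => CProgram.bound
      (respondProgram (Z := Fin (P.respLen η)) (q := q) (h η q) (selIdx q) (selFlag q)) := by
  obtain ⟨len, hlen, hl⟩ := polyBounded_len (P := P)
  refine PolyBounded.mono ((PolyBounded.queries.mul (polyBounded_roundCost h hcost)).add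
    (hlen.mul (.const 64))) fun η q => (respondProgram_bound (h η q) (selIdx q) (selFlag q)).trans ?_
  obtain ⟨h1, h2, h3, h4⟩ := hl η
  rw [Fintype.card_fin]
  gcongr

theorem polyTime_fsExtractor (hn : PolyBounded fun η _ => n η)
    (hcost : PolyBounded fun η q => (h η q).circuit.cost) {K : P.Extractor} (hK : K.PolyTime) :
    (fsExtractor h K).PolyTime := by
  obtain ⟨len, hlen, hl⟩ := polyBounded_len (P := P)
  obtain ⟨b, hb⟩ := hK
  refine PolyBounded.mono (((polyBounded_prepProgram h hn hcost).add (hlen.mul (.const 16))).add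
    ((PolyBounded.of_le b hb).mul ((polyBounded_respondProgram h hcost).add (.const 1))))
    fun η q => (extractor_cost _ _ (K η)).trans ?_
  obtain ⟨h1, h2, h3, h4⟩ := hl η
  rw [Fintype.card_fin]
  gcongr

/-- The derived provers are efficient if the adversary is, with a bound that does not depend on the
instances held. -/
theorem hasCircuits_fsProver (hn : PolyBounded fun η _ => n η) (ha : PolyBounded fun η _ => a η)
    (hcost : PolyBounded fun η q => (h η q).circuit.cost) (A : ∀ η, Σ q, P.FSAdversary η q)
    {b : ℕ[X]} (hA : ∀ η, (A η).1 ≤ b.eval η ∧ (A η).2.HasCircuits (b.eval η)) :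
    ∃ B : ℕ[X], ∀ (x : ∀ η, BitString (P.instLen η)) η,
      (fsProver h (A η).2 (x η)).HasCircuits (B.eval η) := by
  obtain ⟨len, hlen, hl⟩ := polyBounded_len (P := P)
  obtain ⟨c, hc⟩ := polyBounded_respondProgram h hcost
  -- the number of wires held by the derived prover besides the communication wires
  have hcard : PolyBounded fun η q => Fintype.card (Inner (P.FSWires η) (Fin (P.instLen η))
      ((Fin (4 * q) × Fin (n η)) ⊕ Fin (selBits q) ⊕ ProverAnc (Fin (P.instLen η)) (Fin (P.msgLen η))
        (HashAnc (n η) (4 * q) (P.chalLen η) (a η)))) := by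
    refine PolyBounded.mono (((hlen.add hlen).add (hlen.add hlen)).add (hlen.add
      ((((PolyBounded.const 4).mul .queries).mul hn).add (polyBounded_selBits.add
        (((((PolyBounded.const 4).mul .queries).add (.const 1)).mul hn |>.add (hlen.add ha)).add
          (((hlen.add hlen).add (.const 1)).add (.const 1))))))) fun η q => ?_
    obtain ⟨h1, h2, h3, h4⟩ := hl η
    simp only [Fintype.card_sum, Fintype.card_prod, Fintype.card_fin, Fintype.card_unit]
    gcongr
  obtain ⟨w, hw⟩ := hcard
  refine ⟨w.comp (Polynomial.X + b) + b + c.comp (Polynomial.X + b) * (4 * b + 1), fun x η => ?_⟩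
  have hq : η + (A η).1 ≤ (Polynomial.X + b).eval η := by
    rw [Polynomial.eval_add, Polynomial.eval_X]
    exact Nat.add_le_add_left (hA η).1 _
  have e : (w.comp (Polynomial.X + b) + b + c.comp (Polynomial.X + b) * (4 * b + 1)).eval η
      = w.eval ((Polynomial.X + b).eval η) + b.eval η +
        c.eval ((Polynomial.X + b).eval η) * (4 * b.eval η + 1) := by
    simp [Polynomial.eval_comp]
  rw [e]
  refine programAdversary_hasCircuits (A η).2 _ _ (normSq_normalise _ _) (hA η).2 ?_ ?_
  · exact (Nat.add_le_add_right ((hw η _).trans (eval_mono w hq)) _).trans (Nat.le_add_right _ _)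
  · refine le_trans (Nat.mul_le_mul_right _ ?_) (Nat.le_add_left _ _)
    exact (CProgram.plain_cost _).trans ((hc η _).trans (eval_mono c hq))

end Size

/-! ### From static to adaptive extraction -/

section Transfer

variable {P : SigmaProtocol} {n a : ℕ → ℕ} (h : ∀ η q, QueryScheme P η q (n η) (a η))

/-- The success of the adaptive extractor, from the success of the static one with the derived
provers, by convexity. -/
theorem fsExtractor_success (hh : ∀ η q, (h η q).HalfFools (P.chal η) (4 * q)) (K : P.Extractor)
    {η q : ℕ} (A : P.FSAdversary η q) (X : Set (BitString (P.instLen η))) {p d κ : ℝ} (hp : 0 < p)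
    (hd : 0 ≤ d) (hK : ∀ x ∈ X, 1 / p * P.acceptProb (fsProver h A x) x ^ d - κ
      ≤ (K η).outputProb (fsProver h A x) x {w | P.rel η x w}) :
    1 / (((max q 1 : ℕ) : ℝ) ^ (2 * max d 1) * (48 ^ max d 1 * p)) * P.fsSuccessProb A X ^ max d 1 - |κ|
      ≤ (fsExtractor h K η q).outputProb A Empty.elim
        {o | o ∘ Sum.inl ∈ X ∧ P.rel η (o ∘ Sum.inl) (o ∘ Sum.inr)} := by
  classical
  set d' := max d 1 with hd'
  have hd1 : 1 ≤ d' := le_max_right _ _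
  have hd0 : d' ≠ 0 := by linarith
  rw [outputProb_fsExtractor]
  set w := fun x => fsInstProb h A x with hw
  set α := fun x => P.acceptProb (fsProver h A x) x with hα
  have hw0 : ∀ x, 0 ≤ w x := fun x => instProb_nonneg _ _ _
  have hw1 : ∑ x, w x = 1 := sum_instProb _ _
  have hα0 : ∀ x, 0 ≤ α x := fun x => acceptProb_nonneg _ _ _
  have hα1 : ∀ x, α x ≤ 1 := fun x => acceptProb_le_one _ _ _
  set m : ℝ := ((max q 1 : ℕ) : ℝ) with hm
  have hm1 : 1 ≤ m := by
    rw [hm]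
    exact_mod_cast le_max_right q 1
  have hm0 : 0 < m := lt_of_lt_of_le one_pos hm1
  have hsucc : P.fsSuccessProb A X ≤ 48 * m ^ 2 * ∑ x with x ∈ X, w x * α x :=
    fsSuccessProb_le_sum h hh A X
  have hsucc0 : 0 ≤ P.fsSuccessProb A X :=
    div_nonneg (Finset.sum_nonneg fun _ _ => measureProb_nonneg _ _) (Nat.cast_nonneg _)
  have hjensen : (∑ x with x ∈ X, w x * α x) ^ d' ≤ ∑ x with x ∈ X, w x * α x ^ d' := by
    have h1 := Real.rpow_arith_mean_le_arith_mean_rpow Finset.univ w (fun x => if x ∈ X then α x else 0)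
      (fun x _ => hw0 x) hw1 (fun x _ => by split_ifs; exacts [hα0 x, le_rfl]) hd1
    rw [Finset.sum_filter, Finset.sum_filter]
    simp only [mul_ite, mul_zero] at h1
    refine h1.trans (le_of_eq (Finset.sum_congr rfl fun x _ => ?_))
    split_ifs
    · rfl
    · rw [Real.zero_rpow hd0, mul_zero]
  have hpow : P.fsSuccessProb A X ^ d'
      ≤ m ^ (2 * d') * 48 ^ d' * ∑ x with x ∈ X, w x * α x ^ d' := by
    refine (Real.rpow_le_rpow hsucc0 hsucc (by linarith)).trans ?_
    rw [Real.mul_rpow (by positivity) (Finset.sum_nonneg fun x _ => mul_nonneg (hw0 x) (hα0 x)),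
      Real.mul_rpow (by norm_num) (by positivity), ← Real.rpow_natCast m 2, ← Real.rpow_mul hm0.le,
      mul_comm ((48 : ℝ) ^ d')]
    exact mul_le_mul_of_nonneg_left hjensen (by positivity)
  have hterm : ∀ x ∈ X, 1 / p * (w x * α x ^ d') - w x * |κ|
      ≤ w x * (K η).outputProb (fsProver h A x) x {w | P.rel η x w} := by
    intro x hx
    -- for `d < 1` the larger exponent `1` gives a weaker bound, as probabilities are at most 1
    have h1 : α x ^ d' ≤ α x ^ d :=
      Real.rpow_le_rpow_of_exponent_ge' (hα0 x) (hα1 x) hd (le_max_left _ _)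
    have h2 : 1 / p * α x ^ d' - |κ| ≤ (K η).outputProb (fsProver h A x) x {w | P.rel η x w} := by
      refine le_trans ?_ (hK x hx)
      have := mul_le_mul_of_nonneg_left h1 (one_div_pos.2 hp).le
      have := le_abs_self κ
      linarith
    refine le_trans (le_of_eq ?_) (mul_le_mul_of_nonneg_left h2 (hw0 x))
    ring
  refine le_trans ?_ (Finset.sum_le_sum fun x hx => hterm x (Finset.mem_filter.1 hx).2)
  rw [Finset.sum_sub_distrib, ← Finset.mul_sum, ← Finset.sum_mul]
  refine sub_le_sub ?_ ?_
  · rw [one_div, one_div, inv_mul_le_iff₀ (by positivity)]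
    refine hpow.trans (le_of_eq ?_)
    field_simp
  · refine mul_le_of_le_one_left (abs_nonneg κ) (le_trans ?_ hw1.le)
    exact Finset.sum_le_univ_sum_of_nonneg hw0

theorem negligible_abs {κ : ℕ → ℝ} (hκ : Negligible κ) : Negligible fun η => |κ η| :=
  Asymptotics.SuperpolynomialDecay.trans_abs_le hκ fun η => (abs_abs (κ η)).le

/-- If the static extractor succeeds with all provers of a class, so does the adaptive one. -/
theorem fsAdaptiveExtracts (hh : ∀ η q, (h η q).HalfFools (P.chal η) (4 * q))
    (hn : PolyBounded fun η _ => n η) (ha : PolyBounded fun η _ => a η)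
    (hcost : PolyBounded fun η q => (h η q).circuit.cost) {K : P.Extractor} (s : Security) {p : ℝ[X]}
    (hp : ∀ η : ℕ, 0 < p.eval (η : ℝ)) {d : ℝ} (hd : 0 ≤ d) (hK : P.StaticExtracts s K p d) :
    P.FSAdaptiveExtracts s (fsExtractor h K) (Polynomial.C (48 ^ max d 1) * p) (max d 1)
      (2 * max d 1) := by
  classical
  have hmain : ∀ (A : ∀ η, Σ q, P.FSAdversary η q) (κ : ℕ → ℝ),
      (∀ η, ∀ x ∈ P.inst η, 1 / p.eval (η : ℝ) * P.acceptProb (fsProver h (A η).2 x) x ^ d - κ η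
        ≤ (K η).outputProb (fsProver h (A η).2 x) x {w | P.rel η x w}) →
      ∀ η, ∀ X ⊆ P.inst η,
        1 / ((max (A η).1 1 : ℕ) ^ (2 * max d 1) * (Polynomial.C (48 ^ max d 1) * p).eval (η : ℝ)) *
            P.fsSuccessProb (A η).2 X ^ max d 1 - |κ η|
          ≤ (fsExtractor h K η (A η).1).outputProb (A η).2 Empty.elim
            {o | o ∘ Sum.inl ∈ X ∧ P.rel η (o ∘ Sum.inl) (o ∘ Sum.inr)} := by
    intro A κ hA η X hX
    rw [Polynomial.eval_mul, Polynomial.eval_C]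
    exact fsExtractor_success h hh K (A η).2 X (hp η) hd fun x hx => hA η x (hX hx)
  -- an instance at one value of the security parameter, completed to a family
  have hfam : ∀ (η : ℕ) (x : BitString (P.instLen η)), ∃ y : ∀ η, BitString (P.instLen η), y η = x :=
    fun η x => ⟨Function.update (fun _ => zeros _) η x, Function.update_self _ _ _⟩
  cases s with
  | statistical =>
    obtain ⟨κ, hκ, hK⟩ := hK
    refine ⟨fun η => |κ η|, negligible_abs hκ, fun A => hmain A κ fun η x hx => ?_⟩
    obtain ⟨y, rfl⟩ := hfam η x
    exact hK (fun η => fsProver h (A η).2 (y η)) η _ hx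
  | computational =>
    obtain ⟨κ, hκ, hK⟩ := hK
    refine ⟨fun η => |κ η|, negligible_abs hκ, fun A hA => hmain A κ fun η x hx => ?_⟩
    obtain ⟨b, hb⟩ := hA
    obtain ⟨B, hB⟩ := hasCircuits_fsProver h hn ha hcost A hb
    obtain ⟨y, rfl⟩ := hfam η x
    exact hK (fun η => fsProver h (A η).2 (y η)) ⟨B, hB y⟩ η _ hx
  | computationalPerAdversary =>
    intro A hA
    obtain ⟨b, hb⟩ := hA
    obtain ⟨B, hB⟩ := hasCircuits_fsProver h hn ha hcost A hb
    -- the error for the worst instances bounds the error for all instances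
    have hworst : ∀ η, ∃ y : BitString (P.instLen η), (P.inst η).Nonempty → y ∈ P.inst η ∧
        ∀ x ∈ P.inst η,
          1 / p.eval (η : ℝ) * P.acceptProb (fsProver h (A η).2 x) x ^ d -
            (K η).outputProb (fsProver h (A η).2 x) x {w | P.rel η x w}
          ≤ 1 / p.eval (η : ℝ) * P.acceptProb (fsProver h (A η).2 y) y ^ d -
            (K η).outputProb (fsProver h (A η).2 y) y {w | P.rel η y w} := by
      intro η
      by_cases hne : (P.inst η).Nonempty
      · obtain ⟨y, hy, hmax⟩ := Set.exists_max_image (P.inst η)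
          (fun x => 1 / p.eval (η : ℝ) * P.acceptProb (fsProver h (A η).2 x) x ^ d -
            (K η).outputProb (fsProver h (A η).2 x) x {w | P.rel η x w}) (Set.toFinite _) hne
        exact ⟨y, fun _ => ⟨hy, hmax⟩⟩
      · exact ⟨zeros _, fun hne' => absurd hne' hne⟩
    choose y hy using hworst
    obtain ⟨κ, hκ, hK⟩ := hK (fun η => fsProver h (A η).2 (y η)) ⟨B, hB y⟩
    refine ⟨fun η => |κ η|, negligible_abs hκ, hmain A κ fun η x hx => ?_⟩
    obtain ⟨hy1, hy2⟩ := hy η ⟨x, hx⟩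
    have h1 := hK η (y η) hy1
    have h2 := hy2 x hx
    linarith

end Transfer

end FiatShamir

end

theorem corollary2 (P : FiatShamir.SigmaProtocol)
    (hC : FiatShamir.Superpolynomial fun η => (P.chal η).card)
    (hS : P.ChallengeSamplable) :
    (∀ s : FiatShamir.Security, P.IsStaticPoK s → P.FSIsAdaptivePoK s) ∧
    (∀ K : P.Extractor, K.PolyTime →
      ∃ E : P.FSExtractor, E.PolyTime ∧
        ∀ d : ℝ, 0 ≤ d → ∃ c : ℝ, 0 < c ∧
          ∀ (s : FiatShamir.Security) (p : Polynomial ℝ), (∀ η : ℕ, 0 < p.eval (η : ℝ)) →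
            P.StaticExtracts s K p d →
              P.FSAdaptiveExtracts s E (Polynomial.C c * p) (max d 1) (2 * max d 1)) := by
  obtain ⟨B, n, a, hn, ha, hsch⟩ := FiatShamir.exists_queryScheme P hS
  choose h hh hcost using hsch
  have hcost' : FiatShamir.PolyBounded fun η q => (h η q).circuit.cost :=
    .mono ((((FiatShamir.PolyBounded.const 4).mul .queries).add (.const 1)).mul
      (.of_le B fun _ => le_rfl)) hcost
  have key : ∀ K : P.Extractor, K.PolyTime →
      ∃ E : P.FSExtractor, E.PolyTime ∧
        ∀ d : ℝ, 0 ≤ d → ∃ c : ℝ, 0 < c ∧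
          ∀ (s : FiatShamir.Security) (p : Polynomial ℝ), (∀ η : ℕ, 0 < p.eval (η : ℝ)) →
            P.StaticExtracts s K p d →
              P.FSAdaptiveExtracts s E (Polynomial.C c * p) (max d 1) (2 * max d 1) := by
    intro K hK
    refine ⟨FiatShamir.fsExtractor h K, FiatShamir.polyTime_fsExtractor h (.of_le B hn) hcost' hK,
      fun d hd => ⟨48 ^ max d 1, by positivity, fun s p hp hKs => ?_⟩⟩
    exact FiatShamir.fsAdaptiveExtracts h hh (.of_le B hn) (.of_le B ha) hcost' s hp hd hKs
  refine ⟨fun s => ?_, key⟩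
  rintro ⟨K, p, d, hK, hp, hd, hKs⟩
  obtain ⟨E, hE, hEd⟩ := key K hK
  obtain ⟨c, hc, hcs⟩ := hEd d hd
  refine ⟨E, Polynomial.C c * p, max d 1, 2 * max d 1, hE, fun η => ?_,
    hd.trans (le_max_left _ _), mul_nonneg zero_le_two (hd.trans (le_max_left _ _)), hcs s p hp hKs⟩
  rw [Polynomial.eval_mul, Polynomial.eval_C]
  exact mul_pos hc (hp η)
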